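/- Let $n,p,q$ be integers with $q\ge 1$, $2q\le n$ and $0\le p\le n-2q$. For an $n$-dimensional smooth Riemannian manifold $(M,g)$ with Riemann curvature tensor $R$, regarded as a symmetric $(2,2)$ double form, let $R^q$ be the $q$-fold exterior power of $R$ in the algebra of double forms (the Gauss--Kronecker tensor), a $(2q,2q)$ double form, and let $$R^{(p,q)}_{i_1\dots i_p,\,j_1\dots j_p}=\frac1{((2q)!)^2}\sum_{|A|=|B|=2q}\delta^{A\,i_1\dots i_p}_{B\,j_1\dots j_p}\,R^q_{A,B}$$ be the $(p,q)$-curvature tensor; here components are taken in an orthonormal frame, $A,B$ run over all multi-indices of length $2q$, and $\delta$ is the generalized Kronecker delta. Let $L_p$ be the linear operator from $(2q,2q)$ to $(p,p)$ double forms given by the same formula, so that $R^{(p,q)}=L_p(R^q)$. Convention: $g^{m}=0$ for $m<0$. (1) At every point of every such manifold there is a unique decomposition $$R^q=\sum_{i=0}^{2q} g^{2q-i}\omega_i$$ in which each $\omega_i$ is a trace-free $(i,i)$ double form and $\omega_i=0$ for $i>n-2q$ (for these $i$ the summand $g^{2q-i}\omega_i$ vanishes for dimensional reasons). (2) There are real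 coefficients $a_0,a_1,\dots$, depending only on $n,p,q$, with $a_i=0$ for $i>p$, such that at every point of every such manifold $L_p(g^{2q-i}\omega_i)=a_i\,g^{p-i}\omega_i$ for $0\le i\le 2q$, and hence $$R^{(p,q)}=\sum_{i=0}^{2q}a_i\,g^{p-i}\omega_i .$$ Moreover, one has $a_i\ne 0$ for every $i\in\{0,\dots,2q\}$ such that $\omega_i$ is nonzero at some point of some $n$-dimensional Riemannian manifold if and only if $p\ge\min\{2q,\,n-2q\}$. (3) All components $\omega_i$ of $R^q$ contribute effectively to $R^{(p,q)}$ if and only if $p\ge \min\{2q,\,n-2q\}$. That is: the statement "at every point of every $n$-dimensional Riemannian manifold, every nonzero component $\omega_i$ $(0\le i\le 2q)$ has a nonzero contribution $L_p(g^{2q-i}\omega_i)$ to $R^{(p,q)}$" holds if and only if $p\ge\min\{2q,\,n-2q\}$. -/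

import Mathlib

open scoped Manifold ContDiff

noncomputable section

namespace DoubleForms

/-! ### Double forms on a real vector space

`T : Tensor2 V k` is evaluated as `T v w`, with `k` arguments in each of the two slots. -/

/-- Real valued functions of two `k`-tuples of vectors. -/
abbrev Tensor2 (V : Type) (k : ℕ) : Type := (Fin k → V) → (Fin k → V) → ℝ

section Algebra

variable {V : Type}

/-- `T` is a `(k,k)` double form: multilinear and alternating in each group of `k` arguments. -/
def IsDoubleForm [AddCommGroup V] [Module ℝ V] {k : ℕ} (T : Tensor2 V k) : Prop :=
  ∃ Ω : V [⋀^Fin k]→ₗ[ℝ] (V [⋀^Fin k]→ₗ[ℝ] ℝ), ∀ v w, T v w = Ω v w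

/-- The exterior product `g θ` of the `(1,1)` double form `g` with a `(k,k)` double form. -/
def metricMul (g : V → V → ℝ) {k : ℕ} (θ : Tensor2 V k) : Tensor2 V (k + 1) := fun v w =>
  ∑ a : Fin (k + 1), ∑ b : Fin (k + 1),
    (-1 : ℝ) ^ ((a : ℕ) + (b : ℕ)) * g (v a) (w b) *
      θ (fun s => v (a.succAbove s)) (fun s => w (b.succAbove s))

/-- `metricPow g m θ` is the `(m,m)` double form `g ^ (m - i) θ` for a `(i,i)` double form `θ`,
with the convention that it is zero if `m < i` (negative powers of `g` are zero). -/
def metricPow (g : V → V → ℝ) {i : ℕ} : (m : ℕ) → Tensor2 V i → Tensor2 V m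
  | 0, θ => if h : i = 0 then h ▸ θ else 0
  | m + 1, θ => if h : i = m + 1 then h ▸ θ else metricMul g (metricPow g m θ)

/-- The contraction map on double forms, computed in an orthonormal frame `e`. -/
def contract {n : ℕ} (e : Fin n → V) {k : ℕ} (θ : Tensor2 V (k + 1)) : Tensor2 V k := fun v w =>
  ∑ a : Fin n, θ (Fin.cons (e a) v) (Fin.cons (e a) w)

/-- The `q`-fold exterior power of a `(2,2)` double form `R` (the Gauss-Kronecker tensor, if `R` is
the Riemann tensor):
`4 ^ (-q) ∑ sgn σ sgn τ ∏_l R(v_{σ(2l)}, v_{σ(2l+1)}, w_{τ(2l)}, w_{τ(2l+1)})`. -/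
def gaussKronecker (R : V → V → V → V → ℝ) (q : ℕ) : Tensor2 V (2 * q) := fun v w =>
  (1 / 4 : ℝ) ^ q * ∑ σ : Equiv.Perm (Fin (2 * q)), ∑ τ : Equiv.Perm (Fin (2 * q)),
    ((Equiv.Perm.sign σ : ℤ) : ℝ) * ((Equiv.Perm.sign τ : ℤ) : ℝ) *
      ∏ l : Fin q,
        R (v (σ ⟨2 * l, by omega⟩)) (v (σ ⟨2 * l + 1, by omega⟩))
          (w (τ ⟨2 * l, by omega⟩)) (w (τ ⟨2 * l + 1, by omega⟩))

/-- The generalized Kronecker delta `δ^{u_1 ... u_m}_{w_1 ... w_m}`, as the covariant tensor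
`det (g (u_r, w_s))`; on the vectors of an orthonormal frame this is the usual symbol. -/
def kronecker (g : V → V → ℝ) {m : ℕ} (u w : Fin m → V) : ℝ :=
  Matrix.det (Matrix.of fun r s => g (u r) (w s))

/-- The linear operator
`T ↦ (1 / (k!)^2) ∑_{A, B} δ^{A i_1 ... i_p}_{B j_1 ... j_p} T_{A, B}`
from `(k,k)` double forms to `(p,p)` double forms, where `A` and `B` run over all multi-indices of
length `k` in an orthonormal frame `e`. -/
def deltaContract {n : ℕ} (g : V → V → ℝ) (e : Fin n → V) (p : ℕ) {k : ℕ} (T : Tensor2 V k) :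
    Tensor2 V p := fun v w =>
  (1 / (k.factorial : ℝ) ^ 2) * ∑ A : Fin k → Fin n, ∑ B : Fin k → Fin n,
    kronecker g (Fin.append (fun s => e (A s)) v) (Fin.append (fun s => e (B s)) w) *
      T (fun s => e (A s)) (fun s => e (B s))

/-- The `(p,q)`-curvature tensor of a `(2,2)` double form `R`. -/
def pqCurvature {n : ℕ} (g : V → V → ℝ) (e : Fin n → V) (R : V → V → V → V → ℝ) (p q : ℕ) :
    Tensor2 V p :=
  deltaContract g e p (gaussKronecker R q)

/-- `θ 0, θ 1, ...` are the components of the orthogonal decomposition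
`T = θ_k + g θ_{k-1} + ... + g^k θ_0` of a `(k,k)` double form `T` in dimension `n` into trace free
parts. For `i > n - k` one has `g^{k-i} θ_i = 0` for every trace free `(i,i)` double form `θ_i`; the
corresponding components of `T` vanish for dimensional reasons and are set to be zero. -/
structure IsTraceFreeDecomposition [AddCommGroup V] [Module ℝ V] {n : ℕ} (g : V → V → ℝ)
    (e : Fin n → V) {k : ℕ} (T : Tensor2 V k) (θ : (i : ℕ) → Tensor2 V i) : Prop where
  isDoubleForm : ∀ i, IsDoubleForm (θ i)
  traceFree : ∀ i, contract e (θ (i + 1)) = 0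
  eq_zero : ∀ i, min k (n - k) < i → θ i = 0
  eq_sum : T = ∑ i ∈ Finset.range (k + 1), metricPow g k (θ i)

end Algebra

/-! ### Riemannian manifolds and their curvature -/

/-- A smooth `n`-dimensional Riemannian manifold (Hausdorff, second countable, without boundary). -/
structure RiemannianManifold (n : ℕ) where
  carrier : Type
  [top : TopologicalSpace carrier]
  [t2 : T2Space carrier]
  [secondCountable : SecondCountableTopology carrier]
  [charted : ChartedSpace (EuclideanSpace ℝ (Fin n)) carrier]
  [smooth : IsManifold (𝓡 n) ∞ carrier]
  metric : Bundle.ContMDiffRiemannianMetric (𝓡 n) ∞ (EuclideanSpace ℝ (Fin n))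
    (fun x : carrier => TangentSpace (𝓡 n) x)

namespace RiemannianManifold

attribute [instance] top t2 secondCountable charted smooth

variable {n : ℕ} (M : RiemannianManifold n)

/-- The tangent space at a point. -/
abbrev Tangent (x : M.carrier) : Type := TangentSpace (𝓡 n) x

/-- The metric at a point, as a function of two tangent vectors. -/
def g (x : M.carrier) (u v : M.Tangent x) : ℝ := M.metric.inner x u v

/-- `e` is an orthonormal frame of the tangent space at `x`. -/
def IsOrthonormalFrame (x : M.carrier) (e : Fin n → M.Tangent x) : Prop :=
  ∀ a b, M.g x (e a) (e b) = if a = b then 1 else 0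

/-- The coordinate vector field `∂_i` of the chart at `x`, at the point with coordinates `y`. -/
def coordVec (x : M.carrier) (i : Fin n) (y : EuclideanSpace ℝ (Fin n)) :
    M.Tangent ((extChartAt (𝓡 n) x).symm y) :=
  mfderiv 𝓘(ℝ, EuclideanSpace ℝ (Fin n)) (𝓡 n) (extChartAt (𝓡 n) x).symm y
    (EuclideanSpace.single i (1 : ℝ) : EuclideanSpace ℝ (Fin n))

/-- The metric coefficients `g_ij` in the chart at `x`, as functions of the coordinates `y`. -/
def coordMetric (x : M.carrier) (y : EuclideanSpace ℝ (Fin n)) : Matrix (Fin n) (Fin n) ℝ :=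
  Matrix.of fun i j => M.g ((extChartAt (𝓡 n) x).symm y) (M.coordVec x i y) (M.coordVec x j y)

end RiemannianManifold

/-- The partial derivative `∂_i f` of a function on `ℝ^n`. -/
def partialDeriv {n : ℕ} (i : Fin n) (f : EuclideanSpace ℝ (Fin n) → ℝ)
    (y : EuclideanSpace ℝ (Fin n)) : ℝ :=
  fderiv ℝ f y (EuclideanSpace.single i (1 : ℝ))

namespace RiemannianManifold

variable {n : ℕ} (M : RiemannianManifold n)

/-- Christoffel symbols
`Γ^k_ij = (1/2) ∑_l g^{kl} (∂_i g_jl + ∂_j g_il - ∂_l g_ij)` in the chart at `x`. -/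
def christoffel (x : M.carrier) (k i j : Fin n) (y : EuclideanSpace ℝ (Fin n)) : ℝ :=
  (1 / 2) * ∑ l : Fin n, (M.coordMetric x y)⁻¹ k l *
    (partialDeriv i (fun z => M.coordMetric x z j l) y
      + partialDeriv j (fun z => M.coordMetric x z i l) y
      - partialDeriv l (fun z => M.coordMetric x z i j) y)

/-- `R^m_{jkl} = ∂_k Γ^m_{lj} - ∂_l Γ^m_{kj} + ∑_s (Γ^m_{ks} Γ^s_{lj} - Γ^m_{ls} Γ^s_{kj})`
in the chart at `x`. -/
def coordRiemannUp (x : M.carrier) (m j k l : Fin n) (y : EuclideanSpace ℝ (Fin n)) : ℝ :=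
  partialDeriv k (M.christoffel x m l j) y - partialDeriv l (M.christoffel x m k j) y
    + ∑ s : Fin n, (M.christoffel x m k s y * M.christoffel x s l j y
      - M.christoffel x m l s y * M.christoffel x s k j y)

/-- The components `R_{ijkl} = ∑_m g_im R^m_{jkl}` in the chart at `x`. In this sign convention
`R_{ijij}` is the sectional curvature if `∂_i`, `∂_j` are orthonormal. -/
def coordRiemann (x : M.carrier) (i j k l : Fin n) (y : EuclideanSpace ℝ (Fin n)) : ℝ :=
  ∑ m : Fin n, M.coordMetric x y i m * M.coordRiemannUp x m j k l y

/-- The `i`-th coordinate of a tangent vector at `x` in the chart at `x`. -/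
def tangentCoord (x : M.carrier) (u : M.Tangent x) (i : Fin n) : ℝ :=
  (show EuclideanSpace ℝ (Fin n) from
    mfderiv (𝓡 n) 𝓘(ℝ, EuclideanSpace ℝ (Fin n)) (extChartAt (𝓡 n) x) x u) i

/-- The Riemann curvature tensor at `x`, as a function of four tangent vectors. -/
def riemann (x : M.carrier) (u₁ u₂ v₁ v₂ : M.Tangent x) : ℝ :=
  ∑ i : Fin n, ∑ j : Fin n, ∑ k : Fin n, ∑ l : Fin n,
    M.coordRiemann x i j k l (extChartAt (𝓡 n) x x) *
      (M.tangentCoord x u₁ i * M.tangentCoord x u₂ j *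
        M.tangentCoord x v₁ k * M.tangentCoord x v₂ l)

/-- The Gauss-Kronecker tensor `R^q` at `x`. -/
def Rpow (x : M.carrier) (q : ℕ) : Tensor2 (M.Tangent x) (2 * q) :=
  gaussKronecker (M.riemann x) q

/-- The `(p,q)`-curvature tensor `R^(p,q)` at `x`, computed in the orthonormal frame `e`. -/
def Rpq (x : M.carrier) (e : Fin n → M.Tangent x) (p q : ℕ) : Tensor2 (M.Tangent x) p :=
  pqCurvature (M.g x) e (M.riemann x) p q

/-- `θ` is the family of trace free components of `R^q` at `x`. -/
def IsComponents (x : M.carrier) (e : Fin n → M.Tangent x) (q : ℕ)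
    (θ : (i : ℕ) → Tensor2 (M.Tangent x) i) : Prop :=
  IsTraceFreeDecomposition (M.g x) e (M.Rpow x q) θ

/-- The part of `R^(p,q)` that comes from the summand `g^{2q-i} θ_i` of `R^q`: the image of that
summand under the linear operator that sends `R^q` to `R^(p,q)`. -/
def contribution (x : M.carrier) (e : Fin n → M.Tangent x) (p q : ℕ) {i : ℕ}
    (θ : Tensor2 (M.Tangent x) i) : Tensor2 (M.Tangent x) p :=
  deltaContract (M.g x) e p (metricPow (M.g x) (2 * q) θ)

end RiemannianManifold

end DoubleForms

end

noncomputable section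

namespace DoubleForms

/-! ### Smoothness and invertibility of the metric coefficients in a chart. -/

section Curvature

open Bundle

/-! Everything is computed on components in an orthonormal frame, where a double form becomes a
tensor that is skew in each of its two groups of indices. Write g for multiplication by the metric,
c for contraction and L_p for the operator that defines the curvature tensors.

On (k,k) tensors c(gT) = g c(T) + (n - 2k) T (`trace_metricMul`), and c is adjoint to g up to a
positive factor (`pairing_metricMul`). For a trace-free θ of degree i it follows that c(g^{m+1-i} θ)
= (m+1-i)(n-i-m) g^{m-i} θ (`trace_metricPow`). The sign of this factor decides when g^{m-i} θ
vanishes, and contracting a decomposition repeatedly gives its uniqueness. Existence comes from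
orthogonal projection onto the image of g (`exists_trace_sub_metricMul_eq_zero`).

L_p pairs T with a generalized Kronecker delta, so adjointness gives L_p(gT) = (n-k-p) L_p T
(`frameContract_metricMul`). For trace-free T of degree k, comparing two families of Laplace
expansions gives (p+1-k) L_{p+1} T = g L_p T (`frameContract_succ`). Since L_0 T = 0 for k > 0, L_p
T = 0 for p < k. At p = k the recursion says nothing, and a direct evaluation gives plus or minus
the transpose of T (`frameContract_self`). Beyond k the recursion yields plus or minus g^{p-k} T /
(p-k)! for symmetric T. The components ω_i are symmetric because the Riemann tensor has the pair
symmetry (`riemann_pair_symm`) and the decomposition is unique. Hence a_i is, up to sign, the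
product of n-s-p over i ≤ s < 2q divided by (p-i)! if i ≤ p, and 0 otherwise. As p + 2q ≤ n, all
factors are positive, so a_i is non-zero exactly for i ≤ p.

Components above min(2q, n-2q) are zero, so p ≥ min(2q, n-2q) suffices. For necessity one needs a
manifold whose component of degree min(2q, n-2q) is non-zero at some point. Take ℝ^n with the factor
1 + |y'|^2 on the first 2q coordinates y' and the flat metric on the others. At the origin R^q is
non-zero on the first 2q frame vectors and vanishes if the first group contains any other frame
vector. Antisymmetrizing its diagonal values along min(2q, n-2q) disjoint transpositions kills all
lower components but not R^q (`IsFrameDecomposition.top_ne_zero`). -/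

lemma contMDiff_constVec {E : Type*} [NormedAddCommGroup E] [NormedSpace ℝ E] (v : E) :
    ContMDiff 𝓘(ℝ, E) (𝓘(ℝ, E).tangent) ∞ (fun y : E => (⟨y, v⟩ : TangentBundle 𝓘(ℝ, E) E)) := by
  intro x
  refine (contMDiffAt_totalSpace).2 ⟨contMDiffAt_id, ?_⟩
  convert! contMDiffAt_const (c := v)
  simp [TangentSpace]

variable {n : ℕ} (M : RiemannianManifold n)

/-- The coordinate field is the image of a constant section under the tangent map of the inverse
chart. -/
lemma RiemannianManifold.contMDiffAt_coordVec (x : M.carrier) (i : Fin n)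
    {y : EuclideanSpace ℝ (Fin n)} (hy : y ∈ (extChartAt (𝓡 n) x).target) :
    ContMDiffAt (𝓡 n) ((𝓡 n).tangent) ∞
      (fun y => (⟨(extChartAt (𝓡 n) x).symm y, M.coordVec x i y⟩ : TangentBundle (𝓡 n) M.carrier))
      y := by
  have ho : IsOpen (extChartAt (𝓡 n) x).target := isOpen_extChartAt_target x
  have h1 := (contMDiffOn_extChartAt_symm (I := 𝓡 n) (n := ∞) x).contMDiffOn_tangentMapWithin
    (m := ∞) (by simp) ho.uniqueMDiffOn
  have h2 := (contMDiff_constVec (EuclideanSpace.single i (1 : ℝ) : EuclideanSpace ℝ (Fin n))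
    ).contMDiffAt (x := y)
  have h3 := (h1.contMDiffAt (x := ⟨y, EuclideanSpace.single i (1 : ℝ)⟩) (by
    exact (ho.preimage (FiberBundle.continuous_proj _ _)).mem_nhds hy)).comp y h2
  refine h3.congr_of_eventuallyEq ?_
  filter_upwards [ho.mem_nhds hy] with z hz
  simp only [Function.comp, tangentMapWithin, mfderivWithin_of_isOpen ho hz]
  rfl

lemma RiemannianManifold.contDiffAt_coordMetric (x : M.carrier) (i j : Fin n)
    {y : EuclideanSpace ℝ (Fin n)} (hy : y ∈ (extChartAt (𝓡 n) x).target) :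
    ContDiffAt ℝ ∞ (fun y => M.coordMetric x y i j) y := by
  rw [← contMDiffAt_iff_contDiffAt]
  have hb := M.contMDiffAt_coordVec x i hy
  have hc := M.contMDiffAt_coordVec x j hy
  have hs : ContMDiffAt (𝓡 n) (𝓡 n) ∞ (extChartAt (𝓡 n) x).symm y :=
    (contMDiffOn_extChartAt_symm (I := 𝓡 n) (n := ∞) x).contMDiffAt
      ((isOpen_extChartAt_target x).mem_nhds hy)
  have : ContMDiffAt (𝓡 n) ((𝓡 n).prod 𝓘(ℝ)) ∞
      (fun m ↦ TotalSpace.mk' ℝ (E := Bundle.Trivial M.carrier ℝ) ((extChartAt (𝓡 n) x).symm m)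
        (M.metric.inner _ (M.coordVec x i m) (M.coordVec x j m))) y := by
    apply ContMDiffAt.clm_bundle_apply₂ (F₁ := EuclideanSpace ℝ (Fin n))
      (F₂ := EuclideanSpace ℝ (Fin n))
    · exact ContMDiffAt.comp y M.metric.contMDiff.contMDiffAt hs
    · exact hb
    · exact hc
  simp only [contMDiffAt_totalSpace] at this
  exact this.2

/-- A kernel vector of the Gram matrix gives a combination u of the b i that is orthogonal to all of
them. Then B u u = 0, so u = 0 by positivity, against linear independence. -/
lemma isUnit_det_gram {V : Type*} [AddCommGroup V] [Module ℝ V] (B : V →ₗ[ℝ] V →ₗ[ℝ] ℝ)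
    (hB : ∀ v, v ≠ 0 → 0 < B v v) {n : ℕ} {b : Fin n → V} (hb : LinearIndependent ℝ b) :
    IsUnit (Matrix.of fun i j => B (b i) (b j)).det := by
  rw [isUnit_iff_ne_zero]
  intro h
  obtain ⟨c, hc, hc0⟩ := Matrix.exists_vecMul_eq_zero_iff.2 h
  set u : V := ∑ i, c i • b i with hu
  have h1 : ∀ j, B u (b j) = 0 := by
    intro j
    have := congrFun hc0 j
    simpa [hu, Matrix.vecMul, dotProduct] using this
  have h2 : B u u = 0 := by
    conv_lhs => rw [hu, map_sum, ← hu]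
    simp [h1]
  have h3 : u = 0 := by
    by_contra h3
    exact (hB _ h3).ne' h2
  exact hc (funext fun i => Fintype.linearIndependent_iff.1 hb c h3 i)

lemma RiemannianManifold.linearIndependent_coordVec (x : M.carrier)
    {y : EuclideanSpace ℝ (Fin n)} (hy : y ∈ (extChartAt (𝓡 n) x).target) :
    LinearIndependent ℝ (fun i => M.coordVec x i y) := by
  have hI := isInvertible_mfderivWithin_extChartAt_symm (I := 𝓡 n) (x := x) hy
  rw [ModelWithCorners.range_eq_univ, mfderivWithin_univ] at hI
  obtain ⟨D, hD⟩ := hI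
  have hs : LinearIndependent ℝ
      (fun i => (EuclideanSpace.single i (1 : ℝ) : EuclideanSpace ℝ (Fin n))) := by
    have e0 : (fun i => (EuclideanSpace.single i (1 : ℝ) : EuclideanSpace ℝ (Fin n))) =
        (EuclideanSpace.basisFun (Fin n) ℝ).toBasis := by
      ext1 i
      simp
    rw [e0]
    exact (EuclideanSpace.basisFun (Fin n) ℝ).toBasis.linearIndependent
  have := hs.map' (D.toLinearEquiv.toLinearMap) D.toLinearEquiv.ker
  have e : (fun i => M.coordVec x i y) = D.toLinearEquiv.toLinearMap ∘
      (fun i => (EuclideanSpace.single i (1 : ℝ) : EuclideanSpace ℝ (Fin n))) := by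
    ext1 i
    simp only [RiemannianManifold.coordVec, ← hD]
    rfl
  rw [e]
  exact this

lemma RiemannianManifold.isUnit_coordMetric (x : M.carrier)
    {y : EuclideanSpace ℝ (Fin n)} (hy : y ∈ (extChartAt (𝓡 n) x).target) :
    IsUnit (M.coordMetric x y).det :=
  isUnit_det_gram (V := M.Tangent ((extChartAt (𝓡 n) x).symm y))
    ((ContinuousLinearMap.coeLM ℝ).comp (M.metric.inner _).toLinearMap)
    (fun v hv => M.metric.pos _ v hv) (M.linearIndependent_coordVec x hy)

lemma RiemannianManifold.coordMetric_symm (x : M.carrier) (y : EuclideanSpace ℝ (Fin n))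
    (i j : Fin n) : M.coordMetric x y i j = M.coordMetric x y j i :=
  M.metric.symm _ _ _

/-! ### Rules for partial derivatives. -/

section Calculus

variable {n : ℕ} {f h : EuclideanSpace ℝ (Fin n) → ℝ} {y : EuclideanSpace ℝ (Fin n)}

lemma contDiffAt_partialDeriv (i : Fin n) (hf : ContDiffAt ℝ ∞ f y) :
    ContDiffAt ℝ ∞ (partialDeriv i f) y :=
  (hf.fderiv_right (m := ∞) (by simp)).clm_apply contDiffAt_const

lemma partialDeriv_comm (i j : Fin n) (hf : ContDiffAt ℝ ∞ f y) :
    partialDeriv i (partialDeriv j f) y = partialDeriv j (partialDeriv i f) y := by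
  have hd : DifferentiableAt ℝ (fderiv ℝ f) y :=
    (hf.fderiv_right (m := ∞) (by simp)).differentiableAt (by simp)
  have key : ∀ a b : Fin n, partialDeriv a (partialDeriv b f) y =
      fderiv ℝ (fderiv ℝ f) y (EuclideanSpace.single a 1) (EuclideanSpace.single b 1) := by
    intro a b
    unfold partialDeriv
    rw [fderiv_clm_apply hd (by fun_prop)]
    simp
  rw [key, key]
  exact hf.isSymmSndFDerivAt (by
    rw [minSmoothness_of_isRCLikeNormedField]; exact WithTop.coe_le_coe.2 le_top) _ _

lemma partialDeriv_mul (i : Fin n) (hf : DifferentiableAt ℝ f y) (hh : DifferentiableAt ℝ h y) :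
    partialDeriv i (fun z => f z * h z) y =
      partialDeriv i f y * h y + f y * partialDeriv i h y := by
  unfold partialDeriv
  rw [fderiv_fun_mul hf hh]
  simp; ring

lemma partialDeriv_add (i : Fin n) (hf : DifferentiableAt ℝ f y) (hh : DifferentiableAt ℝ h y) :
    partialDeriv i (fun z => f z + h z) y = partialDeriv i f y + partialDeriv i h y := by
  unfold partialDeriv
  rw [fderiv_fun_add hf hh]
  simp

lemma partialDeriv_sub (i : Fin n) (hf : DifferentiableAt ℝ f y) (hh : DifferentiableAt ℝ h y) :
    partialDeriv i (fun z => f z - h z) y = partialDeriv i f y - partialDeriv i h y := by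
  unfold partialDeriv
  rw [fderiv_fun_sub hf hh]
  simp

lemma partialDeriv_const_mul (i : Fin n) (c : ℝ) (hf : DifferentiableAt ℝ f y) :
    partialDeriv i (fun z => c * f z) y = c * partialDeriv i f y := by
  unfold partialDeriv
  rw [fderiv_const_mul hf]
  simp

lemma partialDeriv_sum (i : Fin n) {ι : Type*} (s : Finset ι)
    {F : ι → EuclideanSpace ℝ (Fin n) → ℝ} (hF : ∀ a ∈ s, DifferentiableAt ℝ (F a) y) :
    partialDeriv i (fun z => ∑ a ∈ s, F a z) y = ∑ a ∈ s, partialDeriv i (F a) y := by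
  unfold partialDeriv
  rw [fderiv_fun_sum hF]
  simp

lemma partialDeriv_congr (i : Fin n) (hfh : f =ᶠ[nhds y] h) :
    partialDeriv i f y = partialDeriv i h y := by
  unfold partialDeriv
  rw [hfh.fderiv_eq]

end Calculus

lemma differentiableAt_det {E : Type*} [NormedAddCommGroup E] [NormedSpace ℝ E] {n : ℕ}
    {A : E → Matrix (Fin n) (Fin n) ℝ} {y : E}
    (hA : ∀ i j, DifferentiableAt ℝ (fun z => A z i j) y) :
    DifferentiableAt ℝ (fun z => (A z).det) y := by
  simp only [Matrix.det_apply']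
  refine DifferentiableAt.fun_sum fun σ _ => DifferentiableAt.const_mul ?_ _
  exact (HasFDerivAt.finsetProd fun i _ => (hA (σ i) i).hasFDerivAt).differentiableAt

/-- Cramer's rule: the entry is a cofactor divided by the determinant. -/
lemma differentiableAt_inv {E : Type*} [NormedAddCommGroup E] [NormedSpace ℝ E] {n : ℕ}
    {A : E → Matrix (Fin n) (Fin n) ℝ} {y : E}
    (hA : ∀ i j, DifferentiableAt ℝ (fun z => A z i j) y) (hu : IsUnit (A y).det) (i j : Fin n) :
    DifferentiableAt ℝ (fun z => (A z)⁻¹ i j) y := by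
  simp only [Matrix.inv_def, Ring.inverse_eq_inv', Matrix.smul_apply, smul_eq_mul,
    Matrix.adjugate_apply]
  refine ((differentiableAt_det hA).inv hu.ne_zero).mul (differentiableAt_det fun a b => ?_)
  by_cases h : a = j
  · subst h; simp
  · simpa [Matrix.updateRow_ne h] using hA a b

/-! ### Christoffel symbols and the pair symmetry of the curvature. -/

namespace RiemannianManifold

variable {n : ℕ} (M : RiemannianManifold n)

/-- Christoffel symbols of the first kind `Γ_{m,ij}` in the chart at `x`. -/
def christoffelLow (x : M.carrier) (m i j : Fin n) (y : EuclideanSpace ℝ (Fin n)) : ℝ :=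
  (1 / 2) * (partialDeriv i (fun z => M.coordMetric x z j m) y
      + partialDeriv j (fun z => M.coordMetric x z i m) y
      - partialDeriv m (fun z => M.coordMetric x z i j) y)

variable {M} {x : M.carrier} {y : EuclideanSpace ℝ (Fin n)}

lemma christoffel_eq (k i j : Fin n) :
    M.christoffel x k i j y = ∑ l, (M.coordMetric x y)⁻¹ k l * M.christoffelLow x l i j y := by
  simp only [christoffel, christoffelLow, Finset.mul_sum]
  exact Finset.sum_congr rfl fun l _ => by ring

lemma coordMetric_symm_fun (i j : Fin n) :
    (fun z => M.coordMetric x z i j) = fun z => M.coordMetric x z j i :=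
  funext fun z => M.coordMetric_symm x z i j

lemma christoffelLow_symm (m i j : Fin n) (y : EuclideanSpace ℝ (Fin n)) :
    M.christoffelLow x m i j y = M.christoffelLow x m j i y := by
  simp only [christoffelLow, coordMetric_symm_fun i j]
  ring

lemma christoffel_symm (k i j : Fin n) (y : EuclideanSpace ℝ (Fin n)) :
    M.christoffel x k i j y = M.christoffel x k j i y := by
  simp only [christoffel_eq, christoffelLow_symm _ i j]

/-- Compatibility of the Levi-Civita connection with the metric; it trades first derivatives of the
metric for Christoffel symbols. -/
lemma christoffelLow_add (k i m : Fin n) (y : EuclideanSpace ℝ (Fin n)) :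
    M.christoffelLow x i k m y + M.christoffelLow x m k i y =
      partialDeriv k (fun z => M.coordMetric x z i m) y := by
  simp only [christoffelLow, coordMetric_symm_fun m i, coordMetric_symm_fun k i,
    coordMetric_symm_fun k m]
  ring

lemma sum_coordMetric_mul_christoffel (hy : y ∈ (extChartAt (𝓡 n) x).target) (m i j : Fin n) :
    ∑ k, M.coordMetric x y m k * M.christoffel x k i j y = M.christoffelLow x m i j y := by
  have h1 := Matrix.mul_nonsing_inv _ (M.isUnit_coordMetric x hy)
  have : (M.coordMetric x y).mulVec ((M.coordMetric x y)⁻¹.mulVec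
      fun l => M.christoffelLow x l i j y) m = M.christoffelLow x m i j y := by
    rw [Matrix.mulVec_mulVec, h1, Matrix.one_mulVec]
  simpa [Matrix.mulVec, dotProduct, christoffel_eq] using this

lemma differentiableAt_coordMetric (hy : y ∈ (extChartAt (𝓡 n) x).target) (i j : Fin n) :
    DifferentiableAt ℝ (fun y => M.coordMetric x y i j) y :=
  (M.contDiffAt_coordMetric x i j hy).differentiableAt (by simp)

lemma differentiableAt_partialDeriv_coordMetric (hy : y ∈ (extChartAt (𝓡 n) x).target)
    (k i j : Fin n) :
    DifferentiableAt ℝ (partialDeriv k fun y => M.coordMetric x y i j) y :=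
  (contDiffAt_partialDeriv k (M.contDiffAt_coordMetric x i j hy)).differentiableAt (by simp)

lemma differentiableAt_christoffelLow (hy : y ∈ (extChartAt (𝓡 n) x).target) (m i j : Fin n) :
    DifferentiableAt ℝ (M.christoffelLow x m i j) y :=
  (((differentiableAt_partialDeriv_coordMetric hy _ _ _).add
    (differentiableAt_partialDeriv_coordMetric hy _ _ _)).sub
    (differentiableAt_partialDeriv_coordMetric hy _ _ _)).const_mul _

lemma differentiableAt_christoffel (hy : y ∈ (extChartAt (𝓡 n) x).target) (m i j : Fin n) :
    DifferentiableAt ℝ (M.christoffel x m i j) y := by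
  have : M.christoffel x m i j = fun y =>
      ∑ l, (M.coordMetric x y)⁻¹ m l * M.christoffelLow x l i j y :=
    funext fun y => christoffel_eq m i j
  rw [this]
  exact DifferentiableAt.fun_sum fun l _ =>
    (differentiableAt_inv (differentiableAt_coordMetric hy) (M.isUnit_coordMetric x hy) _ _).mul
      (differentiableAt_christoffelLow hy _ _ _)

/-- Leibniz rule for the lowered symbol as the product of the metric and Γ, valid near y because the
chart target is open, with the derivative of the metric rewritten by compatibility. -/
lemma sum_coordMetric_mul_partialDeriv_christoffel (hy : y ∈ (extChartAt (𝓡 n) x).target)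
    (k i l j : Fin n) :
    ∑ m, M.coordMetric x y i m * partialDeriv k (M.christoffel x m l j) y =
      partialDeriv k (M.christoffelLow x i l j) y - ∑ m,
        (M.christoffelLow x i k m y + M.christoffelLow x m k i y) * M.christoffel x m l j y := by
  have h : M.christoffelLow x i l j =ᶠ[nhds y]
      fun z => ∑ m, M.coordMetric x z i m * M.christoffel x m l j z := by
    filter_upwards [(isOpen_extChartAt_target x).mem_nhds hy] with z hz
    exact (sum_coordMetric_mul_christoffel hz i l j).symm
  rw [partialDeriv_congr k h, partialDeriv_sum k
    (F := fun m z => M.coordMetric x z i m * M.christoffel x m l j z) _ fun m _ =>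
    (differentiableAt_coordMetric hy _ _).mul (differentiableAt_christoffel hy _ _ _),
    ← Finset.sum_sub_distrib]
  refine Finset.sum_congr rfl fun m _ => ?_
  rw [partialDeriv_mul k (f := fun z => M.coordMetric x z i m) (differentiableAt_coordMetric hy _ _)
    (differentiableAt_christoffel hy _ _ _), christoffelLow_add]
  ring

lemma partialDeriv_christoffelLow (hy : y ∈ (extChartAt (𝓡 n) x).target) (k m i j : Fin n) :
    partialDeriv k (M.christoffelLow x m i j) y = (1 / 2) *
      (partialDeriv k (partialDeriv i fun z => M.coordMetric x z j m) y
      + partialDeriv k (partialDeriv j fun z => M.coordMetric x z i m) y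
      - partialDeriv k (partialDeriv m fun z => M.coordMetric x z i j) y) := by
  have h := differentiableAt_partialDeriv_coordMetric (M := M) hy
  set f := partialDeriv i fun z => M.coordMetric x z j m with hf
  set f' := partialDeriv j fun z => M.coordMetric x z i m with hf'
  set f'' := partialDeriv m fun z => M.coordMetric x z i j with hf''
  have h1 : DifferentiableAt ℝ f y := h _ _ _
  have h2 : DifferentiableAt ℝ f' y := h _ _ _
  have h3 : DifferentiableAt ℝ f'' y := h _ _ _
  rw [← partialDeriv_add k h1 h2, ← partialDeriv_sub k (f := fun z => f z + f' z) (h1.add h2) h3,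
    ← partialDeriv_const_mul k (f := fun z => f z + f' z - f'' z) _ ((h1.add h2).sub h3)]
  rfl

/-- The curvature tensor in terms of second derivatives of the metric and of Christoffel symbols. -/
lemma coordRiemann_eq (hy : y ∈ (extChartAt (𝓡 n) x).target) (i j k l : Fin n) :
    M.coordRiemann x i j k l y = (1 / 2) *
      (partialDeriv k (partialDeriv j fun z => M.coordMetric x z i l) y
      + partialDeriv l (partialDeriv i fun z => M.coordMetric x z j k) y
      - partialDeriv k (partialDeriv i fun z => M.coordMetric x z j l) y
      - partialDeriv l (partialDeriv j fun z => M.coordMetric x z i k) y)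
      + ∑ m, M.christoffelLow x m l i y * M.christoffel x m k j y
      - ∑ m, M.christoffelLow x m k i y * M.christoffel x m l j y := by
  -- Lowering an index in the ΓΓ terms produces the sums with Γ_{i,ks} that the Leibniz rule
  -- subtracts. They cancel, and only the sums with Γ_{m,ki} and Γ_{m,li} survive.
  have h : ∀ k l, ∑ m, ∑ s, M.coordMetric x y i m *
      (M.christoffel x m k s y * M.christoffel x s l j y) =
      ∑ s, M.christoffelLow x i k s y * M.christoffel x s l j y := by
    intro k l
    rw [Finset.sum_comm]
    refine Finset.sum_congr rfl fun s _ => ?_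
    rw [← sum_coordMetric_mul_christoffel hy, Finset.sum_mul]
    exact Finset.sum_congr rfl fun m _ => by ring
  simp only [coordRiemann, coordRiemannUp, mul_add, mul_sub, Finset.sum_add_distrib,
    Finset.sum_sub_distrib, Finset.mul_sum, h]
  simp only [sum_coordMetric_mul_partialDeriv_christoffel hy, partialDeriv_christoffelLow hy,
    add_mul, Finset.sum_add_distrib]
  rw [partialDeriv_comm l k (M.contDiffAt_coordMetric x j i hy), coordMetric_symm_fun l i,
    coordMetric_symm_fun k i, coordMetric_symm_fun k j, coordMetric_symm_fun l j]
  ring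

/-- Both sides pair two lowered symbols through the inverse metric, which is symmetric. -/
lemma sum_christoffelLow_mul_christoffel_symm (i j k l : Fin n) :
    ∑ m, M.christoffelLow x m i j y * M.christoffel x m k l y =
      ∑ m, M.christoffelLow x m k l y * M.christoffel x m i j y := by
  simp only [christoffel_eq, Finset.mul_sum]
  rw [Finset.sum_comm]
  refine Finset.sum_congr rfl fun a _ => Finset.sum_congr rfl fun b _ => ?_
  have : (M.coordMetric x y)⁻¹ b a = (M.coordMetric x y)⁻¹ a b := by
    have h : (M.coordMetric x y).transpose = M.coordMetric x y := by
      ext i j; exact M.coordMetric_symm x y j i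
    conv_lhs => rw [← h, ← Matrix.transpose_nonsing_inv, Matrix.transpose_apply]
  rw [this]; ring

/-- This can be read off the formula in second derivatives, since mixed partials commute. It is the
only symmetry of the curvature used later: skewness is built into the Gauss-Kronecker tensor by its
sums over permutations. -/
lemma coordRiemann_pair_symm (hy : y ∈ (extChartAt (𝓡 n) x).target) (i j k l : Fin n) :
    M.coordRiemann x i j k l y = M.coordRiemann x k l i j y := by
  rw [coordRiemann_eq hy, coordRiemann_eq hy]
  have hc := fun a b i j => partialDeriv_comm a b (M.contDiffAt_coordMetric x i j hy)
  rw [hc i l, coordMetric_symm_fun k j, hc j k, coordMetric_symm_fun l i, hc i k,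
    coordMetric_symm_fun l j, hc j l, coordMetric_symm_fun k i,
    sum_christoffelLow_mul_christoffel_symm l i k j]
  simp only [christoffel_symm _ i l, christoffel_symm _ j l, christoffelLow_symm _ j k,
    christoffelLow_symm _ i k]
  ring

lemma riemann_pair_symm (x : M.carrier) (u₁ u₂ v₁ v₂ : M.Tangent x) :
    M.riemann x u₁ u₂ v₁ v₂ = M.riemann x v₁ v₂ u₁ u₂ := by
  have hy := mem_extChartAt_target (I := 𝓡 n) x
  simp only [riemann]
  calc _ = ∑ i, ∑ j, ∑ k, ∑ l, M.coordRiemann x k l i j (extChartAt (𝓡 n) x x) *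
      (M.tangentCoord x v₁ k * M.tangentCoord x v₂ l *
        M.tangentCoord x u₁ i * M.tangentCoord x u₂ j) := by
        refine Finset.sum_congr rfl fun i _ => Finset.sum_congr rfl fun j _ =>
          Finset.sum_congr rfl fun k _ => Finset.sum_congr rfl fun l _ => ?_
        rw [coordRiemann_pair_symm hy i j k l]; ring
    _ = _ := by
        rw [Finset.sum_congr rfl fun i _ => Finset.sum_comm, Finset.sum_comm]
        refine Finset.sum_congr rfl fun k _ => ?_
        rw [Finset.sum_congr rfl fun i _ => Finset.sum_comm, Finset.sum_comm]

end RiemannianManifold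

/-! ### A test metric, curved only in the first k coordinates. -/

section Example

lemma contDiff_sum_smul {E F : Type*} [NormedAddCommGroup E] [NormedSpace ℝ E]
    [NormedAddCommGroup F] [NormedSpace ℝ F] {n : ℕ} (B : Fin n → F) {h : Fin n → E → ℝ}
    (hh : ∀ i, ContDiff ℝ ∞ (h i)) : ContDiff ℝ ∞ fun y => ∑ i, h i y • B i :=
  ContDiff.sum fun i _ => (hh i).smul contDiff_const

variable (n k : ℕ)

/-- The factor `1 + ∑_{j < k} y_j ^ 2` for `i < k`, and `1` for `i ≥ k`. -/
def blockFactor (i : Fin n) (y : EuclideanSpace ℝ (Fin n)) : ℝ :=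
  1 + if (i : ℕ) < k then ∑ j : Fin n, (if (j : ℕ) < k then y j ^ 2 else 0) else 0

lemma blockFactor_pos (i : Fin n) (y : EuclideanSpace ℝ (Fin n)) : 0 < blockFactor n k i y := by
  unfold blockFactor
  have : 0 ≤ if (i : ℕ) < k then ∑ j : Fin n, (if (j : ℕ) < k then y j ^ 2 else 0) else 0 := by
    split_ifs
    · exact Finset.sum_nonneg fun j _ => by split_ifs <;> positivity
    · exact le_rfl
  linarith

lemma one_le_blockFactor (i : Fin n) (y : EuclideanSpace ℝ (Fin n)) : 1 ≤ blockFactor n k i y := by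
  unfold blockFactor
  have : 0 ≤ if (i : ℕ) < k then ∑ j : Fin n, (if (j : ℕ) < k then y j ^ 2 else 0) else 0 := by
    split_ifs
    · exact Finset.sum_nonneg fun j _ => by split_ifs <;> positivity
    · exact le_rfl
  linarith

lemma contDiff_blockFactor (i : Fin n) : ContDiff ℝ ∞ (blockFactor n k i) := by
  unfold blockFactor
  refine contDiff_const.add ?_
  split_ifs
  · refine ContDiff.sum fun j _ => ?_
    split_ifs
    · fun_prop
    · exact contDiff_const
  · exact contDiff_const

/-- The bilinear form `∑ i, h i * u i * v i`. -/
def diagForm (h : Fin n → ℝ) :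
    EuclideanSpace ℝ (Fin n) →L[ℝ] EuclideanSpace ℝ (Fin n) →L[ℝ] ℝ :=
  ∑ i, h i • (EuclideanSpace.proj (𝕜 := ℝ) i).smulRight (EuclideanSpace.proj (𝕜 := ℝ) i)

@[simp] lemma diagForm_apply (h : Fin n → ℝ) (u v : EuclideanSpace ℝ (Fin n)) :
    diagForm n h u v = ∑ i, h i * (u i * v i) := by
  simp [diagForm]

lemma diagForm_single (h : Fin n → ℝ) (i j : Fin n) :
    diagForm n h (EuclideanSpace.single i (1 : ℝ)) (EuclideanSpace.single j (1 : ℝ)) =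
      if i = j then h i else 0 := by
  rw [diagForm_apply, Finset.sum_eq_single i]
  · by_cases hij : i = j <;> simp [hij]
  · intro b _ hb
    simp [hb]
  · simp

/-- The metric `∑ i, blockFactor n k i * (dy_i)^2` on `ℝ ^ n`. -/
def blockMetric : ContMDiffRiemannianMetric (𝓡 n) ∞ (EuclideanSpace ℝ (Fin n))
    (fun x : EuclideanSpace ℝ (Fin n) => TangentSpace (𝓡 n) x) where
  inner y := diagForm n fun i => blockFactor n k i y
  symm y v w := by
    refine (diagForm_apply n _ v w).trans (Eq.trans ?_ (diagForm_apply n _ w v).symm)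
    exact Finset.sum_congr rfl fun i _ => by ring
  pos y v hv := by
    refine lt_of_lt_of_eq ?_ (diagForm_apply n _ v v).symm
    obtain ⟨i, hi⟩ : ∃ i, (show EuclideanSpace ℝ (Fin n) from v).ofLp i ≠ 0 := by
      by_contra h
      push Not at h
      exact hv (PiLp.ext h)
    refine Finset.sum_pos' (fun j _ => mul_nonneg (blockFactor_pos n k j y).le
      (mul_self_nonneg _)) ⟨i, Finset.mem_univ _, mul_pos (blockFactor_pos n k i y) ?_⟩
    exact mul_self_pos.2 hi
  isVonNBounded y := by
    change Bornology.IsVonNBounded ℝ {v : EuclideanSpace ℝ (Fin n) | diagForm n _ v v < 1}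
    -- All factors are at least 1, so the unit ball of the form lies in the Euclidean one.
    refine (NormedSpace.isVonNBounded_ball ℝ (EuclideanSpace ℝ (Fin n)) 1).subset ?_
    intro v hv
    simp only [Set.mem_ofPred_eq, diagForm_apply] at hv
    rw [Metric.mem_ball, dist_zero_right, EuclideanSpace.norm_eq, Real.sqrt_lt' one_pos]
    refine lt_of_le_of_lt (Finset.sum_le_sum fun i _ => ?_) (hv.trans_le (by norm_num))
    rw [Real.norm_eq_abs, sq_abs, sq]
    exact le_mul_of_one_le_left (mul_self_nonneg _) (one_le_blockFactor n k i y)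
  contMDiff := by
    intro x
    refine (contMDiffAt_totalSpace).2 ⟨contMDiffAt_id, ?_⟩
    have : ContMDiffAt (𝓡 n) 𝓘(ℝ, EuclideanSpace ℝ (Fin n) →L[ℝ] EuclideanSpace ℝ (Fin n) →L[ℝ] ℝ)
        ∞ (fun y => diagForm n fun i => blockFactor n k i y) x := by
      rw [contMDiffAt_iff_contDiffAt]
      exact (contDiff_sum_smul _ (contDiff_blockFactor n k)).contDiffAt
    refine this.congr_of_eventuallyEq (Filter.Eventually.of_forall fun y => ?_)
    refine ContinuousLinearMap.ext fun v => ContinuousLinearMap.ext fun w => ?_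
    -- On the model space the trivialization of the tangent bundle is the identity, so the section
    -- in coordinates is the form itself.
    have hb : ∀ z : EuclideanSpace ℝ (Fin n), z ∈ (trivializationAt (EuclideanSpace ℝ (Fin n))
        (fun x : EuclideanSpace ℝ (Fin n) => TangentSpace (𝓡 n) x) x).baseSet := by
      intro z; simp [TangentBundle.trivializationAt_baseSet, chartAt_self_eq]
    have hs : ∀ v : EuclideanSpace ℝ (Fin n), (trivializationAt (EuclideanSpace ℝ (Fin n))
        (fun x : EuclideanSpace ℝ (Fin n) => TangentSpace (𝓡 n) x) x).symm y v = v := by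
      intro v
      exact (Trivialization.symmL_apply (R := ℝ) _ (hb y) v).symm.trans (DFunLike.congr_fun (TangentBundle.symmL_model_space (𝕜 := ℝ) x y) v)
    refine (inCoordinates_apply_eq₂ (E₃ := Bundle.Trivial _ ℝ) (hb y) (hb y)
      (Set.mem_univ _)).trans ?_
    rw [hs, hs]
    simp only [Trivial.fiberBundle_trivializationAt', Trivial.linearMapAt_trivialization,
        LinearMap.id_coe, id_eq]
    rfl

/-- `ℝ ^ n` with the metric `blockMetric n k`. -/
def blockManifold : RiemannianManifold n where
  carrier := EuclideanSpace ℝ (Fin n)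
  metric := blockMetric n k

/-- The origin. -/
def blockPoint : (blockManifold n k).carrier := (0 : EuclideanSpace ℝ (Fin n))

/-- The standard frame at the origin. -/
def blockFrame (i : Fin n) : (blockManifold n k).Tangent (blockPoint n k) :=
  (EuclideanSpace.single i (1 : ℝ) : EuclideanSpace ℝ (Fin n))

lemma coordMetric_block (y : EuclideanSpace ℝ (Fin n)) (i j : Fin n) :
    (blockManifold n k).coordMetric (blockPoint n k) y i j =
      if i = j then blockFactor n k i y else 0 := by
  have h : ∀ i, ((blockManifold n k).coordVec (blockPoint n k) i y : EuclideanSpace ℝ (Fin n)) =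
      EuclideanSpace.single i (1 : ℝ) := by
    intro i
    change mfderiv 𝓘(ℝ, EuclideanSpace ℝ (Fin n)) (𝓡 n) 
      (extChartAt (𝓡 n) (0 : EuclideanSpace ℝ (Fin n))).symm y _ = _
    simp only [mfld_simps]
    erw [mfderiv_id]
    rfl
  change diagForm n _ ((blockManifold n k).coordVec (blockPoint n k) i y : EuclideanSpace ℝ (Fin n))
    ((blockManifold n k).coordVec (blockPoint n k) j y : EuclideanSpace ℝ (Fin n)) = _
  rw [h, h, diagForm_single]
  rfl

lemma tangentCoord_block (i j : Fin n) :
    (blockManifold n k).tangentCoord (blockPoint n k) (blockFrame n k i) j =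
      if i = j then 1 else 0 := by
  have h : (mfderiv (𝓡 n) 𝓘(ℝ, EuclideanSpace ℝ (Fin n))
      (extChartAt (𝓡 n) (0 : EuclideanSpace ℝ (Fin n))) (0 : EuclideanSpace ℝ (Fin n))
      (EuclideanSpace.single i (1 : ℝ) : EuclideanSpace ℝ (Fin n)) : EuclideanSpace ℝ (Fin n)) =
      EuclideanSpace.single i (1 : ℝ) := by
    simp only [mfld_simps]
    erw [mfderiv_id]
    rfl
  change (mfderiv (𝓡 n) 𝓘(ℝ, EuclideanSpace ℝ (Fin n))
      (extChartAt (𝓡 n) (0 : EuclideanSpace ℝ (Fin n))) (0 : EuclideanSpace ℝ (Fin n))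
      (EuclideanSpace.single i (1 : ℝ) : EuclideanSpace ℝ (Fin n)) : EuclideanSpace ℝ (Fin n)).ofLp
      j = _
  rw [h]
  simp [eq_comm]

lemma extChartAt_block :
    extChartAt (𝓡 n) (blockPoint n k) (blockPoint n k) = (0 : EuclideanSpace ℝ (Fin n)) := by
  change extChartAt (𝓡 n) (0 : EuclideanSpace ℝ (Fin n)) (0 : EuclideanSpace ℝ (Fin n)) = _
  simp [chartAt_self_eq]

lemma isOrthonormalFrame_block :
    (blockManifold n k).IsOrthonormalFrame (blockPoint n k) (blockFrame n k) := by
  intro i j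
  change diagForm n (fun i => blockFactor n k i 0) (EuclideanSpace.single i (1 : ℝ))
    (EuclideanSpace.single j (1 : ℝ)) = _
  rw [diagForm_single]
  simp [blockFactor]

lemma partialDeriv_blockFactor (i a : Fin n) (y : EuclideanSpace ℝ (Fin n)) :
    partialDeriv a (blockFactor n k i) y =
      if (i : ℕ) < k ∧ (a : ℕ) < k then 2 * y a else 0 := by
  unfold partialDeriv blockFactor
  have hp : ∀ b : Fin n, HasFDerivAt (fun y : EuclideanSpace ℝ (Fin n) => y b)
      (EuclideanSpace.proj (𝕜 := ℝ) b) y := fun b => (EuclideanSpace.proj (𝕜 := ℝ) b).hasFDerivAt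
  by_cases hi : (i : ℕ) < k
  · simp only [hi, if_true, true_and]
    rw [fderiv_const_add, fderiv_fun_sum]
    · rw [_root_.sum_apply, Finset.sum_eq_single a]
      · split_ifs
        · rw [((hp a).pow 2).fderiv]
          simp
        · simp
      · intro b _ hb
        split_ifs
        · rw [((hp b).pow 2).fderiv]
          simp [hb]
        · simp
      · simp
    · intro j _
      split_ifs <;> fun_prop
  · simp [hi]

lemma partialDeriv_partialDeriv_blockFactor (i a b : Fin n) (y : EuclideanSpace ℝ (Fin n)) :
    partialDeriv b (partialDeriv a (blockFactor n k i)) y =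
      if (i : ℕ) < k ∧ (a : ℕ) < k ∧ a = b then 2 else 0 := by
  have : partialDeriv a (blockFactor n k i) = fun y : EuclideanSpace ℝ (Fin n) => 
      if (i : ℕ) < k ∧ (a : ℕ) < k then 2 * y a else 0 :=
    funext fun y => partialDeriv_blockFactor n k i a y
  rw [this]
  unfold partialDeriv
  by_cases h : (i : ℕ) < k ∧ (a : ℕ) < k
  · simp only [h, and_self, if_true, true_and]
    have hp : HasFDerivAt (fun y : EuclideanSpace ℝ (Fin n) => 2 * y a)
      ((2 : ℝ) • EuclideanSpace.proj (𝕜 := ℝ) a) y :=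
      (EuclideanSpace.proj (𝕜 := ℝ) a).hasFDerivAt.const_mul 2
    rw [hp.fderiv]
    simp
  · simp only [h, if_false]
    rw [if_neg (by tauto)]
    simp

lemma coordMetric_block_fun (i j : Fin n) :
    (fun z => (blockManifold n k).coordMetric (blockPoint n k) z i j) =
      if i = j then blockFactor n k i else 0 := by
  ext y
  rw [coordMetric_block]
  split_ifs <;> rfl

lemma partialDeriv_zero (a : Fin n) : partialDeriv a (0 : EuclideanSpace ℝ (Fin n) → ℝ) = 0 := by
  ext y
  simp [partialDeriv]

/-- The origin is a critical point of all metric coefficients, so the Christoffel terms drop out and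
only the second derivatives of the factors remain. -/
lemma coordRiemann_block (a b c d : Fin n) :
    (blockManifold n k).coordRiemann (blockPoint n k) a b c d (0 : EuclideanSpace ℝ (Fin n)) =
      if (a : ℕ) < k ∧ (b : ℕ) < k then
        -2 * ((if a = c ∧ b = d then 1 else 0) - (if a = d ∧ b = c then 1 else 0)) else 0 := by
  have h0 : (0 : EuclideanSpace ℝ (Fin n)) ∈ (extChartAt (𝓡 n) (blockPoint n k)).target := by
    rw [← extChartAt_block n k]
    exact mem_extChartAt_target _
  have h1 : ∀ m i j, (blockManifold n k).christoffelLow (blockPoint n k) m i j 0 = 0 := by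
    intro m i j
    have : ∀ a i j, partialDeriv a
        (fun z => (blockManifold n k).coordMetric (blockPoint n k) z i j) 0 = 0 := by
      intro a i j
      rw [coordMetric_block_fun]
      split_ifs
      · rw [partialDeriv_blockFactor]; simp
      · rw [partialDeriv_zero]; rfl
    simp [RiemannianManifold.christoffelLow, this]
  have h2 : ∀ p q i j, partialDeriv p (partialDeriv q
      (fun z => (blockManifold n k).coordMetric (blockPoint n k) z i j)) 0 =
      if i = j ∧ p = q ∧ (i : ℕ) < k ∧ (p : ℕ) < k then 2 else 0 := by
    intro p q i j
    rw [coordMetric_block_fun]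
    by_cases hij : i = j
    · rw [if_pos hij, partialDeriv_partialDeriv_blockFactor]
      congr 1
      apply propext
      constructor
      · rintro ⟨h, h', rfl⟩; tauto
      · rintro ⟨_, rfl, h, h'⟩; tauto
    · rw [if_neg hij, if_neg (by tauto), partialDeriv_zero, partialDeriv_zero]; rfl
  rw [RiemannianManifold.coordRiemann_eq h0]
  simp only [h1, h2, zero_mul, Finset.sum_const_zero, add_zero, sub_zero]
  have e1 : (a = d ∧ c = b ∧ (a : ℕ) < k ∧ (c : ℕ) < k) ↔
      (((a : ℕ) < k ∧ (b : ℕ) < k) ∧ a = d ∧ b = c) := by grind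
  have e2 : (b = c ∧ d = a ∧ (b : ℕ) < k ∧ (d : ℕ) < k) ↔
      (((a : ℕ) < k ∧ (b : ℕ) < k) ∧ a = d ∧ b = c) := by grind
  have e3 : (b = d ∧ c = a ∧ (b : ℕ) < k ∧ (c : ℕ) < k) ↔
      (((a : ℕ) < k ∧ (b : ℕ) < k) ∧ a = c ∧ b = d) := by grind
  have e4 : (a = c ∧ d = b ∧ (a : ℕ) < k ∧ (d : ℕ) < k) ↔
      (((a : ℕ) < k ∧ (b : ℕ) < k) ∧ a = c ∧ b = d) := by grind
  simp only [e1, e2, e3, e4]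
  by_cases hab : (a : ℕ) < k ∧ (b : ℕ) < k
  · simp only [hab, and_self, true_and, if_true]
    split_ifs <;> norm_num
  · simp [hab]

lemma riemann_block (a b c d : Fin n) :
    (blockManifold n k).riemann (blockPoint n k) (blockFrame n k a) (blockFrame n k b)
      (blockFrame n k c) (blockFrame n k d) =
      if (a : ℕ) < k ∧ (b : ℕ) < k then
        -2 * ((if a = c ∧ b = d then 1 else 0) - (if a = d ∧ b = c then 1 else 0)) else 0 := by
  rw [← coordRiemann_block]
  simp only [RiemannianManifold.riemann, tangentCoord_block, extChartAt_block]
  simp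

end Example

end Curvature

/-! ### Skew tensors and multiplication by the metric. -/

section Alternating

variable {X : Type}

/-- Invariance up to sign under permutations of the arguments. -/
def IsSkew {k : ℕ} (f : (Fin k → X) → ℝ) : Prop :=
  ∀ (σ : Equiv.Perm (Fin k)) (v : Fin k → X),
    f (fun s => v (σ s)) = ((Equiv.Perm.sign σ : ℤ) : ℝ) * f v

/-- Skewness in each of the two groups of arguments. -/
def IsBiskew {k : ℕ} (T : Tensor2 X k) : Prop :=
  (∀ w, IsSkew fun v => T v w) ∧ ∀ v, IsSkew (T v)

/-- τ is what σ induces once a and σ a are deleted. Moving these two to the front by cycles turns σ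
into a permutation fixing 0, and the cycles account for the two extra signs. -/
lemma exists_perm_succAbove {k : ℕ} (σ : Equiv.Perm (Fin (k + 1))) (a : Fin (k + 1)) :
    ∃ τ : Equiv.Perm (Fin k), (∀ s, σ (a.succAbove s) = (σ a).succAbove (τ s)) ∧
      ((Equiv.Perm.sign τ : ℤ) : ℝ) =
        (-1) ^ (a : ℕ) * (-1) ^ (σ a : ℕ) * ((Equiv.Perm.sign σ : ℤ) : ℝ) := by
  set ρ : Equiv.Perm (Fin (k + 1)) := (Fin.cycleRange (σ a)) * σ * (Fin.cycleRange a)⁻¹ with hρ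
  have h0 : ρ 0 = 0 := by simp [hρ]
  obtain ⟨⟨p, τ⟩, hp⟩ := Equiv.Perm.decomposeFin.symm.surjective ρ
  have hp0 : p = 0 := by
    have := congrArg (fun e : Equiv.Perm _ => e 0) hp
    simpa [h0] using this
  subst hp0
  refine ⟨τ, fun s => ?_, ?_⟩
  · have h1 : ρ s.succ = (τ s).succ := by
      rw [← hp]; simp
    have h2 : Fin.cycleRange (σ a) (σ (a.succAbove s)) = (τ s).succ := by
      rw [← h1, hρ]
      simp [Equiv.Perm.mul_apply, Equiv.Perm.inv_def]
    rw [← Fin.cycleRange_symm_succ (σ a), ← h2, Equiv.symm_apply_apply]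
  · have h3 : Equiv.Perm.sign τ = Equiv.Perm.sign ρ := by
      rw [← hp, Equiv.Perm.decomposeFin.symm_sign]; simp
    rw [h3, hρ]
    simp only [Equiv.Perm.sign_mul, Equiv.Perm.sign_inv, Fin.sign_cycleRange]
    push_cast
    ring

/-- This is the exterior product of φ and ψ; permuting the arguments permutes the deleted positions.
It gives the skewness of gT in one group at a time. -/
lemma IsSkew.sum_succAbove {k : ℕ} {ψ : (Fin k → X) → ℝ} (hψ : IsSkew ψ) (φ : X → ℝ) :
    IsSkew fun v : Fin (k + 1) → X =>
      ∑ a : Fin (k + 1), (-1 : ℝ) ^ (a : ℕ) * φ (v a) * ψ (fun s => v (a.succAbove s)) := by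
  intro σ v
  rw [Finset.mul_sum, ← Equiv.sum_comp σ]
  refine Finset.sum_congr rfl fun a _ => ?_
  obtain ⟨τ, h1, h2⟩ := exists_perm_succAbove σ a
  simp only [h1]
  rw [hψ τ (fun s => v ((σ a).succAbove s)), h2]
  have h3 : ((-1 : ℝ) ^ (a : ℕ)) * (-1) ^ (a : ℕ) = 1 := by
    rw [← mul_pow]; simp
  linear_combination ((-1 : ℝ) ^ (σ a : ℕ) * ((Equiv.Perm.sign σ : ℤ) : ℝ) * φ (v (σ a)) *
    ψ (fun s => v ((σ a).succAbove s))) * h3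

lemma IsSkew.add {k : ℕ} {f h : (Fin k → X) → ℝ} (hf : IsSkew f) (hh : IsSkew h) :
    IsSkew fun v => f v + h v := fun σ v => by
  dsimp only; rw [hf, hh]; ring

lemma IsSkew.const_mul {k : ℕ} {f : (Fin k → X) → ℝ} (c : ℝ) (hf : IsSkew f) :
    IsSkew fun v => c * f v := fun σ v => by
  dsimp only; rw [hf]; ring

lemma IsSkew.sum {k : ℕ} {ι : Type*} (s : Finset ι) {f : ι → (Fin k → X) → ℝ}
    (hf : ∀ i, IsSkew (f i)) : IsSkew fun v => ∑ i ∈ s, f i v := fun σ v => by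
  dsimp only; rw [Finset.mul_sum]
  exact Finset.sum_congr rfl fun i _ => hf i σ v

/-- A cycle of sign (-1)^a brings the argument v a to the front. -/
lemma IsSkew.cons_succAbove {k : ℕ} {f : (Fin (k + 1) → X) → ℝ} (hf : IsSkew f)
    (v : Fin (k + 1) → X) (a : Fin (k + 1)) :
    f (Fin.cons (v a) fun s => v (a.succAbove s)) = (-1) ^ (a : ℕ) * f v := by
  have : (Fin.cons (v a) fun s => v (a.succAbove s) : Fin (k + 1) → X) =
      fun s => v ((Fin.cycleRange a).symm s) := by
    funext s
    refine Fin.cases ?_ (fun s => ?_) s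
    · simp
    · simp [Fin.cycleRange_symm_succ]
  rw [this, hf]
  simp

lemma IsSkew.cons {k : ℕ} {f : (Fin (k + 1) → X) → ℝ} (hf : IsSkew f) (x : X) :
    IsSkew fun v => f (Fin.cons x v) := by
  intro σ v
  have : (Fin.cons x fun s => v (σ s) : Fin (k + 1) → X) =
      fun s => (Fin.cons x v : Fin (k + 1) → X) (Equiv.Perm.decomposeFin.symm (0, σ) s) := by
    funext s
    refine Fin.cases ?_ (fun s => ?_) s <;> simp
  dsimp only
  rw [this, hf, Equiv.Perm.decomposeFin.symm_sign]
  simp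

/-- The two groups of arguments exchanged. -/
def transpose {k : ℕ} (T : Tensor2 X k) : Tensor2 X k := fun v w => T w v

lemma IsBiskew.transpose {k : ℕ} {T : Tensor2 X k} (hT : IsBiskew T) :
    IsBiskew (transpose T) := ⟨hT.2, hT.1⟩

lemma metricMul_transpose {g : X → X → ℝ} (hg : ∀ a b, g a b = g b a) {k : ℕ} (T : Tensor2 X k) :
    metricMul g (transpose T) = transpose (metricMul g T) := by
  funext v w
  simp only [metricMul, transpose]
  rw [Finset.sum_comm]
  refine Finset.sum_congr rfl fun a _ => Finset.sum_congr rfl fun b _ => ?_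
  rw [hg, add_comm (a : ℕ)]

lemma IsBiskew.metricMul {g : X → X → ℝ} (hg : ∀ a b, g a b = g b a) {k : ℕ} {T : Tensor2 X k}
    (hT : IsBiskew T) : IsBiskew (metricMul g T) := by
  have key : ∀ {T : Tensor2 X k}, IsBiskew T → ∀ w, IsSkew fun v => DoubleForms.metricMul g T v w := by
    intro T hT w
    have : (fun v => DoubleForms.metricMul g T v w) = fun v => ∑ b : Fin (k + 1), (-1) ^ (b : ℕ) *
        ∑ a : Fin (k + 1), (-1 : ℝ) ^ (a : ℕ) * g (v a) (w b) *
          T (fun s => v (a.succAbove s)) (fun s => w (b.succAbove s)) := by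
      funext v
      simp only [DoubleForms.metricMul, Finset.mul_sum]
      rw [Finset.sum_comm]
      refine Finset.sum_congr rfl fun a _ => Finset.sum_congr rfl fun b _ => ?_
      ring
    rw [this]
    exact IsSkew.sum _ fun b => IsSkew.const_mul _
      (IsSkew.sum_succAbove (hT.1 fun s => w (b.succAbove s)) fun x => g x (w b))
  refine ⟨key hT, fun v => ?_⟩
  have := key hT.transpose v
  rwa [metricMul_transpose hg] at this

lemma metricMul_add (g : X → X → ℝ) {k : ℕ} (T S : Tensor2 X k) :
    metricMul g (T + S) = metricMul g T + metricMul g S := by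
  funext v w
  simp [metricMul, mul_add, Finset.sum_add_distrib]

lemma metricMul_smul (g : X → X → ℝ) {k : ℕ} (c : ℝ) (T : Tensor2 X k) :
    metricMul g (c • T) = c • metricMul g T := by
  funext v w
  simp only [metricMul, Pi.smul_apply, smul_eq_mul, Finset.mul_sum]
  refine Finset.sum_congr rfl fun a _ => Finset.sum_congr rfl fun b _ => ?_
  ring

/-- Exterior multiplication by the metric, as a linear map. -/
def metricMulₗ (g : X → X → ℝ) (k : ℕ) : Tensor2 X k →ₗ[ℝ] Tensor2 X (k + 1) where
  toFun := metricMul g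
  map_add' := metricMul_add g
  map_smul' := metricMul_smul g

lemma metricMul_zero (g : X → X → ℝ) {k : ℕ} : metricMul g (0 : Tensor2 X k) = 0 :=
  map_zero (metricMulₗ g k)

@[simp] lemma metricPow_self (g : X → X → ℝ) {i : ℕ} (T : Tensor2 X i) : metricPow g i T = T := by
  cases i <;> simp [metricPow]

lemma metricPow_succ (g : X → X → ℝ) {i m : ℕ} (h : i ≤ m) (T : Tensor2 X i) :
    metricPow g (m + 1) T = metricMul g (metricPow g m T) := by
  rw [metricPow, dif_neg (by omega)]

lemma metricPow_of_lt (g : X → X → ℝ) {i m : ℕ} (h : m < i) (T : Tensor2 X i) :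
    metricPow g m T = 0 := by
  induction m with
  | zero => rw [metricPow, dif_neg (by omega)]
  | succ m ih => rw [metricPow, dif_neg (by omega), ih (by omega), metricMul_zero]

/-- The map `T ↦ g ^ (m - i) T`, as a linear map. -/
def metricPowₗ (g : X → X → ℝ) (i m : ℕ) : Tensor2 X i →ₗ[ℝ] Tensor2 X m where
  toFun := metricPow g m
  map_add' T S := by
    rcases lt_or_ge m i with h | h
    · simp [metricPow_of_lt g h]
    · induction m, h using Nat.le_induction with
      | base => simp
      | succ m h ih => simp only [metricPow_succ g h, ih, metricMul_add]
  map_smul' c T := by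
    rcases lt_or_ge m i with h | h
    · simp [metricPow_of_lt g h]
    · induction m, h using Nat.le_induction with
      | base => simp
      | succ m h ih =>
        simp only [RingHom.id_apply] at ih ⊢
        simp only [metricPow_succ g h, ih, metricMul_smul]

lemma metricPow_smul (g : X → X → ℝ) {i : ℕ} (m : ℕ) (c : ℝ) (T : Tensor2 X i) :
    metricPow g m (c • T) = c • metricPow g m T := map_smul (metricPowₗ g i m) c T

@[simp] lemma metricPow_zero (g : X → X → ℝ) {i : ℕ} (m : ℕ) :
    metricPow g m (0 : Tensor2 X i) = 0 := map_zero (metricPowₗ g i m)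

lemma IsBiskew.metricPow {g : X → X → ℝ} (hg : ∀ a b, g a b = g b a) {i : ℕ} {T : Tensor2 X i}
    (hT : IsBiskew T) (m : ℕ) : IsBiskew (metricPow g m T) := by
  rcases lt_or_ge m i with h | h
  · rw [metricPow_of_lt g h]
    exact ⟨fun w σ v => by simp, fun v σ w => by simp⟩
  · induction m, h using Nat.le_induction with
    | base => simpa
    | succ m h ih => rw [metricPow_succ g h]; exact ih.metricMul hg

lemma metricPow_transpose {g : X → X → ℝ} (hg : ∀ a b, g a b = g b a) {i : ℕ} (m : ℕ)
    (T : Tensor2 X i) : metricPow g m (transpose T) = transpose (metricPow g m T) := by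
  rcases lt_or_ge m i with h | h
  · rw [metricPow_of_lt g h, metricPow_of_lt g h]; rfl
  · induction m, h using Nat.le_induction with
    | base => simp
    | succ m h ih => rw [metricPow_succ g h, ih, metricMul_transpose hg, metricPow_succ g h]

end Alternating

/-! ### Contraction in an orthonormal frame and its commutation with the metric. -/

section Frame

variable {n : ℕ}

/-- The components of the metric in an orthonormal frame. -/
def frameMetric (n : ℕ) (a b : Fin n) : ℝ := if a = b then 1 else 0

lemma frameMetric_symm (a b : Fin n) : frameMetric n a b = frameMetric n b a := by
  simp [frameMetric, eq_comm]

/-- Contraction of the components in an orthonormal frame. -/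
abbrev trace {k : ℕ} (T : Tensor2 (Fin n) (k + 1)) : Tensor2 (Fin n) k := contract id T

lemma trace_apply {k : ℕ} (T : Tensor2 (Fin n) (k + 1)) (v w) :
    trace T v w = ∑ x, T (Fin.cons x v) (Fin.cons x w) := rfl

/-- Contraction as a linear map. -/
def traceₗ (n k : ℕ) : Tensor2 (Fin n) (k + 1) →ₗ[ℝ] Tensor2 (Fin n) k where
  toFun := trace
  map_add' T S := by funext v w; simp [trace_apply, Finset.sum_add_distrib]
  map_smul' c T := by funext v w; simp [trace_apply, Finset.mul_sum]

lemma IsBiskew.trace {k : ℕ} {T : Tensor2 (Fin n) (k + 1)} (hT : IsBiskew T) :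
    IsBiskew (trace T) :=
  ⟨fun w => IsSkew.sum _ fun x => (hT.1 (Fin.cons x w)).cons x,
    fun v => IsSkew.sum _ fun x => (hT.2 (Fin.cons x v)).cons x⟩

lemma cons_comp_succ_succAbove {X : Type} {k : ℕ} (x : X) (v : Fin (k + 1) → X) (a : Fin (k + 1)) :
    (fun s => (Fin.cons x v : Fin (k + 2) → X) (a.succ.succAbove s)) =
      Fin.cons x fun s => v (a.succAbove s) := by
  funext s
  refine Fin.cases ?_ (fun s => ?_) s <;> simp

lemma sum_frameMetric_mul (f : Fin n → ℝ) (a : Fin n) : ∑ x, frameMetric n x a * f x = f a := by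
  simp [frameMetric]

lemma sum_frameMetric_mul' (f : Fin n → ℝ) (a : Fin n) : ∑ x, frameMetric n a x * f x = f a := by
  simp [frameMetric]

lemma trace_metricMul_zero {T : Tensor2 (Fin n) 0} :
    trace (metricMul (frameMetric n) T) = (n : ℝ) • T := by
  funext v w
  simp [trace_apply, metricMul, frameMetric]

/-- In gT the contracted index can enter the metric factor on both sides, which gives nT; on one
side only, where each of the 2(k+1) positions gives -T; or on neither side, which gives g c(T). -/
lemma trace_metricMul {k : ℕ} {T : Tensor2 (Fin n) (k + 1)} (hT : IsBiskew T) :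
    trace (metricMul (frameMetric n) T) =
      metricMul (frameMetric n) (trace T) + ((n : ℝ) - 2 * (k + 1)) • T := by
  funext v w
  have h2 : ∀ b : Fin (k + 1), ∑ x, (-1 : ℝ) ^ ((b : ℕ) + 1) * frameMetric n x (w b) *
      T v (Fin.cons x fun s => w (b.succAbove s)) = - T v w := by
    intro b
    have := sum_frameMetric_mul (fun x => (-1 : ℝ) ^ ((b : ℕ) + 1) *
      T v (Fin.cons x fun s => w (b.succAbove s))) (w b)
    rw [(hT.2 v).cons_succAbove w b, ← mul_assoc, ← pow_add] at this
    rw [Odd.neg_one_pow (n := (b : ℕ) + 1 + b) ⟨b, by ring⟩, neg_one_mul] at this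
    rw [← this]
    exact Finset.sum_congr rfl fun x _ => by ring
  have h3 : ∀ a : Fin (k + 1), ∑ x, (-1 : ℝ) ^ ((a : ℕ) + 1) * frameMetric n (v a) x *
      T (Fin.cons x fun s => v (a.succAbove s)) w = - T v w := by
    intro a
    have := sum_frameMetric_mul' (fun x => (-1 : ℝ) ^ ((a : ℕ) + 1) *
      T (Fin.cons x fun s => v (a.succAbove s)) w) (v a)
    rw [(hT.1 w).cons_succAbove v a, ← mul_assoc, ← pow_add] at this
    rw [Odd.neg_one_pow (n := (a : ℕ) + 1 + a) ⟨a, by ring⟩, neg_one_mul] at this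
    rw [← this]
    exact Finset.sum_congr rfl fun x _ => by ring
  have h4 : ∀ x, metricMul (frameMetric n) T (Fin.cons x v) (Fin.cons x w) =
      T v w + ∑ b : Fin (k + 1), (-1 : ℝ) ^ ((b : ℕ) + 1) * frameMetric n x (w b) *
        T v (Fin.cons x fun s => w (b.succAbove s)) +
      (∑ a : Fin (k + 1), (-1 : ℝ) ^ ((a : ℕ) + 1) * frameMetric n (v a) x *
        T (Fin.cons x fun s => v (a.succAbove s)) w +
      ∑ a : Fin (k + 1), ∑ b : Fin (k + 1), (-1 : ℝ) ^ ((a : ℕ) + b) * frameMetric n (v a) (w b) *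
        T (Fin.cons x fun s => v (a.succAbove s)) (Fin.cons x fun s => w (b.succAbove s))) := by
    intro x
    rw [metricMul, Fin.sum_univ_succ, Fin.sum_univ_succ]
    congr 1
    · congr 1
      · simp [frameMetric]
      · refine Finset.sum_congr rfl fun b _ => ?_
        rw [cons_comp_succ_succAbove]
        simp
    · rw [← Finset.sum_add_distrib]
      refine Finset.sum_congr rfl fun a _ => ?_
      rw [Fin.sum_univ_succ]
      congr 1
      · rw [cons_comp_succ_succAbove]
        simp
      · refine Finset.sum_congr rfl fun b _ => ?_
        rw [cons_comp_succ_succAbove, cons_comp_succ_succAbove]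
        simp only [Fin.val_succ, Fin.cons_succ]
        rw [show (a : ℕ) + 1 + (b + 1) = a + b + 2 by ring, pow_add]
        simp
  rw [trace_apply, Finset.sum_congr rfl fun x _ => h4 x]
  simp only [Finset.sum_add_distrib]
  rw [Finset.sum_comm, Finset.sum_congr rfl fun b _ => h2 b]
  rw [Finset.sum_comm (f := fun x (a : Fin (k + 1)) => (-1 : ℝ) ^ ((a : ℕ) + 1) * frameMetric n (v a) x *
        T (Fin.cons x fun s => v (a.succAbove s)) w), Finset.sum_congr rfl fun b _ => h3 b]
  simp only [Finset.sum_const, Finset.card_univ, Fintype.card_fin, Pi.add_apply, Pi.smul_apply,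
    smul_eq_mul, metricMul, trace_apply, Finset.mul_sum]
  rw [Finset.sum_comm, Finset.sum_congr rfl fun a _ => Finset.sum_comm]
  simp only [nsmul_eq_mul]
  push_cast
  ring

end Frame

/-! ### The trace-free decomposition of skew tensors. -/

section Frame

variable {n : ℕ}

lemma sum_removeNth {X : Type} [Fintype X] {k : ℕ} (a : Fin (k + 1)) (H : X → (Fin k → X) → ℝ) :
    ∑ v : Fin (k + 1) → X, H (v a) (fun s => v (a.succAbove s)) = ∑ x, ∑ v, H x v := by
  classical
  rw [← Fintype.sum_prod_type']
  exact Fintype.sum_equiv (Fin.insertNthEquiv (fun _ => X) a).symm _ _ fun v => rfl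

/-- The inner product of two tensors, up to normalization. -/
def pairing {k : ℕ} (T S : Tensor2 (Fin n) k) : ℝ := ∑ v, ∑ w, T v w * S v w

lemma pairing_comm {k : ℕ} (T S : Tensor2 (Fin n) k) : pairing T S = pairing S T := by
  simp only [pairing, mul_comm]

lemma eq_zero_of_pairing_self_nonpos {k : ℕ} {T : Tensor2 (Fin n) k} (h : pairing T T ≤ 0) :
    T = 0 := by
  have h1 : ∀ v ∈ Finset.univ, 0 ≤ ∑ w, T v w * T v w := fun v _ =>
    Finset.sum_nonneg fun w _ => mul_self_nonneg _
  have h2 := (Finset.sum_eq_zero_iff_of_nonneg h1).1 (le_antisymm h (Finset.sum_nonneg h1))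
  funext v w
  have h3 := (Finset.sum_eq_zero_iff_of_nonneg fun w _ => mul_self_nonneg (T v w)).1
    (h2 v (Finset.mem_univ _)) w (Finset.mem_univ _)
  simpa using h3

lemma pairing_smul_right {k : ℕ} (c : ℝ) (T S : Tensor2 (Fin n) k) :
    pairing T (c • S) = c * pairing T S := by
  simp only [pairing, Pi.smul_apply, smul_eq_mul, Finset.mul_sum]
  exact Finset.sum_congr rfl fun v _ => Finset.sum_congr rfl fun w _ => by ring

/-- Multiplication by the metric is adjoint to contraction. -/
lemma pairing_metricMul {k : ℕ} (T : Tensor2 (Fin n) k) {U : Tensor2 (Fin n) (k + 1)}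
    (hU : IsBiskew U) :
    pairing (metricMul (frameMetric n) T) U = ((k : ℝ) + 1) ^ 2 * pairing T (trace U) := by
  have h1 : ∀ a b : Fin (k + 1), ∑ v : Fin (k + 1) → Fin n, ∑ w : Fin (k + 1) → Fin n,
      (-1 : ℝ) ^ ((a : ℕ) + b) * frameMetric n (v a) (w b) *
        T (fun s => v (a.succAbove s)) (fun s => w (b.succAbove s)) * U v w =
      pairing T (trace U) := by
    intro a b
    -- Moving v a and w b to the front of U absorbs the sign of the exterior product, so all (k+1)^2
    -- pairs (a, b) contribute equally.
    have h2 : ∀ v w, (-1 : ℝ) ^ ((a : ℕ) + b) * U v w =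
        U (Fin.cons (v a) fun s => v (a.succAbove s))
          (Fin.cons (w b) fun s => w (b.succAbove s)) := by
      intro v w
      rw [(hU.1 _).cons_succAbove v a, (hU.2 _).cons_succAbove w b, pow_add]
      ring
    have h3 : ∀ v w, (-1 : ℝ) ^ ((a : ℕ) + b) * frameMetric n (v a) (w b) *
        T (fun s => v (a.succAbove s)) (fun s => w (b.succAbove s)) * U v w =
        frameMetric n (v a) (w b) *
        T (fun s => v (a.succAbove s)) (fun s => w (b.succAbove s)) *
        U (Fin.cons (v a) fun s => v (a.succAbove s))
          (Fin.cons (w b) fun s => w (b.succAbove s)) := by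
      intro v w
      rw [← h2]; ring
    simp only [h3]
    rw [Finset.sum_congr rfl fun v _ => sum_removeNth b fun y w' => frameMetric n (v a) y *
        T (fun s => v (a.succAbove s)) w' * U (Fin.cons (v a) fun s => v (a.succAbove s))
          (Fin.cons y w')]
    rw [sum_removeNth a fun x v' => ∑ y, ∑ w', frameMetric n x y * T v' w' *
      U (Fin.cons x v') (Fin.cons y w')]
    have h5 : ∀ x v', ∑ y, ∑ w', frameMetric n x y * T v' w' * U (Fin.cons x v') (Fin.cons y w') =
        ∑ w', T v' w' * U (Fin.cons x v') (Fin.cons x w') := by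
      intro x v'
      simp only [mul_assoc, ← Finset.mul_sum]
      rw [sum_frameMetric_mul']
    simp only [h5, pairing, trace_apply, Finset.mul_sum]
    rw [Finset.sum_comm]
    exact Finset.sum_congr rfl fun v' _ => Finset.sum_comm
  have h4 : pairing (metricMul (frameMetric n) T) U = ∑ a : Fin (k + 1), ∑ b : Fin (k + 1),
      ∑ v : Fin (k + 1) → Fin n, ∑ w : Fin (k + 1) → Fin n,
      (-1 : ℝ) ^ ((a : ℕ) + b) * frameMetric n (v a) (w b) *
        T (fun s => v (a.succAbove s)) (fun s => w (b.succAbove s)) * U v w := by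
    simp only [pairing, metricMul, Finset.sum_mul]
    calc _ = ∑ v : Fin (k + 1) → Fin n, ∑ a : Fin (k + 1), ∑ b : Fin (k + 1),
          ∑ w : Fin (k + 1) → Fin n, (-1 : ℝ) ^ ((a : ℕ) + b) * frameMetric n (v a) (w b) *
            T (fun s => v (a.succAbove s)) (fun s => w (b.succAbove s)) * U v w :=
          Finset.sum_congr rfl fun v _ => by
            rw [Finset.sum_comm]
            exact Finset.sum_congr rfl fun a _ => Finset.sum_comm
      _ = _ := by
          rw [Finset.sum_comm]
          exact Finset.sum_congr rfl fun a _ => Finset.sum_comm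
  rw [h4]
  simp only [h1, Finset.sum_const, Finset.card_univ, Fintype.card_fin, nsmul_eq_mul]
  push_cast
  ring

/-- The vanishing of the contraction; no condition in degree zero. -/
def IsTraceFree : {k : ℕ} → Tensor2 (Fin n) k → Prop
  | 0, _ => True
  | _ + 1, T => trace T = 0

/-- Each commutation of c past g at degree j adds n - 2j; the factor is the sum of these over i ≤ j
≤ m. -/
lemma trace_metricPow {i : ℕ} {θ : Tensor2 (Fin n) i} (hθ : IsBiskew θ) (ht : IsTraceFree θ)
    {m : ℕ} (h : i ≤ m) : trace (metricPow (frameMetric n) (m + 1) θ) =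
      (((m : ℝ) + 1 - i) * (n - i - m)) • metricPow (frameMetric n) m θ := by
  induction m, h using Nat.le_induction with
  | base =>
    rw [metricPow_succ _ le_rfl, metricPow_self]
    cases i with
    | zero => rw [trace_metricMul_zero]; simp
    | succ i =>
      rw [trace_metricMul hθ, show trace θ = 0 from ht, metricMul_zero, zero_add]
      congr 1; push_cast; ring
  | succ m h ih =>
    rw [metricPow_succ _ (by omega : i ≤ m + 1),
      trace_metricMul (hθ.metricPow frameMetric_symm _), ih, metricMul_smul,
      ← metricPow_succ _ h, ← add_smul]
    congr 1; push_cast; ring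

/-- Since squared norms are non-negative, the sign of n - i - m in this recursion forces the
vanishing in high degrees. -/
lemma pairing_metricPow_self {i : ℕ} {θ : Tensor2 (Fin n) i} (hθ : IsBiskew θ)
    (ht : IsTraceFree θ) {m : ℕ} (h : i ≤ m) :
    pairing (metricPow (frameMetric n) (m + 1) θ) (metricPow (frameMetric n) (m + 1) θ) =
      ((m : ℝ) + 1) ^ 2 * (((m : ℝ) + 1 - i) * (n - i - m)) *
        pairing (metricPow (frameMetric n) m θ) (metricPow (frameMetric n) m θ) := by
  conv_lhs => arg 1; rw [metricPow_succ _ h]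
  rw [pairing_metricMul _ (hθ.metricPow frameMetric_symm _), trace_metricPow hθ ht h,
    pairing_smul_right]
  ring

lemma pairing_self_nonneg {k : ℕ} (T : Tensor2 (Fin n) k) : 0 ≤ pairing T T :=
  Finset.sum_nonneg fun _ _ => Finset.sum_nonneg fun _ _ => mul_self_nonneg _

/-- For m > i the squared norm is a non-positive multiple of the one in degree m - 1. For m = i the
recursion is used one degree higher: the squared norm of gθ would be a negative multiple of that of
θ. -/
lemma metricPow_eq_zero_of_gt {i : ℕ} {θ : Tensor2 (Fin n) i} (hθ : IsBiskew θ)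
    (ht : IsTraceFree θ) {m : ℕ} (hm : n < m + i) : metricPow (frameMetric n) m θ = 0 := by
  rcases lt_or_ge m i with h | h
  · exact metricPow_of_lt _ h _
  rcases h.eq_or_lt with rfl | h
  · have h1 := pairing_metricPow_self hθ ht le_rfl
    have h2 := pairing_self_nonneg (metricPow (frameMetric n) (i + 1) θ)
    apply eq_zero_of_pairing_self_nonpos
    by_contra h3
    push Not at h3
    have h4 : ((n : ℝ) - i - i) < 0 := by
      have : (n : ℝ) < i + i := by exact_mod_cast hm
      linarith
    have h5 : ((i : ℝ) + 1) ^ 2 * (((i : ℝ) + 1 - i) * (n - i - i)) < 0 := by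
      rw [show (i : ℝ) + 1 - i = 1 by ring, one_mul]
      exact mul_neg_of_pos_of_neg (by positivity) h4
    have := mul_neg_of_neg_of_pos h5 h3
    linarith
  · obtain ⟨m, rfl⟩ : ∃ m', m = m' + 1 := ⟨m - 1, by omega⟩
    apply eq_zero_of_pairing_self_nonpos
    rw [pairing_metricPow_self hθ ht (by omega)]
    refine mul_nonpos_of_nonpos_of_nonneg ?_ (pairing_self_nonneg _)
    refine mul_nonpos_of_nonneg_of_nonpos (by positivity)
      (mul_nonpos_of_nonneg_of_nonpos ?_ ?_)
    · have : (i : ℝ) ≤ m + 1 := by exact_mod_cast h.le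
      linarith
    · have : (n : ℝ) < m + 1 + i := by exact_mod_cast hm
      have : (n : ℝ) ≤ m + i := by exact_mod_cast (by omega : n ≤ m + i)
      linarith

/-- In this range each contraction removes one power of g at the cost of a positive factor, down to
θ itself. -/
lemma eq_zero_of_metricPow_eq_zero {i : ℕ} {θ : Tensor2 (Fin n) i} (hθ : IsBiskew θ)
    (ht : IsTraceFree θ) {m : ℕ} (him : i ≤ m) (hm : m + i ≤ n)
    (h : metricPow (frameMetric n) m θ = 0) : θ = 0 := by
  induction m, him using Nat.le_induction with
  | base => simpa using h
  | succ m him ih =>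
    apply ih (by omega)
    have h1 := trace_metricPow hθ ht him
    rw [h, show trace (0 : Tensor2 (Fin n) (m + 1)) = 0 from map_zero (traceₗ n m)] at h1
    refine (smul_eq_zero.1 h1.symm).resolve_left ?_
    have h2 : (i : ℝ) ≤ m := by exact_mod_cast him
    have h3 : (m : ℝ) + 1 + i ≤ n := by exact_mod_cast hm
    have h4 : 0 < (m : ℝ) + 1 - i := by linarith
    have h5 : 0 < (n : ℝ) - i - m := by linarith
    positivity

/-- The components in a frame of the decomposition into trace free parts. -/
structure IsFrameDecomposition {k : ℕ} (T : Tensor2 (Fin n) k) (θ : (i : ℕ) → Tensor2 (Fin n) i) :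
    Prop where
  isBiskew : ∀ i, IsBiskew (θ i)
  traceFree : ∀ i, IsTraceFree (θ i)
  eq_zero : ∀ i, min k (n - k) < i → θ i = 0
  eq_sum : T = ∑ i ∈ Finset.range (k + 1), metricPow (frameMetric n) k (θ i)

lemma IsBiskew.smul {X : Type} {k : ℕ} {T : Tensor2 X k} (hT : IsBiskew T) (c : ℝ) :
    IsBiskew (c • T) :=
  ⟨fun w => (hT.1 w).const_mul c, fun v => (hT.2 v).const_mul c⟩

lemma IsBiskew.sub {X : Type} {k : ℕ} {T S : Tensor2 X k} (hT : IsBiskew T) (hS : IsBiskew S) :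
    IsBiskew (T - S) :=
  ⟨fun w σ v => by have := hT.1 w σ v; have := hS.1 w σ v; simp_all [mul_sub],
   fun v σ w => by have := hT.2 v σ w; have := hS.2 v σ w; simp_all [mul_sub]⟩

lemma IsTraceFree.smul {k : ℕ} {T : Tensor2 (Fin n) k} (hT : IsTraceFree T) (c : ℝ) :
    IsTraceFree (c • T) := by
  cases k with
  | zero => trivial
  | succ k => 
    have : trace (c • T) = c • trace T := map_smul (traceₗ n k) c T
    rw [IsTraceFree, this, show trace T = 0 from hT, smul_zero]

lemma IsTraceFree.sub {k : ℕ} {T S : Tensor2 (Fin n) k} (hT : IsTraceFree T)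
    (hS : IsTraceFree S) : IsTraceFree (T - S) := by
  cases k with
  | zero => trivial
  | succ k => 
    have : trace (T - S) = trace T - trace S := map_sub (traceₗ n k) T S
    rw [IsTraceFree, this, show trace T = 0 from hT, show trace S = 0 from hS, sub_zero]

/-- Contraction removes the term of top degree and rescales the others, by factors that are non-zero
wherever the component is not zero by assumption. Induction on k kills these, and then the top term
is all that is left. -/
lemma eq_zero_of_sum_metricPow_eq_zero {k : ℕ} (hk : k ≤ n) {θ : (i : ℕ) → Tensor2 (Fin n) i}
    (hs : ∀ i, IsBiskew (θ i)) (ht : ∀ i, IsTraceFree (θ i)) (h0 : ∀ i, n - k < i → θ i = 0)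
    (h : ∑ i ∈ Finset.range (k + 1), metricPow (frameMetric n) k (θ i) = 0) :
    ∀ i ≤ k, θ i = 0 := by
  induction k generalizing θ with
  | zero =>
    intro i hi
    obtain rfl : i = 0 := by omega
    simpa using h
  | succ k ih =>
    have h1 := congrArg (traceₗ n k) h
    rw [map_zero, Finset.sum_range_succ, map_add, map_sum, metricPow_self,
      show traceₗ n k (θ (k + 1)) = 0 from ht (k + 1), add_zero] at h1
    have h2 : ∑ i ∈ Finset.range (k + 1), metricPow (frameMetric n) k
        ((((k : ℝ) + 1 - i) * (n - i - k)) • θ i) = 0 := by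
      rw [← h1]
      refine Finset.sum_congr rfl fun i hi => ?_
      rw [metricPow_smul]
      exact (trace_metricPow (hs i) (ht i) (Finset.mem_range_succ_iff.1 hi)).symm
    have h3 := ih (by omega) (θ := fun i => (((k : ℝ) + 1 - i) * (n - i - k)) • θ i)
      (fun i => (hs i).smul _) (fun i => (ht i).smul _)
      (fun i hi => by rw [h0 i (by omega), smul_zero]) h2
    have h4 : ∀ i ≤ k, θ i = 0 := by
      intro i hi
      by_cases hi' : n - (k + 1) < i
      · exact h0 i hi'
      refine (smul_eq_zero.1 (h3 i hi)).resolve_left ?_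
      have e2 : (i : ℝ) ≤ k := by exact_mod_cast hi
      have e3 : (k : ℝ) + 1 + i ≤ n := by exact_mod_cast (by omega : k + 1 + i ≤ n)
      have e4 : 0 < (k : ℝ) + 1 - i := by linarith
      have e5 : 0 < (n : ℝ) - i - k := by linarith
      positivity
    intro i hi
    rcases hi.eq_or_lt with rfl | hi
    · rw [Finset.sum_range_succ, Finset.sum_eq_zero, zero_add, metricPow_self] at h
      · exact h
      · intro i hi
        rw [h4 i (Finset.mem_range_succ_iff.1 hi), metricPow_zero]
    · exact h4 i (by omega)

lemma metricPow_sub {X : Type} (g : X → X → ℝ) {i : ℕ} (m : ℕ) (T S : Tensor2 X i) :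
    metricPow g m (T - S) = metricPow g m T - metricPow g m S := map_sub (metricPowₗ g i m) T S

lemma IsFrameDecomposition.unique {k : ℕ} (hk : k ≤ n) {T : Tensor2 (Fin n) k}
    {θ η : (i : ℕ) → Tensor2 (Fin n) i} (hθ : IsFrameDecomposition T θ)
    (hη : IsFrameDecomposition T η) : θ = η := by
  have h := eq_zero_of_sum_metricPow_eq_zero hk (θ := fun i => θ i - η i)
    (fun i => (hθ.isBiskew i).sub (hη.isBiskew i)) (fun i => (hθ.traceFree i).sub (hη.traceFree i))
    (fun i hi => by rw [hθ.eq_zero i (by omega), hη.eq_zero i (by omega), sub_zero])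
    (by simp only [metricPow_sub, Finset.sum_sub_distrib, ← hθ.eq_sum, ← hη.eq_sum, sub_self])
  funext i
  by_cases hi : i ≤ k
  · exact sub_eq_zero.1 (h i hi)
  · rw [hθ.eq_zero i (by omega), hη.eq_zero i (by omega)]

/-- The tensors that are skew in both groups of arguments. -/
def biskew (n k : ℕ) : Submodule ℝ (Tensor2 (Fin n) k) where
  carrier := {T | IsBiskew T}
  add_mem' hT hS :=
    ⟨fun w => (hT.1 w).add (hS.1 w), fun v => (hT.2 v).add (hS.2 v)⟩
  zero_mem' := ⟨fun w σ v => by simp, fun v σ w => by simp⟩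
  smul_mem' c T hT := hT.smul c

/-- Tensors as vectors of a Euclidean space. -/
def toEuclidean (n k : ℕ) :
    Tensor2 (Fin n) k →ₗ[ℝ] EuclideanSpace ℝ ((Fin k → Fin n) × (Fin k → Fin n)) where
  toFun T := WithLp.toLp 2 fun p => T p.1 p.2
  map_add' _ _ := rfl
  map_smul' _ _ := rfl

lemma inner_toEuclidean {k : ℕ} (T S : Tensor2 (Fin n) k) :
    inner ℝ (toEuclidean n k T) (toEuclidean n k S) = pairing S T := by
  simp [toEuclidean, pairing, PiLp.inner_apply, Fintype.sum_prod_type]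
  rfl

/-- Let gS be the orthogonal projection of T onto the image of g on skew tensors. The remainder U is
orthogonal in particular to g c(U), so c(U) has norm zero by adjointness. -/
lemma exists_trace_sub_metricMul_eq_zero {k : ℕ} {T : Tensor2 (Fin n) (k + 1)} (hT : IsBiskew T) :
    ∃ S : Tensor2 (Fin n) k, IsBiskew S ∧ trace (T - metricMul (frameMetric n) S) = 0 := by
  set K := (biskew n k).map ((toEuclidean n (k + 1)).comp (metricMulₗ (frameMetric n) k)) with hK
  obtain ⟨S, hS, hS'⟩ := Submodule.mem_map.1 (K.starProjection_apply_mem (toEuclidean n (k + 1) T))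
  have hU : IsBiskew (T - metricMul (frameMetric n) S) :=
    hT.sub (IsBiskew.metricMul frameMetric_symm hS)
  refine ⟨S, hS, eq_zero_of_pairing_self_nonpos (le_of_eq ?_)⟩
  have h1 := K.sub_starProjection_mem_orthogonal (toEuclidean n (k + 1) T)
  have h2 := K.inner_left_of_mem_orthogonal (Submodule.mem_map_of_mem
    (f := (toEuclidean n (k + 1)).comp (metricMulₗ (frameMetric n) k)) hU.trace) h1
  rw [← hS', LinearMap.comp_apply, LinearMap.comp_apply, ← map_sub, inner_toEuclidean] at h2
  change pairing (metricMul (frameMetric n) (trace (T - metricMul (frameMetric n) S)))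
    (T - metricMul (frameMetric n) S) = 0 at h2
  rw [pairing_metricMul _ hU] at h2
  exact (mul_eq_zero.1 h2).resolve_left (by positivity)

lemma exists_sum_metricPow {k : ℕ} {T : Tensor2 (Fin n) k} (hT : IsBiskew T) :
    ∃ θ : (i : ℕ) → Tensor2 (Fin n) i, (∀ i, IsBiskew (θ i)) ∧ (∀ i, IsTraceFree (θ i)) ∧
      T = ∑ i ∈ Finset.range (k + 1), metricPow (frameMetric n) k (θ i) := by
  induction k with
  | zero =>
    refine ⟨Function.update (fun i => 0) 0 T, fun i => ?_, fun i => ?_, by simp⟩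
    · rcases eq_or_ne i 0 with rfl | h
      · simpa
      · rw [Function.update_of_ne h]; exact (biskew n i).zero_mem
    · cases i with
      | zero => trivial
      | succ i =>
        rw [Function.update_of_ne (by omega)]
        exact map_zero (traceₗ n i)
  | succ k ih =>
    obtain ⟨S, hS, hS'⟩ := exists_trace_sub_metricMul_eq_zero hT
    obtain ⟨θ, h1, h2, h3⟩ := ih hS
    refine ⟨Function.update θ (k + 1) (T - metricMul (frameMetric n) S), fun i => ?_, fun i => ?_,
      ?_⟩
    · rcases eq_or_ne i (k + 1) with rfl | h
      · rw [Function.update_self]; exact hT.sub (IsBiskew.metricMul frameMetric_symm hS)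
      · rw [Function.update_of_ne h]; exact h1 i
    · rcases eq_or_ne i (k + 1) with rfl | h
      · rw [Function.update_self]; exact hS'
      · rw [Function.update_of_ne h]; exact h2 i
    · rw [Finset.sum_range_succ, Function.update_self, metricPow_self]
      have : ∑ i ∈ Finset.range (k + 1), metricPow (frameMetric n) (k + 1)
          (Function.update θ (k + 1) (T - metricMul (frameMetric n) S) i) =
          metricMul (frameMetric n) S := by
        conv_rhs => rw [h3]
        rw [show metricMul (frameMetric n) = metricMulₗ (frameMetric n) k from rfl, map_sum]
        refine Finset.sum_congr rfl fun i hi => ?_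
        have hi := Finset.mem_range_succ_iff.1 hi
        rw [Function.update_of_ne (by omega), metricPow_succ _ hi]
        rfl
      rw [this, add_sub_cancel]

/-- Components of degree above n - k contribute nothing to the sum, so they can be replaced by zero.
-/
lemma exists_isFrameDecomposition {k : ℕ} {T : Tensor2 (Fin n) k} (hT : IsBiskew T) (hk : k ≤ n) :
    ∃ θ, IsFrameDecomposition T θ := by
  obtain ⟨θ, h1, h2, h3⟩ := exists_sum_metricPow hT
  refine ⟨fun i => if i ≤ min k (n - k) then θ i else 0, ⟨fun i => ?_, fun i => ?_, fun i hi => ?_,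
    ?_⟩⟩
  · split_ifs
    exacts [h1 i, (biskew n i).zero_mem]
  · split_ifs
    · exact h2 i
    · simpa using (h2 i).smul 0
  · exact if_neg (by omega)
  · rw [h3]
    refine Finset.sum_congr rfl fun i hi => ?_
    have hi := Finset.mem_range_succ_iff.1 hi
    split_ifs with h
    · rfl
    · rw [metricPow_eq_zero_of_gt (h1 i) (h2 i) (by omega), metricPow_zero]

end Frame

/-! ### The contraction operator and powers of the metric. -/

section Frame

variable {n : ℕ}

lemma isBiskew_kronecker {X : Type} (g : X → X → ℝ) {m : ℕ} :
    IsBiskew (fun u w : Fin m → X => kronecker g u w) :=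
  ⟨fun w σ u => by simpa [kronecker, Matrix.submatrix] using
      Matrix.det_permute σ (Matrix.of fun r s => g (u r) (w s)),
    fun u σ w => by simpa [kronecker, Matrix.submatrix] using
      Matrix.det_permute' σ (Matrix.of fun r s => g (u r) (w s))⟩

lemma kronecker_comp_cast {X : Type} (g : X → X → ℝ) {m m' : ℕ} (h : m' = m) (u w : Fin m → X) :
    kronecker g (u ∘ Fin.cast h) (w ∘ Fin.cast h) = kronecker g u w := by
  subst h; rfl

lemma kronecker_succ_row {X : Type} (g : X → X → ℝ) {m : ℕ} (u w : Fin (m + 1) → X)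
    (a : Fin (m + 1)) : kronecker g u w = ∑ b : Fin (m + 1), (-1 : ℝ) ^ ((a : ℕ) + b) *
      g (u a) (w b) * kronecker g (fun s => u (a.succAbove s)) (fun s => w (b.succAbove s)) :=
  Matrix.det_succ_row _ a

lemma metricMul_kronecker {X : Type} (g : X → X → ℝ) (m : ℕ) :
    metricMul g (fun u w : Fin m → X => kronecker g u w) =
      ((m : ℝ) + 1) • fun u w : Fin (m + 1) → X => kronecker g u w := by
  funext u w
  simp only [metricMul, ← kronecker_succ_row]
  simp

/-- The delta of degree m + 1 is g times the delta of degree m, divided by m + 1, so the commutation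
rule gives the factor by induction. -/
lemma trace_kronecker (m : ℕ) :
    trace (fun u w : Fin (m + 1) → Fin n => kronecker (frameMetric n) u w) =
      ((n : ℝ) - m) • fun u w : Fin m → Fin n => kronecker (frameMetric n) u w := by
  have hm : ((m : ℝ) + 1) ≠ 0 := by positivity
  have h1 : ((m : ℝ) + 1) • trace (fun u w : Fin (m + 1) → Fin n => kronecker (frameMetric n) u w) =
      trace (metricMul (frameMetric n) fun u w : Fin m → Fin n => kronecker (frameMetric n) u w) := by
    rw [metricMul_kronecker]
    exact (map_smul (traceₗ n m) _ _).symm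
  induction m with
  | zero =>
    rw [trace_metricMul_zero] at h1
    simpa using h1
  | succ m ih =>
    rw [trace_metricMul (isBiskew_kronecker _)] at h1
    rw [ih (by positivity) ?_, metricMul_smul, metricMul_kronecker, smul_smul, ← add_smul] at h1
    · have := congrArg (fun z => ((((m + 1 : ℕ) : ℝ) + 1)⁻¹) • z) h1
      simp only [smul_smul] at this
      rw [inv_mul_cancel₀ hm, one_smul] at this
      rw [this]
      congr 1
      field_simp
      push_cast
      ring
    · rw [metricMul_kronecker]
      exact (map_smul (traceₗ n m) _ _).symm

lemma append_comp_perm {X : Type} {k p : ℕ} (σ : Equiv.Perm (Fin k)) :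
    ∃ τ : Equiv.Perm (Fin (k + p)), Equiv.Perm.sign τ = Equiv.Perm.sign σ ∧
      ∀ (A : Fin k → X) (v : Fin p → X), Fin.append (fun s => A (σ s)) v =
        fun s => Fin.append A v (τ s) := by
  refine ⟨finSumFinEquiv.permCongr (Equiv.sumCongr σ 1), by simp, fun A v => ?_⟩
  funext s
  refine Fin.addCases (fun i => ?_) (fun i => ?_) s <;> simp [Equiv.permCongr_apply]

lemma IsSkew.append {X : Type} {k p : ℕ} {f : (Fin (k + p) → X) → ℝ} (hf : IsSkew f)
    (v : Fin p → X) : IsSkew fun A : Fin k → X => f (Fin.append A v) := by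
  intro σ A
  obtain ⟨τ, h1, h2⟩ := append_comp_perm (X := X) (p := p) σ
  dsimp only
  rw [h2, hf, h1]

/-- The generalized Kronecker delta as a tensor in its first `k` pairs of indices. -/
def kroneckerAppend (k : ℕ) {p : ℕ} (v w : Fin p → Fin n) : Tensor2 (Fin n) k := fun A B =>
  kronecker (frameMetric n) (Fin.append A v) (Fin.append B w)

lemma isBiskew_kroneckerAppend (k : ℕ) {p : ℕ} (v w : Fin p → Fin n) :
    IsBiskew (kroneckerAppend k v w) :=
  ⟨fun B => IsSkew.append ((isBiskew_kronecker _).1 (Fin.append B w)) v,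
    fun A => IsSkew.append ((isBiskew_kronecker _).2 (Fin.append A v)) w⟩

lemma trace_kroneckerAppend (k : ℕ) {p : ℕ} (v w : Fin p → Fin n) :
    trace (kroneckerAppend (k + 1) v w) = ((n : ℝ) - k - p) • kroneckerAppend k v w := by
  funext A B
  have := congrFun (congrFun (trace_kronecker (n := n) (k + p)) (Fin.append A v)) (Fin.append B w)
  simp only [trace_apply, Pi.smul_apply, smul_eq_mul] at this
  simp only [trace_apply, kroneckerAppend, Pi.smul_apply, smul_eq_mul, Fin.append_cons,
    kronecker_comp_cast, this]
  push_cast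
  ring

/-- The operator `deltaContract` in an orthonormal frame. -/
abbrev frameContract (p : ℕ) {k : ℕ} (T : Tensor2 (Fin n) k) : Tensor2 (Fin n) p :=
  deltaContract (frameMetric n) id p T

lemma frameContract_apply {p k : ℕ} (T : Tensor2 (Fin n) k) (v w : Fin p → Fin n) :
    frameContract p T v w = 1 / (k.factorial : ℝ) ^ 2 * pairing T (kroneckerAppend k v w) := by
  rw [pairing_comm]; rfl

/-- Adjointness moves g onto the delta as a contraction; the resulting (k+1)^2 is absorbed by the
factorials in the normalization. -/
lemma frameContract_metricMul {p k : ℕ} (T : Tensor2 (Fin n) k) :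
    frameContract p (metricMul (frameMetric n) T) = ((n : ℝ) - k - p) • frameContract p T := by
  funext v w
  rw [Pi.smul_apply, Pi.smul_apply, smul_eq_mul, frameContract_apply, frameContract_apply,
    pairing_metricMul _ (isBiskew_kroneckerAppend _ v w), trace_kroneckerAppend,
    pairing_smul_right, Nat.factorial_succ]
  have : (k.factorial : ℝ) ≠ 0 := by exact_mod_cast k.factorial_ne_zero
  push_cast
  field_simp

lemma frameContract_metricPow {p i m : ℕ} (h : i ≤ m) (T : Tensor2 (Fin n) i) :
    frameContract p (metricPow (frameMetric n) m T) =
      (∏ s ∈ Finset.Ico i m, ((n : ℝ) - s - p)) • frameContract p T := by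
  induction m, h using Nat.le_induction with
  | base => simp
  | succ m h ih =>
    rw [metricPow_succ _ h, frameContract_metricMul, ih, smul_smul, Finset.prod_Ico_succ_top h,
      mul_comm]

/-- Without free indices the delta is a multiple of g times a smaller delta, hence orthogonal to
every trace-free tensor. -/
lemma frameContract_zero_left {k : ℕ} {T : Tensor2 (Fin n) (k + 1)} (hT : IsBiskew T)
    (ht : trace T = 0) : frameContract 0 T = 0 := by
  funext v w
  rw [frameContract_apply]
  have h1 : kroneckerAppend (k + 1) v w =
      fun u w : Fin (k + 1) → Fin n => kronecker (frameMetric n) u w := by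
    funext A B
    simp only [kroneckerAppend]
    rw [Subsingleton.elim v Fin.elim0, Subsingleton.elim w Fin.elim0, Fin.append_elim0,
      Fin.append_elim0, kronecker_comp_cast]
  have h2 := pairing_metricMul (fun u w : Fin k → Fin n => kronecker (frameMetric n) u w) hT
  rw [metricMul_kronecker, ht, pairing_comm, pairing_smul_right] at h2
  have h3 : pairing (fun u w : Fin k → Fin n => kronecker (frameMetric n) u w) 0 = 0 := by
    simp [pairing]
  rw [h3, mul_zero] at h2
  rw [h1, (mul_eq_zero.1 h2).resolve_left (by positivity)]
  simp

/-- Sums over indices of a trace free tensor in which one index of each group is contracted. -/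
lemma sum_frameMetric_mul_eq_zero {k : ℕ} {T : Tensor2 (Fin n) (k + 1)} (hT : IsBiskew T)
    (ht : trace T = 0) (a b : Fin (k + 1)) (c : Tensor2 (Fin n) (k + 1))
    (hc : ∀ A B x y, c (Function.update A a x) (Function.update B b y) = c A B) :
    ∑ A, ∑ B, frameMetric n (A a) (B b) * c A B * T A B = 0 := by
  have hs : ∀ (a : Fin (k + 1)) (F : (Fin (k + 1) → Fin n) → ℝ),
      ∑ A, F A = ∑ A', ∑ x, F (Fin.insertNth a x A') := by
    intro a F
    rw [Finset.sum_comm, ← Fintype.sum_prod_type']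
    exact (Fintype.sum_equiv (Fin.insertNthEquiv (fun _ => Fin n) a) _ _ fun v => rfl).symm
  have hT' : ∀ (x y : Fin n) (A' B' : Fin k → Fin n),
      T (Fin.insertNth a x A') (Fin.insertNth b y B') =
        (-1) ^ ((a : ℕ) + b) * T (Fin.cons x A') (Fin.cons y B') := by
    intro x y A' B'
    have h1 := (hT.1 (Fin.insertNth b y B')).cons_succAbove (Fin.insertNth a x A') a
    have h2 := (hT.2 (Fin.cons x A')).cons_succAbove (Fin.insertNth b y B') b
    simp only [Fin.insertNth_apply_same, Fin.insertNth_apply_succAbove] at h1 h2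
    rw [h2, h1, pow_add]
    have e : ∀ m : ℕ, ((-1 : ℝ) ^ m) * (-1) ^ m = 1 := fun m => by rw [← mul_pow]; simp
    linear_combination (-(T (Fin.insertNth a x A') (Fin.insertNth b y B'))) *
      (e a * ((-1 : ℝ) ^ (b : ℕ) * (-1 : ℝ) ^ (b : ℕ)) + e b)
  rw [hs a]
  refine Finset.sum_eq_zero fun A' _ => ?_
  rw [Finset.sum_congr rfl fun x _ => hs b _, Finset.sum_comm]
  refine Finset.sum_eq_zero fun B' _ => ?_
  have hx : ∀ x, ∑ y, frameMetric n ((Fin.insertNth a x A' : Fin (k + 1) → Fin n) a)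
      ((Fin.insertNth b y B' : Fin (k + 1) → Fin n) b) *
      c (Fin.insertNth a x A') (Fin.insertNth b y B') *
      T (Fin.insertNth a x A') (Fin.insertNth b y B') =
      c (Fin.insertNth a x A') (Fin.insertNth b x B') *
        ((-1) ^ ((a : ℕ) + b) * T (Fin.cons x A') (Fin.cons x B')) := by
    intro x
    simp only [Fin.insertNth_apply_same, hT', mul_assoc]
    rw [sum_frameMetric_mul']
  rw [Finset.sum_congr rfl fun x _ => hx x]
  rcases isEmpty_or_nonempty (Fin n) with h | ⟨⟨x₀⟩⟩
  · simp
  -- The coefficient does not depend on the summed index, so it is evaluated at a fixed x₀ and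
  -- leaves a contraction of T.
  have h0 : ∀ x, c (Fin.insertNth a x A') (Fin.insertNth b x B') =
      c (Fin.insertNth a x₀ A') (Fin.insertNth b x₀ B') := by
    intro x
    have := hc (Fin.insertNth a x A') (Fin.insertNth b x B') x₀ x₀
    rw [Fin.update_insertNth, Fin.update_insertNth] at this
    exact this.symm
  simp only [h0, ← Finset.mul_sum]
  rw [← trace_apply, ht]
  simp

end Frame

/-! ### The contraction operator on trace-free tensors. -/

section Frame

variable {n : ℕ}

lemma append_update_left_of_ne {X : Type} {k p : ℕ} (A : Fin k → X) (v : Fin p → X) (a : Fin k)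
    (x : X) {r : Fin (k + p)} (hr : r ≠ Fin.castAdd p a) :
    Fin.append (Function.update A a x) v r = Fin.append A v r := by
  induction r using Fin.addCases with
  | left i =>
    rw [Fin.append_left, Fin.append_left, Function.update_of_ne]
    rintro rfl; exact hr rfl
  | right i => rw [Fin.append_right, Fin.append_right]

lemma append_natAdd_succAbove {X : Type} {k p : ℕ} (A : Fin k → X) (v : Fin (p + 1) → X)
    (r : Fin (p + 1)) :
    (fun s : Fin (k + p) => Fin.append A v ((Fin.natAdd k r).succAbove s)) =
      Fin.append A fun s => v (r.succAbove s) := by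
  funext s
  induction s using Fin.addCases with
  | left i =>
    rw [Fin.append_left, Fin.succAbove_of_castSucc_lt]
    · exact Fin.append_left A v i
    · simp [Fin.lt_def]; omega
  | right i =>
    rw [Fin.append_right]
    rcases lt_or_ge i.castSucc r with h | h
    · rw [Fin.succAbove_of_castSucc_lt _ _ h, Fin.succAbove_of_castSucc_lt]
      · exact Fin.append_right A v i.castSucc
      · simpa [Fin.lt_def] using h
    · rw [Fin.succAbove_of_le_castSucc _ _ h, Fin.succAbove_of_le_castSucc]
      · exact Fin.append_right A v i.succ
      · simpa [Fin.le_def] using h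

/-- Row expansions of a determinant along the last block of rows, compared with column expansions
along the first block of columns. -/
lemma sub_mul_det {k p : ℕ} (M : Matrix (Fin (k + p)) (Fin (k + p)) ℝ) :
    ((p : ℝ) - k) * M.det =
      ∑ r, ∑ j, M (Fin.natAdd k r) (Fin.natAdd k j) *
        M.adjugate (Fin.natAdd k j) (Fin.natAdd k r) -
      ∑ b, ∑ a, M (Fin.castAdd p a) (Fin.castAdd p b) *
        M.adjugate (Fin.castAdd p b) (Fin.castAdd p a) := by
  have h1 : (p : ℝ) * M.det = ∑ r : Fin p, ∑ s, M (Fin.natAdd k r) s *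
      M.adjugate s (Fin.natAdd k r) := by
    simp only [← Matrix.det_eq_sum_mul_adjugate_row]
    simp
  have h2 : (k : ℝ) * M.det = ∑ b : Fin k, ∑ r, M r (Fin.castAdd p b) *
      M.adjugate (Fin.castAdd p b) r := by
    simp only [← Matrix.det_eq_sum_mul_adjugate_col]
    simp
  simp only [Fin.sum_univ_add, Finset.sum_add_distrib] at h1 h2
  rw [sub_mul, h1, h2, Finset.sum_comm (f := fun b r => M (Fin.natAdd k r) (Fin.castAdd p b) *
    M.adjugate (Fin.castAdd p b) (Fin.natAdd k r))]
  ring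

/-- Expand the delta along its p + 1 free rows and subtract the expansions along its k summed
columns. The mixed entries (v, B) cancel. The (v, w) entries assemble to the product with g, and the
(A, B) entries contract T. -/
lemma frameContract_succ {k p : ℕ} {T : Tensor2 (Fin n) k} (hT : IsBiskew T)
    (ht : IsTraceFree T) :
    ((p : ℝ) + 1 - k) • frameContract (p + 1) T =
      metricMul (frameMetric n) (frameContract p T) := by
  funext v w
  set M : (Fin k → Fin n) → (Fin k → Fin n) → Matrix (Fin (k + (p + 1))) (Fin (k + (p + 1))) ℝ :=
    fun A B => Matrix.of fun r s =>
      frameMetric n (Fin.append A v r) (Fin.append B w s) with hM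
  have hdet : ∀ A B, ((p : ℝ) + 1 - k) * kroneckerAppend k v w A B =
      ∑ r : Fin (p + 1), ∑ j : Fin (p + 1), (-1 : ℝ) ^ ((r : ℕ) + j) * frameMetric n (v r) (w j) *
        kroneckerAppend k (fun s => v (r.succAbove s)) (fun s => w (j.succAbove s)) A B -
      ∑ b, ∑ a, frameMetric n (A a) (B b) *
        (M A B).adjugate (Fin.castAdd (p + 1) b) (Fin.castAdd (p + 1) a) := by
    intro A B
    have := sub_mul_det (M A B)
    rw [Nat.cast_succ] at this
    rw [show kroneckerAppend k v w A B = (M A B).det from rfl, this]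
    congr 1
    · refine Finset.sum_congr rfl fun r _ => Finset.sum_congr rfl fun j _ => ?_
      have h1 := Matrix.adjugate_fin_succ_eq_det_submatrix (n := k + p) (M A B)
        (Fin.natAdd k j) (Fin.natAdd k r)
      rw [h1]
      have h2 : ((M A B).submatrix (Fin.natAdd k r).succAbove (Fin.natAdd k j).succAbove).det =
          kroneckerAppend k (fun s => v (r.succAbove s)) (fun s => w (j.succAbove s)) A B := by
        rw [kroneckerAppend, ← append_natAdd_succAbove, ← append_natAdd_succAbove]
        rfl
      rw [h2]
      simp only [hM, Matrix.of_apply, Fin.append_right, Fin.val_natAdd]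
      rw [show k + (r : ℕ) + (k + j) = 2 * k + (r + j) by ring, pow_add, pow_mul]
      norm_num
      ring
    · refine Finset.sum_congr rfl fun b _ => Finset.sum_congr rfl fun a _ => ?_
      simp only [hM, Matrix.of_apply, Fin.append_left]
  -- The cofactor omits row a and column b, so it depends neither on A a nor on B b.
  have hzero : ∀ a b, ∑ A, ∑ B, frameMetric n (A a) (B b) *
      (M A B).adjugate (Fin.castAdd (p + 1) b) (Fin.castAdd (p + 1) a) * T A B = 0 := by
    intro a b
    cases k with
    | zero => exact a.elim0
    | succ k =>
      refine sum_frameMetric_mul_eq_zero hT ht a b _ fun A B x y => ?_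
      have h1 := fun A B => Matrix.adjugate_fin_succ_eq_det_submatrix (n := k + 1 + p) (M A B)
        (Fin.castAdd (p + 1) b) (Fin.castAdd (p + 1) a)
      rw [h1, h1]
      congr 2
      ext r s
      simp only [hM, Matrix.submatrix_apply, Matrix.of_apply]
      rw [append_update_left_of_ne (p := p + 1) A v a x
          (Fin.succAbove_ne (Fin.castAdd (p + 1) a : Fin (k + 1 + p + 1)) r),
        append_update_left_of_ne (p := p + 1) B w b y
          (Fin.succAbove_ne (Fin.castAdd (p + 1) b : Fin (k + 1 + p + 1)) s)]
  simp only [Pi.smul_apply, smul_eq_mul, frameContract_apply, metricMul]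
  have h3 : ((p : ℝ) + 1 - k) * pairing T (kroneckerAppend k v w) =
      ∑ r : Fin (p + 1), ∑ j : Fin (p + 1), (-1 : ℝ) ^ ((r : ℕ) + j) * frameMetric n (v r) (w j) *
        pairing T (kroneckerAppend k (fun s => v (r.succAbove s)) (fun s => w (j.succAbove s))) := by
    have h4 : ((p : ℝ) + 1 - k) * pairing T (kroneckerAppend k v w) =
      ∑ A, ∑ B, (∑ r : Fin (p + 1), ∑ j : Fin (p + 1), (-1 : ℝ) ^ ((r : ℕ) + j) * frameMetric n (v r) (w j) *
        (T A B * kroneckerAppend k (fun s => v (r.succAbove s)) (fun s => w (j.succAbove s)) A B)) -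
      ∑ A, ∑ B, ∑ b, ∑ a, frameMetric n (A a) (B b) *
        (M A B).adjugate (Fin.castAdd (p + 1) b) (Fin.castAdd (p + 1) a) * T A B := by
      simp only [pairing, Finset.mul_sum, ← Finset.sum_sub_distrib]
      refine Finset.sum_congr rfl fun A _ => Finset.sum_congr rfl fun B _ => ?_
      rw [mul_left_comm, hdet, mul_sub]
      simp only [Finset.mul_sum]
      congr 1 <;> refine Finset.sum_congr rfl fun r _ => Finset.sum_congr rfl fun j _ => ?_ <;> ring
    have h5 : ∑ A, ∑ B, ∑ b, ∑ a, frameMetric n (A a) (B b) *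
        (M A B).adjugate (Fin.castAdd (p + 1) b) (Fin.castAdd (p + 1) a) * T A B = 0 := by
      rw [Finset.sum_congr rfl fun A _ => Finset.sum_comm, Finset.sum_comm]
      refine Finset.sum_eq_zero fun b _ => ?_
      rw [Finset.sum_congr rfl fun A _ => Finset.sum_comm, Finset.sum_comm]
      exact Finset.sum_eq_zero fun a _ => hzero a b
    rw [h4, h5, sub_zero]
    simp only [pairing, Finset.mul_sum]
    rw [Finset.sum_congr rfl fun A _ => Finset.sum_comm, Finset.sum_comm]
    refine Finset.sum_congr rfl fun r _ => ?_
    rw [Finset.sum_congr rfl fun A _ => Finset.sum_comm, Finset.sum_comm]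
  rw [mul_left_comm, h3, Finset.mul_sum]
  refine Finset.sum_congr rfl fun r _ => ?_
  rw [Finset.mul_sum]
  exact Finset.sum_congr rfl fun j _ => by ring

/-- The vanishing propagates upwards from p = 0 as long as the factor p + 1 - k of the recursion is
non-zero, that is, up to degree k - 1. -/
lemma frameContract_of_lt {k p : ℕ} {T : Tensor2 (Fin n) k} (hT : IsBiskew T)
    (ht : IsTraceFree T) (h : p < k) : frameContract p T = 0 := by
  induction p with
  | zero =>
    cases k with
    | zero => omega
    | succ k => exact frameContract_zero_left hT ht
  | succ p ih =>
    have h1 := frameContract_succ (p := p) hT ht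
    rw [ih (by omega), metricMul_zero] at h1
    refine (smul_eq_zero.1 h1).resolve_left ?_
    have : (p : ℝ) + 1 < k := by exact_mod_cast h
    linarith

lemma prod_frameMetric {k : ℕ} (u v : Fin k → Fin n) :
    ∏ s, frameMetric n (u s) (v s) = if u = v then 1 else 0 := by
  simp only [frameMetric, Finset.prod_ite_zero, Finset.prod_const_one, funext_iff,
    Finset.mem_univ, true_implies]

lemma sum_prod_frameMetric_mul {k : ℕ} (u : Fin k → Fin n) (F : (Fin k → Fin n) → ℝ) :
    ∑ v, (∏ s, frameMetric n (u s) (v s)) * F v = F u := by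
  simp [prod_frameMetric]

/-- The sign of the permutation that exchanges two groups of `k` elements. -/
def swapSign (k : ℕ) : ℝ := ((Equiv.Perm.sign (Equiv.sumComm (Fin k) (Fin k)) : ℤ) : ℝ)

lemma swapSign_ne_zero (k : ℕ) : swapSign k ≠ 0 := by
  simp [swapSign]

lemma kroneckerAppend_eq_sum_perm {k p : ℕ} (v w : Fin p → Fin n) (A B : Fin k → Fin n) :
    kroneckerAppend k v w A B = ∑ π : Equiv.Perm (Fin k ⊕ Fin p),
      ((Equiv.Perm.sign π : ℤ) : ℝ) *
        ∏ i, frameMetric n (Sum.elim A v (π i)) (Sum.elim B w i) := by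
  have : kroneckerAppend k v w A B = (Matrix.of fun r s : Fin k ⊕ Fin p =>
      frameMetric n (Sum.elim A v r) (Sum.elim B w s)).det := by
    rw [← Matrix.det_submatrix_equiv_self finSumFinEquiv.symm]
    unfold kroneckerAppend kronecker
    congr 1
    ext r s
    simp only [Matrix.of_apply, Matrix.submatrix_apply]
    have e : ∀ (A : Fin k → Fin n) (v : Fin p → Fin n) r,
        Fin.append A v r = Sum.elim A v (finSumFinEquiv.symm r) := by
      intro A v r
      induction r using Fin.addCases <;> simp
    rw [e, e]
  rw [this, Matrix.det_apply']
  rfl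

/-- The factor at b pairs A a with B b, and no other factor involves either index, so the sum
contains a contraction of T. -/
lemma sum_prod_perm_eq_zero {k p : ℕ} {T : Tensor2 (Fin n) k} (hT : IsBiskew T)
    (ht : IsTraceFree T) (v w : Fin p → Fin n) (π : Equiv.Perm (Fin k ⊕ Fin p)) {a b : Fin k}
    (hab : π (Sum.inl b) = Sum.inl a) :
    ∑ A, ∑ B, (∏ i, frameMetric n (Sum.elim A v (π i)) (Sum.elim B w i)) * T A B = 0 := by
  cases k with
  | zero => exact a.elim0
  | succ k =>
    rw [← sum_frameMetric_mul_eq_zero hT ht a b (fun A B =>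
      ∏ i ∈ Finset.univ.erase (Sum.inl b), frameMetric n (Sum.elim A v (π i)) (Sum.elim B w i)) ?_]
    · refine Finset.sum_congr rfl fun A _ => Finset.sum_congr rfl fun B _ => ?_
      rw [← Finset.mul_prod_erase Finset.univ _ (Finset.mem_univ (Sum.inl b)), hab]
      rfl
    · intro A B x y
      refine Finset.prod_congr rfl fun i hi => ?_
      have hi := Finset.ne_of_mem_erase hi
      have hi' : π i ≠ Sum.inl a := fun h => hi (π.injective (h.trans hab.symm))
      have e : ∀ (A : Fin (k + 1) → Fin n) (v : Fin p → Fin n) a x (i : Fin (k + 1) ⊕ Fin p),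
          i ≠ Sum.inl a → Sum.elim (Function.update A a x) v i = Sum.elim A v i := by
        intro A v a x i hi
        cases i with
        | inl i => 
          simp only [Sum.elim_inl]
          rw [Function.update_of_ne]
          rintro rfl; exact hi rfl
        | inr i => rfl
      rw [e _ _ _ _ _ hi, e _ _ _ _ _ hi']

/-- In the permutation expansion of the delta only permutations exchanging the summed and the free
block avoid a contraction of T. There are (k!)^2 of them; skewness of T cancels their individual
signs, so they contribute equally, and the normalization removes the count. -/
lemma frameContract_self {k : ℕ} {T : Tensor2 (Fin n) k} (hT : IsBiskew T)
    (ht : IsTraceFree T) : frameContract k T = swapSign k • transpose T := by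
  funext v w
  set f : Equiv.Perm (Fin k ⊕ Fin k) → ℝ := fun π => ((Equiv.Perm.sign π : ℤ) : ℝ) *
    ∑ A, ∑ B, (∏ i, frameMetric n (Sum.elim A v (π i)) (Sum.elim B w i)) * T A B with hf
  have h1 : pairing T (kroneckerAppend k v w) = ∑ π, f π := by
    simp only [pairing, kroneckerAppend_eq_sum_perm, hf, Finset.mul_sum]
    rw [Finset.sum_congr rfl fun A _ => Finset.sum_comm, Finset.sum_comm]
    refine Finset.sum_congr rfl fun π _ => Finset.sum_congr rfl fun A _ =>
      Finset.sum_congr rfl fun B _ => by ring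
  have h2 : ∑ π, f π = ∑ q : Equiv.Perm (Fin k) × Equiv.Perm (Fin k),
      f (Equiv.sumComm (Fin k) (Fin k) * Equiv.Perm.sumCongrHom (Fin k) (Fin k) q) := by
    rw [← Equiv.sum_comp (Equiv.mulLeft (Equiv.sumComm (Fin k) (Fin k) : Equiv.Perm _))]
    symm
    refine Finset.sum_of_injOn (Equiv.Perm.sumCongrHom (Fin k) (Fin k))
      Equiv.Perm.sumCongrHom_injective.injOn (fun _ _ => Finset.mem_coe.2 (Finset.mem_univ _))
      (fun π _ hπ => ?_) (fun _ _ => rfl)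
    -- A permutation outside the image of `Equiv.Perm.sumCongrHom` sends some index of the first
    -- block to the second, and the exchange of blocks sends it back to the first, which yields a
    -- contraction.
    have h3 : ¬ Set.MapsTo π (Set.range Sum.inl) (Set.range Sum.inl) := by
      intro h3
      obtain ⟨q, hq⟩ := Equiv.Perm.mem_sumCongrHom_range_of_perm_mapsTo_inl h3
      exact hπ ⟨q, by simp, hq⟩
    simp only [Set.MapsTo, Set.mem_range, forall_exists_index, forall_apply_eq_imp_iff,
      not_forall, not_exists] at h3
    obtain ⟨b, hb⟩ := h3
    obtain ⟨a, ha⟩ : ∃ a, π (Sum.inl b) = Sum.inr a := by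
      rcases hπb : π (Sum.inl b) with a | a
      · exact absurd hπb.symm (hb a)
      · exact ⟨a, rfl⟩
    simp only [hf, Equiv.coe_mulLeft]
    rw [sum_prod_perm_eq_zero hT ht v w _ (a := a) (b := b) (by simp [ha]), mul_zero]
  have h4 : ∀ σ τ : Equiv.Perm (Fin k),
      f (Equiv.sumComm (Fin k) (Fin k) * Equiv.Perm.sumCongrHom (Fin k) (Fin k) (σ, τ)) =
      swapSign k * T w v := by
    intro σ τ
    simp only [hf, Fintype.prod_sum_type]
    have h5 : ∀ A B : Fin k → Fin n, (∏ i, frameMetric n (Sum.elim A v ((Equiv.sumComm (Fin k) (Fin k) *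
        Equiv.Perm.sumCongrHom (Fin k) (Fin k) (σ, τ)) (Sum.inl i))) (Sum.elim B w (Sum.inl i))) *
        (∏ i, frameMetric n (Sum.elim A v ((Equiv.sumComm (Fin k) (Fin k) *
        Equiv.Perm.sumCongrHom (Fin k) (Fin k) (σ, τ)) (Sum.inr i))) (Sum.elim B w (Sum.inr i))) =
        (∏ s, frameMetric n (w (τ⁻¹ s)) (A s)) * ∏ s, frameMetric n (v (σ s)) (B s) := by
      intro A B
      rw [mul_comm]
      congr 1
      rw [← Equiv.prod_comp τ fun s => frameMetric n (w (τ⁻¹ s)) (A s)]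
      refine Finset.prod_congr rfl fun i _ => ?_
      rw [frameMetric_symm]
      simp
    simp only [h5, mul_assoc, ← Finset.mul_sum]
    simp only [sum_prod_frameMetric_mul]
    have h7 : T (fun s => w (τ⁻¹ s)) v = _ := hT.1 v τ⁻¹ w
    rw [hT.2 (fun s => w (τ⁻¹ s)) σ v, h7]
    have hσ : ((Equiv.Perm.sign σ : ℤ) : ℝ) * ((Equiv.Perm.sign σ : ℤ) : ℝ) = 1 := by
      rw [← Int.cast_mul, ← Units.val_mul, Int.units_mul_self]; simp
    have hτ : ((Equiv.Perm.sign τ : ℤ) : ℝ) * ((Equiv.Perm.sign τ : ℤ) : ℝ) = 1 := by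
      rw [← Int.cast_mul, ← Units.val_mul, Int.units_mul_self]; simp
    have e : Equiv.Perm.sign (Equiv.Perm.sumCongrHom (Fin k) (Fin k) (σ, τ)) =
        Equiv.Perm.sign σ * Equiv.Perm.sign τ := by
      simp [Equiv.Perm.sumCongrHom]
    rw [Equiv.Perm.sign_mul, e, Equiv.Perm.sign_inv, swapSign]
    push_cast
    linear_combination (((Equiv.Perm.sign (Equiv.sumComm (Fin k) (Fin k)) : ℤ) : ℝ) * T w v *
      ((Equiv.Perm.sign τ : ℤ) : ℝ) * ((Equiv.Perm.sign τ : ℤ) : ℝ)) * hσ +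
      (((Equiv.Perm.sign (Equiv.sumComm (Fin k) (Fin k)) : ℤ) : ℝ) * T w v) * hτ
  have h6 : (k.factorial : ℝ) ≠ 0 := by exact_mod_cast k.factorial_ne_zero
  rw [frameContract_apply, h1, h2, Fintype.sum_prod_type]
  simp only [h4, Finset.sum_const, Finset.card_univ, Fintype.card_perm, Fintype.card_fin,
    nsmul_eq_mul, Pi.smul_apply, smul_eq_mul, transpose]
  field_simp

/-- The coefficient in `frameContract_of_isTraceFree`. -/
def contractCoeff (i p : ℕ) : ℝ := if p < i then 0 else swapSign i / (p - i).factorial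

lemma contractCoeff_ne_zero {i p : ℕ} (h : i ≤ p) : contractCoeff i p ≠ 0 := by
  rw [contractCoeff, if_neg (by omega)]
  exact div_ne_zero (swapSign_ne_zero i) (by exact_mod_cast (p - i).factorial_ne_zero)

/-- From the value at p = i, where symmetry absorbs the transpose, each step of the recursion
divides by p + 1 - i; this builds the factorial. -/
lemma frameContract_of_isTraceFree {i p : ℕ} {T : Tensor2 (Fin n) i} (hT : IsBiskew T)
    (ht : IsTraceFree T) (hs : transpose T = T) :
    frameContract p T = contractCoeff i p • metricPow (frameMetric n) p T := by
  rcases lt_or_ge p i with h | h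
  · rw [frameContract_of_lt hT ht h, contractCoeff, if_pos h, zero_smul]
  induction p, h using Nat.le_induction with
  | base => rw [frameContract_self hT ht, hs, metricPow_self]; simp [contractCoeff]
  | succ p h ih =>
    have h1 := frameContract_succ (p := p) hT ht
    have h2 : (i : ℝ) ≤ p := by exact_mod_cast h
    have h3 : (p : ℝ) + 1 - i ≠ 0 := by linarith
    rw [ih, metricMul_smul, ← metricPow_succ _ h] at h1
    have h4 := congrArg (fun z => ((p : ℝ) + 1 - i)⁻¹ • z) h1
    simp only [smul_smul, inv_mul_cancel₀ h3, one_smul] at h4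
    rw [h4]
    congr 1
    rw [contractCoeff, contractCoeff, if_neg (by omega), if_neg (by omega),
      show p + 1 - i = (p - i) + 1 by omega, Nat.factorial_succ]
    push_cast [Nat.cast_sub h]
    have h5 : ((p - i).factorial : ℝ) ≠ 0 := by exact_mod_cast (p - i).factorial_ne_zero
    have h6 : (p : ℝ) - i + 1 ≠ 0 := by linarith
    field_simp
    ring

end Frame

/-! ### Antisymmetrization along disjoint permutations. -/

section Antisymmetrization

variable {X : Type}

/-- The composition of the operators `F ↦ F - F ∘ π s` for `s < j`. -/
def antisym (π : ℕ → Equiv.Perm X) {k : ℕ} : ℕ → ((Fin k → X) → ℝ) → (Fin k → X) → ℝ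
  | 0, F => F
  | j + 1, F => fun v => antisym π j F v - antisym π j F fun t => π j (v t)

variable {π : ℕ → Equiv.Perm X} {k : ℕ}

/-- The difference taken along π s vanishes at a tuple fixed by π s. The other permutations commute
with π s, so they preserve the set of such tuples. -/
lemma antisym_eq_zero_of_fixed {j : ℕ} (F : (Fin k → X) → ℝ)
    (hπ : ∀ r < j, ∀ s < j, r ≠ s → (π r).Disjoint (π s)) {s : ℕ} (hs : s < j) {v : Fin k → X}
    (hv : ∀ t, π s (v t) = v t) : antisym π j F v = 0 := by
  induction j generalizing v with
  | zero => omega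
  | succ j ih =>
    rcases (Nat.lt_succ_iff.1 hs).eq_or_lt with rfl | h
    · simp only [antisym, hv, sub_self]
    · have hπ' : ∀ r < j, ∀ s < j, r ≠ s → (π r).Disjoint (π s) :=
        fun r hr s hs => hπ r (by omega) s (by omega)
      simp only [antisym]
      rw [ih hπ' h hv, ih hπ' h, sub_self]
      intro t
      have hc := (hπ s (by omega) j (by omega) (by omega)).commute
      have := congrArg (fun e : Equiv.Perm X => e (v t)) hc.eq
      simp only [Equiv.Perm.mul_apply, hv] at this
      exact this

/-- Pigeonhole: if each of the j permutations moved an entry, disjointness would make these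
positions distinct. -/
lemma exists_fixed {j : ℕ} (hπ : ∀ r < j, ∀ s < j, r ≠ s → (π r).Disjoint (π s)) (hk : k < j)
    (v : Fin k → X) : ∃ s < j, ∀ t, π s (v t) = v t := by
  by_contra! h
  choose t ht using fun s : Fin j => h s s.2
  have hinj : Function.Injective t := by
    intro r s hrs
    by_contra hne
    have := hπ r r.2 s s.2 (fun h => hne (Fin.ext h)) (v (t r))
    rcases this with h | h
    · exact ht r h
    · rw [hrs] at h; exact ht s h
  have := Fintype.card_le_of_injective t hinj
  simp at this
  omega

lemma antisym_sum {ι : Type*} (s : Finset ι) (j : ℕ) (F : ι → (Fin k → X) → ℝ) (v : Fin k → X) :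
    antisym π j (fun v => ∑ i ∈ s, F i v) v = ∑ i ∈ s, antisym π j (F i) v := by
  induction j generalizing v with
  | zero => rfl
  | succ j ih => simp only [antisym, ih, Finset.sum_sub_distrib]

lemma antisym_sum_succAbove (j : ℕ) (F : (Fin k → X) → ℝ) (v : Fin (k + 1) → X) :
    antisym π j (fun v : Fin (k + 1) → X => ∑ a : Fin (k + 1), F fun s => v (a.succAbove s)) v =
      ∑ a : Fin (k + 1), antisym π j F fun s => v (a.succAbove s) := by
  induction j generalizing v with
  | zero => rfl
  | succ j ih => simp only [antisym, ih, Finset.sum_sub_distrib]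

lemma antisym_congr (j : ℕ) {F F' : (Fin k → X) → ℝ}
    (h : ∀ v, Function.Injective v → F v = F' v) {v : Fin k → X} (hv : Function.Injective v) :
    antisym π j F v = antisym π j F' v := by
  induction j generalizing v with
  | zero => exact h v hv
  | succ j ih =>
    simp only [antisym]
    rw [ih hv, ih (v := fun t => π j (v t)) ((π j).injective.comp hv)]

lemma antisym_eq_zero_of_mem {j : ℕ} {F : (Fin k → X) → ℝ} {x : X}
    (hx : ∀ s < j, π s x = x) (hF : ∀ v t, v t = x → F v = 0) {v : Fin k → X} {t : Fin k}
    (hv : v t = x) : antisym π j F v = 0 := by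
  induction j generalizing v with
  | zero => exact hF v t hv
  | succ j ih =>
    simp only [antisym]
    rw [ih (fun s hs => hx s (by omega)) hv, ih (fun s hs => hx s (by omega)), sub_self]
    rw [hv, hx j (by omega)]

end Antisymmetrization

/-! ### A criterion for a non-zero top component. -/

section Frame

variable {n : ℕ}

/-- With distinct entries the metric factor forces the two deleted positions to agree, so all signs
are positive. -/
lemma metricMul_diag {k : ℕ} (T : Tensor2 (Fin n) k) {v : Fin (k + 1) → Fin n}
    (hv : Function.Injective v) : metricMul (frameMetric n) T v v =
      ∑ a : Fin (k + 1), T (fun s => v (a.succAbove s)) fun s => v (a.succAbove s) := by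
  refine Finset.sum_congr rfl fun a _ => ?_
  rw [Finset.sum_eq_single a]
  · rw [Even.neg_one_pow ⟨_, rfl⟩]; simp [frameMetric]
  · intro b _ hb
    have : v a ≠ v b := fun h => hb (hv h).symm
    simp [frameMetric, this]
  · simp

/-- On the diagonal, g^{m-i} T is a sum of terms that see only i entries of the tuple, and among
more than i disjoint permutations one fixes all of them. -/
lemma antisym_metricPow {π : ℕ → Equiv.Perm (Fin n)} {j : ℕ}
    (hπ : ∀ r < j, ∀ s < j, r ≠ s → (π r).Disjoint (π s)) {i m : ℕ} (hi : i < j)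
    (T : Tensor2 (Fin n) i) {v : Fin m → Fin n} (hv : Function.Injective v) :
    antisym π j (fun v => metricPow (frameMetric n) m T v v) v = 0 := by
  rcases lt_or_ge m i with h | h
  · obtain ⟨s, hs, hs'⟩ := exists_fixed hπ (h.trans hi) v
    exact antisym_eq_zero_of_fixed _ hπ hs hs'
  induction m, h using Nat.le_induction with
  | base =>
    obtain ⟨s, hs, hs'⟩ := exists_fixed hπ hi v
    exact antisym_eq_zero_of_fixed _ hπ hs hs'
  | succ m h ih =>
    rw [antisym_congr j (F' := fun v : Fin (m + 1) → Fin n => ∑ a : Fin (m + 1),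
      (fun v => metricPow (frameMetric n) m T v v) fun s => v (a.succAbove s)) ?_ hv]
    · refine (antisym_sum_succAbove j (fun v => metricPow (frameMetric n) m T v v) v).trans ?_
      exact Finset.sum_eq_zero fun a _ => ih (hv.comp Fin.succAbove_right_injective)
    · intro v hv
      rw [metricPow_succ _ h, metricMul_diag _ hv]

/-- If the component of degree min(k, n-k) were zero, antisymmetrization along that many disjoint
transpositions would kill the diagonal of T. At the tuple (0, ..., k-1) it returns the value of T
instead. -/
lemma IsFrameDecomposition.top_ne_zero {k : ℕ} (hk : k ≤ n) {T : Tensor2 (Fin n) k}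
    {θ : (i : ℕ) → Tensor2 (Fin n) i} (hθ : IsFrameDecomposition T θ)
    (h0 : ∀ v t, k ≤ (v t : ℕ) → T v v = 0) (h1 : T (Fin.castLE hk) (Fin.castLE hk) ≠ 0) :
    θ (min k (n - k)) ≠ 0 := by
  intro hm
  -- Each transposition exchanges an index below k with one that is not; exactly min(k, n-k)
  -- disjoint ones fit into n indices, and the default is the identity.
  set π : ℕ → Equiv.Perm (Fin n) := fun s => if h : s < k ∧ k + s < n then
    Equiv.swap ⟨s, by omega⟩ ⟨k + s, h.2⟩ else 1 with hπ
  have hπs : ∀ s (h : s < k ∧ k + s < n), π s = Equiv.swap ⟨s, by omega⟩ ⟨k + s, h.2⟩ :=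
    fun s h => dif_pos h
  have hfix : ∀ (s : ℕ) (x : Fin n), s ≠ (x : ℕ) → k + s ≠ (x : ℕ) → π s x = x := by
    intro s x h1 h2
    by_cases h : s < k ∧ k + s < n
    · rw [hπs s h, Equiv.swap_apply_of_ne_of_ne]
      · rintro rfl; exact h1 rfl
      · rintro rfl; exact h2 rfl
    · simp only [hπ, dif_neg h, Equiv.Perm.one_apply]
  have hd : ∀ r < min k (n - k), ∀ s < min k (n - k), r ≠ s → (π r).Disjoint (π s) := by
    intro r hr s hs hrs x
    by_cases h : r ≠ (x : ℕ) ∧ k + r ≠ (x : ℕ)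
    · exact Or.inl (hfix r x h.1 h.2)
    · exact Or.inr (hfix s x (by omega) (by omega))
  have hinj : Function.Injective (Fin.castLE hk) := Fin.castLE_injective hk
  have h2 : antisym π (min k (n - k)) (fun v => T v v) (Fin.castLE hk) = 0 := by
    have : (fun v => T v v) = fun v => ∑ i ∈ Finset.range (k + 1),
        metricPow (frameMetric n) k (θ i) v v := by
      funext v
      conv_lhs => rw [hθ.eq_sum]
      simp [Finset.sum_apply]
    rw [this, antisym_sum]
    refine Finset.sum_eq_zero fun i _ => ?_
    rcases lt_trichotomy i (min k (n - k)) with h | h | h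
    · exact antisym_metricPow hd h _ hinj
    · subst h
      rw [hm, metricPow_zero]
      have := antisym_sum (π := π) (∅ : Finset ℕ) (min k (n - k))
        (fun _ => (0 : (Fin k → Fin n) → ℝ)) (Fin.castLE hk)
      simpa using this
    · rw [hθ.eq_zero i h, metricPow_zero]
      have := antisym_sum (π := π) (∅ : Finset ℕ) (min k (n - k))
        (fun _ => (0 : (Fin k → Fin n) → ℝ)) (Fin.castLE hk)
      simpa using this
  -- Every transposed tuple has an entry k + j, which the remaining permutations do not move and at
  -- which T vanishes. Only the untransposed term survives.
  have h3 : ∀ j ≤ min k (n - k), antisym π j (fun v => T v v) (Fin.castLE hk) =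
      T (Fin.castLE hk) (Fin.castLE hk) := by
    intro j hj
    induction j with
    | zero => rfl
    | succ j ih =>
      simp only [antisym]
      rw [ih (by omega)]
      rw [antisym_eq_zero_of_mem (x := ⟨k + j, by omega⟩) (t := ⟨j, by omega⟩), sub_zero]
      · intro s hs
        exact hfix s _ (by simp; omega) (by simp; omega)
      · intro v t ht
        exact h0 v t (by rw [ht]; simp)
      · rw [hπs j (by omega)]
        exact Equiv.swap_apply_left _ _
  exact h1 ((h3 _ le_rfl).symm.trans h2)

end Frame

/-! ### The Gauss-Kronecker tensor and its value for the test metric. -/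

section GaussKronecker

variable {X : Type} {R : X → X → X → X → ℝ}

lemma gaussKronecker_symm (hR : ∀ a b c d, R a b c d = R c d a b) (q : ℕ) :
    transpose (gaussKronecker R q) = gaussKronecker R q := by
  funext v w
  simp only [transpose, gaussKronecker]
  rw [Finset.sum_comm]
  congr 1
  refine Finset.sum_congr rfl fun σ _ => Finset.sum_congr rfl fun τ _ => ?_
  rw [mul_comm ((Equiv.Perm.sign τ : ℤ) : ℝ)]
  congr 1
  exact Finset.prod_congr rfl fun l _ => hR _ _ _ _

lemma isSkew_sum_perm {k : ℕ} (F : (Fin k → X) → ℝ) : IsSkew fun v : Fin k → X =>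
    ∑ σ : Equiv.Perm (Fin k), ((Equiv.Perm.sign σ : ℤ) : ℝ) * F fun s => v (σ s) := by
  intro ρ v
  dsimp only
  rw [Finset.mul_sum, ← Equiv.sum_comp (Equiv.mulLeft ρ)
    (fun σ => ((Equiv.Perm.sign ρ : ℤ) : ℝ) * (((Equiv.Perm.sign σ : ℤ) : ℝ) * F fun s => v (σ s)))]
  refine Finset.sum_congr rfl fun σ _ => ?_
  have hρ : ((Equiv.Perm.sign ρ : ℤ) : ℝ) * ((Equiv.Perm.sign ρ : ℤ) : ℝ) = 1 := by
    rw [← Int.cast_mul, ← Units.val_mul, Int.units_mul_self]; simp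
  simp only [Equiv.coe_mulLeft, Equiv.Perm.sign_mul, Equiv.Perm.mul_apply]
  push_cast
  linear_combination (-(((Equiv.Perm.sign σ : ℤ) : ℝ) * F fun s => v (ρ (σ s)))) * hρ

lemma isBiskew_gaussKronecker (R : X → X → X → X → ℝ) (q : ℕ) :
    IsBiskew (gaussKronecker R q) := by
  constructor
  · intro w
    have := (isSkew_sum_perm fun v : Fin (2 * q) → X => ∑ τ : Equiv.Perm (Fin (2 * q)),
      ((Equiv.Perm.sign τ : ℤ) : ℝ) * ∏ l : Fin q, R (v ⟨2 * l, by omega⟩) (v ⟨2 * l + 1, by omega⟩)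
          (w (τ ⟨2 * l, by omega⟩)) (w (τ ⟨2 * l + 1, by omega⟩))).const_mul ((1 / 4) ^ q)
    simpa only [gaussKronecker, Finset.mul_sum, mul_assoc] using this
  · intro v
    have := (isSkew_sum_perm fun w : Fin (2 * q) → X => ∑ σ : Equiv.Perm (Fin (2 * q)),
      ((Equiv.Perm.sign σ : ℤ) : ℝ) * ∏ l : Fin q, R (v (σ ⟨2 * l, by omega⟩))
        (v (σ ⟨2 * l + 1, by omega⟩)) (w ⟨2 * l, by omega⟩)
          (w ⟨2 * l + 1, by omega⟩)).const_mul ((1 / 4) ^ q)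
    have e : gaussKronecker R q v = fun w => (1 / 4) ^ q * ∑ τ : Equiv.Perm (Fin (2 * q)),
        ((Equiv.Perm.sign τ : ℤ) : ℝ) * ∑ σ : Equiv.Perm (Fin (2 * q)),
      ((Equiv.Perm.sign σ : ℤ) : ℝ) * ∏ l : Fin q, R (v (σ ⟨2 * l, by omega⟩))
        (v (σ ⟨2 * l + 1, by omega⟩)) (w (τ ⟨2 * l, by omega⟩))
          (w (τ ⟨2 * l + 1, by omega⟩)) := by
      funext w
      simp only [gaussKronecker]
      rw [Finset.sum_comm]
      simp only [Finset.mul_sum]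
      exact Finset.sum_congr rfl fun τ _ => Finset.sum_congr rfl fun σ _ => by ring
    rw [e]
    exact this

/-- The value `±1` on the permutations of `Fin (2 * q)` that preserve the block `{2 l, 2 l + 1}`. -/
def blockSign {q : ℕ} (ρ : Equiv.Perm (Fin (2 * q))) (l : Fin q) : ℝ :=
  (if ρ ⟨2 * l, by omega⟩ = ⟨2 * l, by omega⟩ ∧ ρ ⟨2 * l + 1, by omega⟩ = ⟨2 * l + 1, by omega⟩
    then 1 else 0) -
  (if ρ ⟨2 * l, by omega⟩ = ⟨2 * l + 1, by omega⟩ ∧ ρ ⟨2 * l + 1, by omega⟩ = ⟨2 * l, by omega⟩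
    then 1 else 0)

/-- If no block sign vanishes, ρ preserves each pair {2l, 2l+1}. It is then a family of permutations
of two elements, and its sign is the product of theirs. -/
lemma sign_eq_prod_blockSign {q : ℕ} (ρ : Equiv.Perm (Fin (2 * q)))
    (h : ∀ l, blockSign ρ l ≠ 0) :
    ((Equiv.Perm.sign ρ : ℤ) : ℝ) = ∏ l, blockSign ρ l := by
  set e : Fin q × Fin 2 ≃ Fin (2 * q) := finProdFinEquiv.trans (finCongr (mul_comm q 2)) with he
  have he0 : ∀ l : Fin q, e (l, 0) = ⟨2 * l, by omega⟩ := by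
    intro l; ext; simp [he]
  have he1 : ∀ l : Fin q, e (l, 1) = ⟨2 * l + 1, by omega⟩ := by
    intro l; ext; simp [he]; ring
  have hcase : ∀ l, (ρ (e (l, 0)) = e (l, 0) ∧ ρ (e (l, 1)) = e (l, 1) ∧ blockSign ρ l = 1) ∨
      (ρ (e (l, 0)) = e (l, 1) ∧ ρ (e (l, 1)) = e (l, 0) ∧ blockSign ρ l = -1) := by
    intro l
    rw [he0, he1]
    have hl := h l
    unfold blockSign at hl ⊢
    by_cases h1 : ρ ⟨2 * l, by omega⟩ = ⟨2 * l, by omega⟩ ∧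
        ρ ⟨2 * l + 1, by omega⟩ = ⟨2 * l + 1, by omega⟩
    · left
      refine ⟨h1.1, h1.2, ?_⟩
      rw [if_pos h1, if_neg, sub_zero]
      rw [h1.1]; simp
    · by_cases h2 : ρ ⟨2 * l, by omega⟩ = ⟨2 * l + 1, by omega⟩ ∧
          ρ ⟨2 * l + 1, by omega⟩ = ⟨2 * l, by omega⟩
      · right
        refine ⟨h2.1, h2.2, ?_⟩
        rw [if_neg h1, if_pos h2, zero_sub]
      · rw [if_neg h1, if_neg h2] at hl
        simp at hl
  set f : Fin q → Equiv.Perm (Fin 2) := fun l =>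
    if ρ (e (l, 0)) = e (l, 0) then 1 else Equiv.swap 0 1 with hf
  have hf' : ∀ l, ((Equiv.Perm.sign (f l) : ℤ) : ℝ) = blockSign ρ l ∧
      ∀ i, ρ (e (l, i)) = e (l, f l i) := by
    intro l
    rcases hcase l with ⟨h1, h2, h3⟩ | ⟨h1, h2, h3⟩
    · have : f l = 1 := if_pos h1
      rw [this, h3]
      refine ⟨by simp, fun i => ?_⟩
      fin_cases i
      · exact h1
      · exact h2
    · have : f l = Equiv.swap 0 1 := if_neg (by rw [h1]; simp)
      rw [this, h3]
      refine ⟨by simp, fun i => ?_⟩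
      fin_cases i
      · simpa using h1
      · simpa using h2
  have hρ : ρ = e.permCongr (Equiv.prodCongrRight f) := by
    ext x
    obtain ⟨⟨l, i⟩, rfl⟩ := e.surjective x
    rw [(hf' l).2]
    simp [Equiv.permCongr_apply]
  conv_lhs => rw [hρ, Equiv.Perm.sign_permCongr, Equiv.Perm.sign_prodCongrRight]
  rw [Units.coe_prod]
  push_cast
  exact Finset.prod_congr rfl fun l _ => (hf' l).1

lemma sign_mul_prod_blockSign_nonneg {q : ℕ} (ρ : Equiv.Perm (Fin (2 * q))) :
    0 ≤ ((Equiv.Perm.sign ρ : ℤ) : ℝ) * ∏ l, blockSign ρ l := by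
  by_cases h : ∀ l, blockSign ρ l ≠ 0
  · rw [sign_eq_prod_blockSign ρ h]
    exact mul_self_nonneg _
  · push Not at h
    obtain ⟨l, hl⟩ := h
    rw [Finset.prod_eq_zero (Finset.mem_univ l) hl, mul_zero]

lemma blockSign_one {q : ℕ} (l : Fin q) : blockSign (1 : Equiv.Perm (Fin (2 * q))) l = 1 := by
  simp [blockSign]

variable {n : ℕ}

/-- The curvature tensor of the product of a sphere or hyperbolic space of dimension `k` with a
flat space, in an orthonormal frame. -/
def blockCurvature (n k : ℕ) (a b c d : Fin n) : ℝ :=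
  if (a : ℕ) < k ∧ (b : ℕ) < k then
    -2 * ((if a = c ∧ b = d then 1 else 0) - (if a = d ∧ b = c then 1 else 0)) else 0

lemma gaussKronecker_blockCurvature_eq_zero {q k : ℕ} {v : Fin (2 * q) → Fin n} (w)
    {t : Fin (2 * q)} (ht : k ≤ (v t : ℕ)) : gaussKronecker (blockCurvature n k) q v w = 0 := by
  unfold gaussKronecker
  rw [Finset.sum_eq_zero, mul_zero]
  intro σ _
  refine Finset.sum_eq_zero fun τ _ => ?_
  obtain ⟨s, rfl⟩ := σ.surjective t
  rw [Finset.prod_eq_zero (Finset.mem_univ (⟨s / 2, by omega⟩ : Fin q)), mul_zero]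
  unfold blockCurvature
  rw [if_neg]
  rintro ⟨h1, h2⟩
  rcases Nat.even_or_odd' (s : ℕ) with ⟨c, hc | hc⟩
  · have : s = ⟨2 * ((s : ℕ) / 2), by omega⟩ := by ext; simp; omega
    rw [this] at ht; simp only at h1; omega
  · have : s = ⟨2 * ((s : ℕ) / 2) + 1, by omega⟩ := by ext; simp; omega
    rw [this] at ht; simp only at h2; omega

/-- No cancellation occurs: with ρ = τ⁻¹σ each term is (-2)^q times the sign of ρ times its block
signs. This last product is never negative, and it is 1 for σ = τ = 1. -/
lemma gaussKronecker_blockCurvature_ne_zero {q : ℕ} (hq : 2 * q ≤ n) :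
    gaussKronecker (blockCurvature n (2 * q)) q (Fin.castLE hq) (Fin.castLE hq) ≠ 0 := by
  have h1 : ∀ σ τ : Equiv.Perm (Fin (2 * q)),
      ((Equiv.Perm.sign σ : ℤ) : ℝ) * ((Equiv.Perm.sign τ : ℤ) : ℝ) *
      ∏ l : Fin q, blockCurvature n (2 * q) (Fin.castLE hq (σ ⟨2 * l, by omega⟩))
        (Fin.castLE hq (σ ⟨2 * l + 1, by omega⟩)) (Fin.castLE hq (τ ⟨2 * l, by omega⟩))
        (Fin.castLE hq (τ ⟨2 * l + 1, by omega⟩)) = (-2) ^ q *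
      (((Equiv.Perm.sign (τ⁻¹ * σ) : ℤ) : ℝ) * ∏ l, blockSign (τ⁻¹ * σ) l) := by
    intro σ τ
    have h2 : ∀ l : Fin q, blockCurvature n (2 * q) (Fin.castLE hq (σ ⟨2 * l, by omega⟩))
        (Fin.castLE hq (σ ⟨2 * l + 1, by omega⟩)) (Fin.castLE hq (τ ⟨2 * l, by omega⟩))
        (Fin.castLE hq (τ ⟨2 * l + 1, by omega⟩)) = -2 * blockSign (τ⁻¹ * σ) l := by
      intro l
      unfold blockCurvature blockSign
      rw [if_pos (by simp)]
      simp only [(Fin.castLE_injective hq).eq_iff, Equiv.Perm.mul_apply, Equiv.Perm.inv_eq_iff_eq]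
    simp only [h2, Finset.prod_mul_distrib, Finset.prod_const, Finset.card_univ, Fintype.card_fin]
    rw [Equiv.Perm.sign_mul, Equiv.Perm.sign_inv]
    push_cast
    ring
  unfold gaussKronecker
  simp only [h1, ← Finset.mul_sum]
  refine mul_ne_zero (by positivity) (mul_ne_zero (pow_ne_zero _ (by norm_num)) (ne_of_gt ?_))
  refine Finset.sum_pos' (fun σ _ => Finset.sum_nonneg fun τ _ =>
    sign_mul_prod_blockSign_nonneg _) ⟨1, Finset.mem_univ _, ?_⟩
  refine Finset.sum_pos' (fun τ _ => sign_mul_prod_blockSign_nonneg _) ⟨1, Finset.mem_univ _, ?_⟩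
  simp [blockSign_one]

end GaussKronecker

/-! ### Multilinear functions and double forms. -/

section Multilinear

variable {V : Type} [AddCommGroup V] [Module ℝ V] {k : ℕ}

/-- Multilinearity of a real valued function of `k` vectors. -/
def IsMulti (f : (Fin k → V) → ℝ) : Prop :=
  ∃ F : MultilinearMap ℝ (fun _ : Fin k => V) ℝ, ∀ v, f v = F v

/-- Multilinearity in each of the two groups of arguments. -/
def IsBimulti (T : Tensor2 V k) : Prop := (∀ w, IsMulti fun v => T v w) ∧ ∀ v, IsMulti (T v)

lemma isMulti_of_update {f : (Fin k → V) → ℝ}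
    (h : ∀ v s (c : ℝ) x y, f (Function.update v s (c • x + y)) =
      c * f (Function.update v s x) + f (Function.update v s y)) : IsMulti f := by
  have h0 : ∀ v s, f (Function.update v s 0) = 0 := fun v s => by
    have := h v s 1 0 0
    simpa using this
  refine ⟨⟨f, fun {inst} v s x y => ?_, fun {inst} v s c x => ?_⟩, fun v => rfl⟩
  · rw [Subsingleton.elim inst (instDecidableEqFin k)]
    simpa using h v s 1 x y
  · rw [Subsingleton.elim inst (instDecidableEqFin k)]
    simpa [h0] using h v s c x 0

lemma IsMulti.update {f : (Fin k → V) → ℝ} (hf : IsMulti f) (v s) (c : ℝ) (x y : V) :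
    f (Function.update v s (c • x + y)) =
      c * f (Function.update v s x) + f (Function.update v s y) := by
  obtain ⟨F, hF⟩ := hf
  simp [hF]

lemma IsMulti.sum {ι : Type*} (s : Finset ι) {f : ι → (Fin k → V) → ℝ}
    (hf : ∀ i, IsMulti (f i)) : IsMulti fun v => ∑ i ∈ s, f i v := by
  choose F hF using hf
  exact ⟨∑ i ∈ s, F i, fun v => by simp [hF]⟩

lemma IsMulti.const_mul (c : ℝ) {f : (Fin k → V) → ℝ} (hf : IsMulti f) :
    IsMulti fun v => c * f v := by
  obtain ⟨F, hF⟩ := hf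
  exact ⟨c • F, fun v => by simp [hF]⟩

lemma IsMulti.comp_perm {f : (Fin k → V) → ℝ} (hf : IsMulti f) (σ : Equiv.Perm (Fin k)) :
    IsMulti fun v => f fun s => v (σ s) := by
  obtain ⟨F, hF⟩ := hf
  exact ⟨F.domDomCongr σ, fun v => by simp [hF]⟩

lemma IsMulti.comp_append {p : ℕ} {f : (Fin (k + p) → V) → ℝ} (hf : IsMulti f) (u : Fin k → V) :
    IsMulti fun v : Fin p → V => f (Fin.append u v) := by
  refine isMulti_of_update fun v s c x y => ?_
  have : ∀ z, Fin.append u (Function.update v s z) =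
      Function.update (Fin.append u v) (Fin.natAdd k s) z := by
    intro z
    funext j
    refine Fin.addCases (fun i => ?_) (fun i => ?_) j
    · have : Fin.castAdd p i ≠ Fin.natAdd k s := by
        intro h; have := congrArg Fin.val h; simp at this; omega
      rw [Function.update_of_ne this]; simp
    · by_cases h : i = s
      · subst h; simp
      · have : Fin.natAdd k i ≠ Fin.natAdd k s := by simpa [Fin.ext_iff] using h
        rw [Function.update_of_ne this]; simp [h]
  simp only [this, hf.update]

lemma IsMulti.mul_succAbove {f : (Fin k → V) → ℝ} (hf : IsMulti f) (φ : V →ₗ[ℝ] ℝ)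
    (a : Fin (k + 1)) :
    IsMulti fun v : Fin (k + 1) → V => φ (v a) * f fun s => v (a.succAbove s) := by
  refine isMulti_of_update fun v s c x y => ?_
  rcases eq_or_ne s a with rfl | h
  · have h1 : ∀ z, (fun t => Function.update v s z (s.succAbove t)) =
        fun t => v (s.succAbove t) := fun z => funext fun t =>
      Function.update_of_ne (Fin.succAbove_ne s t) _ _
    simp only [h1, Function.update_self, map_add, map_smul, smul_eq_mul]
    ring
  · obtain ⟨t, rfl⟩ := Fin.exists_succAbove_eq h
    have h1 : ∀ z, (fun r => Function.update v (a.succAbove t) z (a.succAbove r)) =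
        Function.update (fun r => v (a.succAbove r)) t z := fun z =>
      Function.update_comp_eq_of_injective v Fin.succAbove_right_injective t z
    simp only [h1, hf.update, Function.update_of_ne h.symm]
    ring

lemma isMulti_prod_linear (φ : Fin k → V →ₗ[ℝ] ℝ) : IsMulti fun v => ∏ s, φ s (v s) :=
  ⟨(MultilinearMap.mkPiAlgebra ℝ (Fin k) ℝ).compLinearMap φ, fun v => by simp⟩

/-- The argument v s occurs only in the factor s / 2, in the first or second slot according to the
parity of s. -/
lemma isMulti_prod_pairs {q : ℕ} (f : Fin q → V → V → ℝ)
    (h1 : ∀ l u (c : ℝ) x y, f l (c • x + y) u = c * f l x u + f l y u)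
    (h2 : ∀ l u (c : ℝ) x y, f l u (c • x + y) = c * f l u x + f l u y) :
    IsMulti fun v : Fin (2 * q) → V =>
      ∏ l : Fin q, f l (v ⟨2 * l, by omega⟩) (v ⟨2 * l + 1, by omega⟩) := by
  refine isMulti_of_update fun v s c x y => ?_
  set l₀ : Fin q := ⟨s / 2, by omega⟩ with hl₀
  have hne : ∀ z, ∏ l ∈ {l₀}ᶜ, f l (Function.update v s z ⟨2 * l, by omega⟩)
      (Function.update v s z ⟨2 * l + 1, by omega⟩) =
      ∏ l ∈ {l₀}ᶜ, f l (v ⟨2 * l, by omega⟩) (v ⟨2 * l + 1, by omega⟩) := by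
    intro z
    refine Finset.prod_congr rfl fun l hl => ?_
    have hl' : (l : ℕ) ≠ s / 2 := by simpa [hl₀, Fin.ext_iff] using hl
    rw [Function.update_of_ne, Function.update_of_ne]
    · intro h; have := congrArg Fin.val h; simp at this; omega
    · intro h; have := congrArg Fin.val h; simp at this; omega
  simp only [Fintype.prod_eq_mul_prod_compl l₀, hne]
  rcases Nat.even_or_odd' (s : ℕ) with ⟨d, hd | hd⟩
  · have e0 : (⟨2 * (l₀ : ℕ), by omega⟩ : Fin (2 * q)) = s := by ext; simp [hl₀]; omega
    have e1 : (⟨2 * (l₀ : ℕ) + 1, by omega⟩ : Fin (2 * q)) ≠ s := by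
      intro h; have := congrArg Fin.val h; simp [hl₀] at this; omega
    simp only [e0, Function.update_self, Function.update_of_ne e1, h1]
    ring
  · have e0 : (⟨2 * (l₀ : ℕ) + 1, by omega⟩ : Fin (2 * q)) = s := by ext; simp [hl₀]; omega
    have e1 : (⟨2 * (l₀ : ℕ), by omega⟩ : Fin (2 * q)) ≠ s := by
      intro h; have := congrArg Fin.val h; simp [hl₀] at this; omega
    simp only [e0, Function.update_self, Function.update_of_ne e1, h2]
    ring

lemma IsDoubleForm.isBimulti {T : Tensor2 V k} (hT : IsDoubleForm T) : IsBimulti T := by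
  obtain ⟨Ω, hΩ⟩ := hT
  refine ⟨fun w => isMulti_of_update fun v s c x y => ?_,
    fun v => ⟨(Ω v).toMultilinearMap, hΩ v⟩⟩
  simp only [hΩ]
  rw [AlternatingMap.map_update_add, AlternatingMap.map_update_smul]
  simp

lemma IsDoubleForm.isBiskew {T : Tensor2 V k} (hT : IsDoubleForm T) : IsBiskew T := by
  obtain ⟨Ω, hΩ⟩ := hT
  refine ⟨fun w σ v => ?_, fun v σ w => ?_⟩
  · have := congrArg (fun F => F w) (Ω.map_perm v σ)
    simp only [hΩ]
    refine Eq.trans this ?_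
    rcases Int.units_eq_one_or (Equiv.Perm.sign σ) with h | h <;> simp [h]
  · have := (Ω v).map_perm w σ
    simp only [hΩ]
    refine Eq.trans this ?_
    rcases Int.units_eq_one_or (Equiv.Perm.sign σ) with h | h <;> simp [h]

lemma IsSkew.eq_zero_of_eq {X : Type} {f : (Fin k → X) → ℝ} (hf : IsSkew f) {v : Fin k → X}
    {i j : Fin k} (h : v i = v j) (hij : i ≠ j) : f v = 0 := by
  have h1 := hf (Equiv.swap i j) v
  have h2 : (fun s => v (Equiv.swap i j s)) = v := by
    funext s
    rcases eq_or_ne s i with rfl | hi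
    · rw [Equiv.swap_apply_left, h]
    · rcases eq_or_ne s j with rfl | hj
      · rw [Equiv.swap_apply_right, h]
      · rw [Equiv.swap_apply_of_ne_of_ne hi hj]
  rw [h2, Equiv.Perm.sign_swap hij] at h1
  push_cast at h1
  linarith

lemma isDoubleForm_of_isBimulti {T : Tensor2 V k} (hT : IsBimulti T) (hs : IsBiskew T) :
    IsDoubleForm T := by
  choose F hF using hT.2
  set Φ : (Fin k → V) → (V [⋀^Fin k]→ₗ[ℝ] ℝ) := fun v =>
    { F v with
      map_eq_zero_of_eq' := fun w i j h hij => by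
        have := (hs.2 v).eq_zero_of_eq h hij
        rw [hF] at this
        exact this } with hΦ
  have hΦ' : ∀ v w, Φ v w = T v w := fun v w => (hF v w).symm
  refine ⟨⟨⟨Φ, fun {inst} v s x y => ?_, fun {inst} v s c x => ?_⟩, fun v i j h hij => ?_⟩,
    fun v w => (hΦ' v w).symm⟩
  · ext w
    rw [Subsingleton.elim inst (instDecidableEqFin k)]
    have := (hT.1 w).update v s 1 x y
    simpa [hΦ'] using this
  · ext w
    rw [Subsingleton.elim inst (instDecidableEqFin k)]
    obtain ⟨G, hG⟩ := hT.1 w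
    simp [hΦ', hG]
  · ext w
    exact (hΦ' v w).trans ((hs.1 w).eq_zero_of_eq h hij)

lemma IsBimulti.sum {ι : Type*} (s : Finset ι) {T : ι → Tensor2 V k} (hT : ∀ i, IsBimulti (T i)) :
    IsBimulti (∑ i ∈ s, T i) := by
  refine ⟨fun w => ?_, fun v => ?_⟩
  · simpa [Finset.sum_apply] using IsMulti.sum s fun i => (hT i).1 w
  · have := IsMulti.sum s fun i => (hT i).2 v
    have e : (∑ i ∈ s, T i) v = fun w => ∑ i ∈ s, T i v w := by
      funext w; simp [Finset.sum_apply]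
    rw [e]; exact this

lemma IsBimulti.smul {T : Tensor2 V k} (hT : IsBimulti T) (c : ℝ) : IsBimulti (c • T) :=
  ⟨fun w => (hT.1 w).const_mul c, fun v => (hT.2 v).const_mul c⟩

lemma isBimulti_zero : IsBimulti (0 : Tensor2 V k) :=
  ⟨fun _ => ⟨0, fun _ => rfl⟩, fun _ => ⟨0, fun _ => rfl⟩⟩

end Multilinear

/-! ### Passage to components in a frame. -/

section Frames

variable {V : Type} {n : ℕ} (e : Fin n → V)

/-- The components of `T` in the frame `e`. -/
def components {k : ℕ} (T : Tensor2 V k) : Tensor2 (Fin n) k := fun A B =>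
  T (fun s => e (A s)) fun s => e (B s)

variable {e} {g : V → V → ℝ}

lemma components_metricMul (he : ∀ a b, g (e a) (e b) = frameMetric n a b) {k : ℕ}
    (T : Tensor2 V k) :
    components e (metricMul g T) = metricMul (frameMetric n) (components e T) := by
  funext A B
  simp only [components, metricMul, he]

lemma components_metricPow (he : ∀ a b, g (e a) (e b) = frameMetric n a b) {i : ℕ} (m : ℕ)
    (T : Tensor2 V i) :
    components e (metricPow g m T) = metricPow (frameMetric n) m (components e T) := by
  rcases lt_or_ge m i with h | h
  · rw [metricPow_of_lt g h, metricPow_of_lt _ h]; rfl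
  · induction m, h using Nat.le_induction with
    | base => simp
    | succ m h ih => rw [metricPow_succ g h, metricPow_succ _ h, components_metricMul he, ih]

lemma components_contract {k : ℕ} (T : Tensor2 V (k + 1)) :
    components e (contract e T) = trace (components e T) := by
  funext A B
  simp only [components, contract, id]
  refine Finset.sum_congr rfl fun a _ => ?_
  have : ∀ C : Fin k → Fin n, (Fin.cons (e a) fun s => e (C s) : Fin (k + 1) → V) =
      fun s => e ((Fin.cons a C : Fin (k + 1) → Fin n) s) := fun C => by
    funext s
    refine Fin.cases rfl (fun s => rfl) s
  rw [this, this]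

lemma components_deltaContract (he : ∀ a b, g (e a) (e b) = frameMetric n a b) {p k : ℕ}
    (T : Tensor2 V k) :
    components e (deltaContract g e p T) = frameContract p (components e T) := by
  funext A B
  have : ∀ C : Fin k → Fin n, ∀ A : Fin p → Fin n,
      (Fin.append (fun s => e (C s)) fun s => e (A s)) = fun s => e (Fin.append C A s) := by
    intro C A
    funext s
    refine Fin.addCases (fun i => ?_) (fun i => ?_) s <;> simp
  simp only [components, frameContract, deltaContract, this, kronecker, he, id]

lemma components_sum {ι : Type*} {k : ℕ} (s : Finset ι) (T : ι → Tensor2 V k) :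
    components e (∑ i ∈ s, T i) = ∑ i ∈ s, components e (T i) := by
  funext A B
  simp [components, Finset.sum_apply]

lemma components_smul {k : ℕ} (c : ℝ) (T : Tensor2 V k) :
    components e (c • T) = c • components e T := rfl

lemma IsBiskew.components {k : ℕ} {T : Tensor2 V k} (hT : IsBiskew T) :
    IsBiskew (components e T) :=
  ⟨fun B σ A => hT.1 (fun s => e (B s)) σ fun s => e (A s),
    fun A σ B => hT.2 (fun s => e (A s)) σ fun s => e (B s)⟩

end Frames

/-! ### Recovering tensors from their components. -/

section OrthonormalBasis

variable {V : Type} [AddCommGroup V] [Module ℝ V] {n : ℕ}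
  {g : V → V → ℝ} {e : Fin n → V}

/-- `g` is a symmetric bilinear form and `e` is an orthonormal basis. -/
structure IsOrthonormalBasis (g : V → V → ℝ) (e : Fin n → V) : Prop where
  add_smul : ∀ (c : ℝ) x y u, g (c • x + y) u = c * g x u + g y u
  symm : ∀ x y, g x y = g y x
  apply : ∀ a b, g (e a) (e b) = frameMetric n a b
  expand : ∀ u, u = ∑ a, g (e a) u • e a

/-- The linear functional `g u`. -/
def IsOrthonormalBasis.dual (he : IsOrthonormalBasis g e) (u : V) : V →ₗ[ℝ] ℝ where
  toFun := g u
  map_add' x y := by simpa [he.symm u] using he.add_smul 1 x y u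
  map_smul' c x := by
    have h0 : g 0 u = 0 := by simpa using he.add_smul 1 0 0 u
    simpa [he.symm u, h0] using he.add_smul c x 0 u

lemma IsOrthonormalBasis.dual_apply (he : IsOrthonormalBasis g e) (u v : V) :
    he.dual u v = g u v := rfl

lemma IsMulti.eq_sum {k : ℕ} {f : (Fin k → V) → ℝ} (hf : IsMulti f)
    (he : IsOrthonormalBasis g e) (v : Fin k → V) :
    f v = ∑ A : Fin k → Fin n, (∏ s, g (e (A s)) (v s)) * f fun s => e (A s) := by
  obtain ⟨F, hF⟩ := hf
  have h1 : v = fun s => ∑ a, g (e a) (v s) • e a := funext fun s => he.expand _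
  rw [hF]
  conv_lhs => rw [h1]
  rw [MultilinearMap.map_sum]
  refine Finset.sum_congr rfl fun A _ => ?_
  rw [F.map_smul_univ, hF, smul_eq_mul]

/-- Expand every argument in the basis. Identities proved for components are carried back to the
tangent space by this lemma. -/
lemma IsBimulti.ext {k : ℕ} {T S : Tensor2 V k} (hT : IsBimulti T) (hS : IsBimulti S)
    (he : IsOrthonormalBasis g e) (h : components e T = components e S) : T = S := by
  funext v w
  rw [(hT.1 w).eq_sum he, (hS.1 w).eq_sum he]
  refine Finset.sum_congr rfl fun A _ => ?_
  rw [(hT.2 _).eq_sum he, (hS.2 _).eq_sum he]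
  congr 1
  refine Finset.sum_congr rfl fun B _ => ?_
  congr 1
  exact congrFun (congrFun h A) B

lemma IsBimulti.transpose {k : ℕ} {T : Tensor2 V k} (hT : IsBimulti T) :
    IsBimulti (transpose T) := ⟨hT.2, hT.1⟩

lemma IsOrthonormalBasis.isBimulti_metricMul (he : IsOrthonormalBasis g e) {k : ℕ}
    {T : Tensor2 V k} (hT : IsBimulti T) : IsBimulti (metricMul g T) := by
  have key : ∀ {S : Tensor2 V k}, IsBimulti S → ∀ w, IsMulti fun v => metricMul g S v w := by
    intro S hS w
    refine IsMulti.sum _ fun a => IsMulti.sum _ fun b => ?_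
    have := ((hS.1 fun s => w (b.succAbove s)).mul_succAbove (he.dual (w b)) a).const_mul
      ((-1 : ℝ) ^ ((a : ℕ) + (b : ℕ)))
    simpa only [he.dual_apply, he.symm (w b), mul_assoc] using this
  refine ⟨key hT, fun v => ?_⟩
  have := key hT.transpose v
  rw [metricMul_transpose he.symm] at this
  exact this

lemma IsOrthonormalBasis.isBimulti_metricPow (he : IsOrthonormalBasis g e) {i : ℕ} (m : ℕ)
    {T : Tensor2 V i} (hT : IsBimulti T) : IsBimulti (metricPow g m T) := by
  rcases lt_or_ge m i with h | h
  · rw [metricPow_of_lt g h]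
    exact isBimulti_zero
  · induction m, h using Nat.le_induction with
    | base => simpa using hT
    | succ m h ih => rw [metricPow_succ g h]; exact he.isBimulti_metricMul ih

lemma IsOrthonormalBasis.isMulti_kronecker (he : IsOrthonormalBasis g e) {m : ℕ}
    (w : Fin m → V) : IsMulti fun u : Fin m → V => kronecker g u w :=
  ⟨(Matrix.detRowAlternating (n := Fin m) (R := ℝ)).toMultilinearMap.compLinearMap
    fun _ => LinearMap.pi fun s => he.dual (w s), fun u => by
      simp only [kronecker, MultilinearMap.compLinearMap_apply, he.symm (u _)]
      rfl⟩

lemma IsOrthonormalBasis.kronecker_comm (he : IsOrthonormalBasis g e) {m : ℕ}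
    (u w : Fin m → V) : kronecker g u w = kronecker g w u := by
  rw [kronecker, ← Matrix.det_transpose]
  simp only [kronecker, Matrix.transpose, Matrix.of_apply, he.symm (u _)]

lemma IsOrthonormalBasis.isBimulti_deltaContract (he : IsOrthonormalBasis g e) (p : ℕ) {k : ℕ}
    (T : Tensor2 V k) : IsBimulti (deltaContract g e p T) := by
  constructor
  · intro w
    refine (IsMulti.sum _ fun A => IsMulti.sum _ fun B => ?_).const_mul _
    have := ((he.isMulti_kronecker (Fin.append (fun s => e (B s)) w)).comp_append
      fun s => e (A s)).const_mul (T (fun s => e (A s)) fun s => e (B s))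
    simpa only [mul_comm] using this
  · intro v
    refine (IsMulti.sum _ fun A => IsMulti.sum _ fun B => ?_).const_mul _
    have := ((he.isMulti_kronecker (Fin.append (fun s => e (A s)) v)).comp_append
      fun s => e (B s)).const_mul (T (fun s => e (A s)) fun s => e (B s))
    simpa only [mul_comm, he.kronecker_comm] using this

/-- Linearity in the first pair of arguments is enough, because the pair symmetry exchanges the two
groups. -/
lemma isBimulti_gaussKronecker {R : V → V → V → V → ℝ}
    (h1 : ∀ (c : ℝ) x y u₂ v₁ v₂, R (c • x + y) u₂ v₁ v₂ = c * R x u₂ v₁ v₂ + R y u₂ v₁ v₂)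
    (h2 : ∀ (c : ℝ) x y u₁ v₁ v₂, R u₁ (c • x + y) v₁ v₂ = c * R u₁ x v₁ v₂ + R u₁ y v₁ v₂)
    (hR : ∀ a b c d, R a b c d = R c d a b) (q : ℕ) : IsBimulti (gaussKronecker R q) := by
  have key : ∀ w, IsMulti fun v => gaussKronecker R q v w := by
    intro w
    refine (IsMulti.sum _ fun σ => IsMulti.sum _ fun τ => IsMulti.const_mul _ ?_).const_mul _
    exact (isMulti_prod_pairs (fun l x y => R x y (w (τ ⟨2 * l, by omega⟩))
      (w (τ ⟨2 * l + 1, by omega⟩))) (fun l u c x y => h1 c x y u _ _)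
      fun l u c x y => h2 c x y u _ _).comp_perm σ
  refine ⟨key, fun v => ?_⟩
  have := key v
  rw [← gaussKronecker_symm hR] at this
  exact this

/-- The tensor with components `t` in the frame `e`. -/
def ofComponents (g : V → V → ℝ) (e : Fin n → V) {k : ℕ} (t : Tensor2 (Fin n) k) : Tensor2 V k :=
  fun v w => ∑ A : Fin k → Fin n, ∑ B : Fin k → Fin n,
    (∏ s, g (e (A s)) (v s)) * (∏ s, g (e (B s)) (w s)) * t A B

lemma IsOrthonormalBasis.components_ofComponents (he : IsOrthonormalBasis g e) {k : ℕ}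
    (t : Tensor2 (Fin n) k) : components e (ofComponents g e t) = t := by
  funext A B
  simp only [components, ofComponents, he.apply, mul_assoc, ← Finset.mul_sum,
    frameMetric_symm _ (A _), frameMetric_symm _ (B _), sum_prod_frameMetric_mul]

lemma IsOrthonormalBasis.isDoubleForm_ofComponents (he : IsOrthonormalBasis g e) {k : ℕ}
    {t : Tensor2 (Fin n) k} (ht : IsBiskew t) : IsDoubleForm (ofComponents g e t) := by
  refine isDoubleForm_of_isBimulti ⟨fun w => ?_, fun v => ?_⟩ ⟨fun w σ v => ?_, fun v σ w => ?_⟩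
  · refine IsMulti.sum _ fun A => IsMulti.sum _ fun B => ?_
    have := (isMulti_prod_linear fun s => he.dual (e (A s))).const_mul
      ((∏ s, g (e (B s)) (w s)) * t A B)
    simpa only [he.dual_apply, mul_comm, mul_left_comm, mul_assoc] using this
  · refine IsMulti.sum _ fun A => IsMulti.sum _ fun B => ?_
    have := (isMulti_prod_linear fun s => he.dual (e (B s))).const_mul
      ((∏ s, g (e (A s)) (v s)) * t A B)
    simpa only [he.dual_apply, mul_comm, mul_left_comm, mul_assoc] using this
  · simp only [ofComponents, Finset.mul_sum]
    rw [← Equiv.sum_comp (Equiv.arrowCongr σ⁻¹ (Equiv.refl (Fin n)))]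
    refine Finset.sum_congr rfl fun A _ => Finset.sum_congr rfl fun B _ => ?_
    have h1 : ∀ s, (Equiv.arrowCongr σ⁻¹ (Equiv.refl (Fin n))) A s = A (σ s) := fun s => rfl
    have h2 : (Equiv.arrowCongr σ⁻¹ (Equiv.refl (Fin n))) A = fun s => A (σ s) := rfl
    simp only [h1]
    rw [h2, show t (fun s => A (σ s)) B = _ from ht.1 B σ A, Equiv.prod_comp σ fun s => g (e (A s)) (v s)]
    ring
  · simp only [ofComponents, Finset.mul_sum]
    refine Finset.sum_congr rfl fun A _ => ?_
    rw [← Equiv.sum_comp (Equiv.arrowCongr σ⁻¹ (Equiv.refl (Fin n)))]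
    refine Finset.sum_congr rfl fun B _ => ?_
    have h1 : ∀ s, (Equiv.arrowCongr σ⁻¹ (Equiv.refl (Fin n))) B s = B (σ s) := fun s => rfl
    have h2 : (Equiv.arrowCongr σ⁻¹ (Equiv.refl (Fin n))) B = fun s => B (σ s) := rfl
    simp only [h1]
    rw [h2, ht.2 A σ B, Equiv.prod_comp σ fun s => g (e (B s)) (w s)]
    ring

lemma IsMulti.comp_cons {k : ℕ} {f : (Fin (k + 1) → V) → ℝ} (hf : IsMulti f) (x : V) :
    IsMulti fun v : Fin k → V => f (Fin.cons x v) := by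
  obtain ⟨F, hF⟩ := hf
  exact ⟨F.curryLeft x, fun v => by simp [hF]⟩

lemma IsBimulti.contract {k : ℕ} {T : Tensor2 V (k + 1)} (hT : IsBimulti T) :
    IsBimulti (contract e T) :=
  ⟨fun w => IsMulti.sum _ fun a => (hT.1 (Fin.cons (e a) w)).comp_cons (e a),
    fun v => IsMulti.sum _ fun a => (hT.2 (Fin.cons (e a) v)).comp_cons (e a)⟩

/-- Contraction and multiplication by the metric commute with taking components. Multilinearity is
what allows the way back. -/
lemma IsOrthonormalBasis.isTraceFreeDecomposition_iff (he : IsOrthonormalBasis g e) {k : ℕ}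
    {T : Tensor2 V k} (hT : IsBimulti T) {θ : (i : ℕ) → Tensor2 V i} :
    IsTraceFreeDecomposition g e T θ ↔ (∀ i, IsDoubleForm (θ i)) ∧
      IsFrameDecomposition (components e T) fun i => components e (θ i) := by
  constructor
  · intro h
    refine ⟨h.isDoubleForm, fun i => (h.isDoubleForm i).isBiskew.components, fun i => ?_,
      fun i hi => ?_, ?_⟩
    · cases i with
      | zero => trivial
      | succ i =>
        show trace (components e (θ (i + 1))) = 0
        rw [← components_contract, h.traceFree]
        rfl
    · rw [h.eq_zero i hi]; rfl
    · conv_lhs => rw [h.eq_sum]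
      rw [components_sum]
      simp only [components_metricPow he.apply]
  · rintro ⟨h1, h2⟩
    refine ⟨h1, fun i => ?_, fun i hi => ?_, ?_⟩
    · refine (h1 _).isBimulti.contract.ext isBimulti_zero he ?_
      rw [components_contract]
      exact h2.traceFree (i + 1)
    · exact (h1 i).isBimulti.ext isBimulti_zero he (h2.eq_zero i hi)
    · refine hT.ext (IsBimulti.sum _ fun i => he.isBimulti_metricPow k (h1 i).isBimulti) he ?_
      rw [components_sum]
      simp only [components_metricPow he.apply]
      exact h2.eq_sum

lemma IsOrthonormalBasis.existsUnique_isTraceFreeDecomposition (he : IsOrthonormalBasis g e)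
    {k : ℕ} (hk : k ≤ n) {T : Tensor2 V k} (hT : IsBimulti T) (hs : IsBiskew T) :
    ∃! θ, IsTraceFreeDecomposition g e T θ := by
  obtain ⟨t, ht⟩ := exists_isFrameDecomposition (hs.components (e := e)) hk
  have h : IsTraceFreeDecomposition g e T fun i => ofComponents g e (t i) := by
    rw [he.isTraceFreeDecomposition_iff hT]
    refine ⟨fun i => he.isDoubleForm_ofComponents (ht.isBiskew i), ?_⟩
    simpa only [he.components_ofComponents] using ht
  refine ⟨_, h, fun θ hθ => ?_⟩
  have h1 := ((he.isTraceFreeDecomposition_iff hT).1 hθ).2.unique hk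
    ((he.isTraceFreeDecomposition_iff hT).1 h).2
  funext i
  exact (hθ.isDoubleForm i).isBimulti.ext (h.isDoubleForm i).isBimulti he (congrFun h1 i)

end OrthonormalBasis

/-! ### Coefficients of the expansion. -/

section Expansion

lemma IsFrameDecomposition.transpose {n k : ℕ} {T : Tensor2 (Fin n) k}
    {θ : (i : ℕ) → Tensor2 (Fin n) i} (h : IsFrameDecomposition T θ) :
    IsFrameDecomposition (transpose T) fun i => transpose (θ i) := by
  refine ⟨fun i => (h.isBiskew i).transpose, fun i => ?_, fun i hi => ?_, ?_⟩
  · have := h.traceFree i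
    cases i with
    | zero => trivial
    | succ i =>
      have h0 : trace (θ (i + 1)) = 0 := this
      show trace (DoubleForms.transpose (θ (i + 1))) = 0
      funext v w
      exact congrFun (congrFun h0 w) v
  · rw [h.eq_zero i hi]; rfl
  · simp only [metricPow_transpose (g := frameMetric n) frameMetric_symm]
    conv_lhs => rw [h.eq_sum]
    funext v w
    simp [DoubleForms.transpose, Finset.sum_apply]

/-- The coefficient of `g ^ (p - i) θ_i` in the `(p,q)`-curvature tensor. -/
def expansionCoeff (n p q i : ℕ) : ℝ :=
  (∏ s ∈ Finset.Ico i (2 * q), ((n : ℝ) - s - p)) * contractCoeff i p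

lemma expansionCoeff_of_lt {n p q i : ℕ} (h : p < i) : expansionCoeff n p q i = 0 := by
  rw [expansionCoeff, contractCoeff, if_pos h, mul_zero]

lemma expansionCoeff_ne_zero {n p q i : ℕ} (hpq : p + 2 * q ≤ n) (h : i ≤ p) :
    expansionCoeff n p q i ≠ 0 := by
  refine mul_ne_zero (Finset.prod_ne_zero_iff.2 fun s hs => ne_of_gt ?_) (contractCoeff_ne_zero h)
  have h1 : s + p + 1 ≤ n := by have := (Finset.mem_Ico.1 hs).2; omega
  have h2 : (s : ℝ) + p + 1 ≤ n := by exact_mod_cast h1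
  linarith

lemma deltaContract_sum {X : Type} {n : ℕ} {g : X → X → ℝ} {e : Fin n → X} (p : ℕ) {k : ℕ} {ι : Type*}
    (s : Finset ι) (T : ι → Tensor2 X k) :
    deltaContract g e p (∑ i ∈ s, T i) = ∑ i ∈ s, deltaContract g e p (T i) := by
  funext v w
  simp only [deltaContract, Finset.sum_apply, Finset.mul_sum]
  symm
  rw [Finset.sum_comm]
  refine Finset.sum_congr rfl fun A _ => ?_
  rw [Finset.sum_comm]

variable {V : Type} [AddCommGroup V] [Module ℝ V] {n : ℕ} {g : V → V → ℝ} {e : Fin n → V}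

lemma IsOrthonormalBasis.deltaContract_metricPow (he : IsOrthonormalBasis g e) (p : ℕ) {q : ℕ}
    (hq : 2 * q ≤ n) {T : Tensor2 V (2 * q)} (hT : IsBimulti T) (hs : transpose T = T)
    {θ : (i : ℕ) → Tensor2 V i} (hθ : IsTraceFreeDecomposition g e T θ) {i : ℕ}
    (hi : i ≤ 2 * q) : deltaContract g e p (metricPow g (2 * q) (θ i)) =
      expansionCoeff n p q i • metricPow g p (θ i) := by
  obtain ⟨h1, h2⟩ := (he.isTraceFreeDecomposition_iff hT).1 hθ
  -- As T is symmetric, the transposed components decompose it too, so by uniqueness each component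
  -- is symmetric.
  have h3 : IsFrameDecomposition (components e T) fun i => transpose (components e (θ i)) := by
    have := h2.transpose
    rwa [show transpose (components e T) = components e (transpose T) from rfl, hs] at this
  refine (he.isBimulti_deltaContract p _).ext
    ((he.isBimulti_metricPow p (h1 i).isBimulti).smul _) he ?_
  rw [components_deltaContract he.apply, components_smul, components_metricPow he.apply,
    components_metricPow he.apply, frameContract_metricPow hi,
    frameContract_of_isTraceFree (h2.isBiskew i) (h2.traceFree i) (congrFun (h3.unique hq h2) i),
    smul_smul, expansionCoeff]

lemma IsOrthonormalBasis.metricPow_ne_zero (he : IsOrthonormalBasis g e) {p k : ℕ}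
    {T : Tensor2 V k} (hT : IsBimulti T) {θ : (i : ℕ) → Tensor2 V i}
    (hθ : IsTraceFreeDecomposition g e T θ) {i : ℕ} (hi : i ≤ p) (hp : p + i ≤ n)
    (h0 : θ i ≠ 0) : metricPow g p (θ i) ≠ 0 := by
  obtain ⟨h1, h2⟩ := (he.isTraceFreeDecomposition_iff hT).1 hθ
  intro h
  refine h0 ((h1 i).isBimulti.ext isBimulti_zero he ?_)
  refine eq_zero_of_metricPow_eq_zero (h2.isBiskew i) (h2.traceFree i) hi hp ?_
  rw [← components_metricPow he.apply, h]
  rfl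

/-- Pairing with the e b reads off coefficients, so n orthonormal vectors are independent and hence
span. -/
lemma isOrthonormalBasis_of_finrank [FiniteDimensional ℝ V] (hV : Module.finrank ℝ V = n)
    (h1 : ∀ (c : ℝ) x y u, g (c • x + y) u = c * g x u + g y u) (h2 : ∀ x y, g x y = g y x)
    (h3 : ∀ a b, g (e a) (e b) = frameMetric n a b) : IsOrthonormalBasis g e := by
  have h0 : ∀ u, g u 0 = 0 := fun u => by simpa [h2 u] using h1 1 0 0 u
  have hsum : ∀ (c : Fin n → ℝ) (b : Fin n), g (e b) (∑ a, c a • e a) = c b := by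
    intro c b
    have : ∀ s : Finset (Fin n), g (e b) (∑ a ∈ s, c a • e a) =
        ∑ a ∈ s, c a * frameMetric n a b := by
      intro s
      induction s using Finset.induction_on with
      | empty => simp [h0]
      | insert a s ha ih =>
        rw [Finset.sum_insert ha, Finset.sum_insert ha, h2, h1, h3, h2 _ (e b), ih]
    rw [this]
    simp [frameMetric]
  have hli : LinearIndependent ℝ e := by
    rw [Fintype.linearIndependent_iff]
    intro c hc b
    rw [← hsum c b, hc, h0]
  refine ⟨h1, h2, h3, fun u => ?_⟩
  obtain ⟨c, hc⟩ := (Submodule.mem_span_range_iff_exists_fun ℝ).1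
    (show u ∈ Submodule.span ℝ (Set.range e) by
      rw [hli.span_eq_top_of_card_eq_finrank' (by simp [hV])]; trivial)
  simp only [← hc, hsum]

end Expansion

/-! ### The expansion on Riemannian manifolds. -/

namespace RiemannianManifold

variable {n : ℕ} {M : RiemannianManifold n} {x : M.carrier} {e : Fin n → M.Tangent x}

lemma IsOrthonormalFrame.isOrthonormalBasis (he : M.IsOrthonormalFrame x e) :
    IsOrthonormalBasis (M.g x) e := by
  have : FiniteDimensional ℝ (M.Tangent x) :=
    inferInstanceAs (FiniteDimensional ℝ (EuclideanSpace ℝ (Fin n)))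
  refine isOrthonormalBasis_of_finrank ?_ (fun c u v w => ?_) (fun u v => M.metric.symm x u v) he
  · exact finrank_euclideanSpace_fin (𝕜 := ℝ) (n := n)
  · simp [g]

lemma tangentCoord_add_smul (c : ℝ) (u v : M.Tangent x) (i : Fin n) :
    M.tangentCoord x (c • u + v) i = c * M.tangentCoord x u i + M.tangentCoord x v i := by
  simp only [tangentCoord, map_add, map_smul]
  rfl

lemma isBimulti_Rpow (x : M.carrier) (q : ℕ) : IsBimulti (M.Rpow x q) := by
  refine isBimulti_gaussKronecker (fun c u v u₂ v₁ v₂ => ?_) (fun c u v u₁ v₁ v₂ => ?_)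
    (riemann_pair_symm x) q
  all_goals
    simp only [riemann, Finset.mul_sum, ← Finset.sum_add_distrib, tangentCoord_add_smul]
    refine Finset.sum_congr rfl fun i _ => Finset.sum_congr rfl fun j _ =>
      Finset.sum_congr rfl fun k _ => Finset.sum_congr rfl fun l _ => ?_
    ring

lemma transpose_Rpow (x : M.carrier) (q : ℕ) : transpose (M.Rpow x q) = M.Rpow x q :=
  gaussKronecker_symm (riemann_pair_symm x) q

lemma IsOrthonormalFrame.existsUnique_isComponents (he : M.IsOrthonormalFrame x e) {q : ℕ}
    (hq : 2 * q ≤ n) : ∃! θ, M.IsComponents x e q θ :=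
  he.isOrthonormalBasis.existsUnique_isTraceFreeDecomposition hq (isBimulti_Rpow x q)
    (isBiskew_gaussKronecker _ q)

lemma IsComponents.contribution_eq {q : ℕ} {θ : (i : ℕ) → Tensor2 (M.Tangent x) i}
    (hθ : M.IsComponents x e q θ) (he : M.IsOrthonormalFrame x e) (p : ℕ) (hq : 2 * q ≤ n)
    {i : ℕ} (hi : i ≤ 2 * q) : M.contribution x e p q (θ i) =
      expansionCoeff n p q i • metricPow (M.g x) p (θ i) :=
  he.isOrthonormalBasis.deltaContract_metricPow p hq (isBimulti_Rpow x q) (transpose_Rpow x q)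
    hθ hi

lemma IsComponents.Rpq_eq {q : ℕ} {θ : (i : ℕ) → Tensor2 (M.Tangent x) i}
    (hθ : M.IsComponents x e q θ) (he : M.IsOrthonormalFrame x e) (p : ℕ) (hq : 2 * q ≤ n) :
    M.Rpq x e p q = ∑ i ∈ Finset.range (2 * q + 1),
      expansionCoeff n p q i • metricPow (M.g x) p (θ i) := by
  have h : M.Rpq x e p q = deltaContract (M.g x) e p (M.Rpow x q) := rfl
  rw [h, IsTraceFreeDecomposition.eq_sum hθ, deltaContract_sum]
  exact Finset.sum_congr rfl fun i hi =>
    hθ.contribution_eq he p hq (Nat.lt_succ_iff.1 (Finset.mem_range.1 hi))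

/-- The witness is the block metric with 2q curved directions, at the origin. -/
lemma exists_isComponents_top_ne_zero {n q : ℕ} (hq : 2 * q ≤ n) :
    ∃ (M : RiemannianManifold n) (x : M.carrier) (e : Fin n → M.Tangent x),
      M.IsOrthonormalFrame x e ∧
        ∃ θ, M.IsComponents x e q θ ∧ θ (min (2 * q) (n - 2 * q)) ≠ 0 := by
  have he := isOrthonormalFrame_block n (2 * q)
  obtain ⟨θ, hθ, -⟩ := he.existsUnique_isComponents hq
  refine ⟨blockManifold n (2 * q), blockPoint n (2 * q), blockFrame n (2 * q), he, θ, hθ, ?_⟩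
  have h := (he.isOrthonormalBasis.isTraceFreeDecomposition_iff (isBimulti_Rpow _ q)).1 hθ
  have hR : components (blockFrame n (2 * q))
      ((blockManifold n (2 * q)).Rpow (blockPoint n (2 * q)) q) =
        gaussKronecker (blockCurvature n (2 * q)) q := by
    funext A B
    simp only [components, Rpow, gaussKronecker, riemann_block, blockCurvature]
  rw [hR] at h
  intro h0
  refine h.2.top_ne_zero hq (fun v t ht => gaussKronecker_blockCurvature_eq_zero v ht)
    (gaussKronecker_blockCurvature_ne_zero hq) ?_
  rw [h0]
  rfl

end RiemannianManifold

end DoubleForms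

end

theorem mainTheorem11 (n p q : ℕ) (hq : 1 ≤ q) (hpq : p + 2 * q ≤ n) :
    -- the orthogonal decomposition of `R^q` exists and is unique
    (∀ (M : DoubleForms.RiemannianManifold n) (x : M.carrier) (e : Fin n → M.Tangent x),
      M.IsOrthonormalFrame x e → ∃! θ, M.IsComponents x e q θ) ∧
    -- the expansion of `R^(p,q)`: some coefficient is zero exactly if `p < min {2q, n - 2q}`
    (∃ a : ℕ → ℝ,
      (∀ i, p < i → a i = 0) ∧
      (∀ (M : DoubleForms.RiemannianManifold n) (x : M.carrier) (e : Fin n → M.Tangent x),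
        M.IsOrthonormalFrame x e → ∀ θ, M.IsComponents x e q θ →
          M.Rpq x e p q = ∑ i ∈ Finset.range (2 * q + 1),
            a i • DoubleForms.metricPow (M.g x) p (θ i) ∧
          ∀ i ≤ 2 * q,
            M.contribution x e p q (θ i) = a i • DoubleForms.metricPow (M.g x) p (θ i)) ∧
      ((∀ i ≤ 2 * q,
        (∃ (M : DoubleForms.RiemannianManifold n) (x : M.carrier) (e : Fin n → M.Tangent x),
          M.IsOrthonormalFrame x e ∧ ∃ θ, M.IsComponents x e q θ ∧ θ i ≠ 0) → a i ≠ 0) ↔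
        min (2 * q) (n - 2 * q) ≤ p)) ∧
    -- the nonzero components always give nonzero contributions exactly if `p ≥ min {2q, n - 2q}`
    ((∀ (M : DoubleForms.RiemannianManifold n) (x : M.carrier) (e : Fin n → M.Tangent x),
      M.IsOrthonormalFrame x e → ∀ θ, M.IsComponents x e q θ →
        ∀ i ≤ 2 * q, θ i ≠ 0 → M.contribution x e p q (θ i) ≠ 0) ↔
      min (2 * q) (n - 2 * q) ≤ p) := by
  have hn : 2 * q ≤ n := by omega
  refine ⟨fun M x e he => he.existsUnique_isComponents hn, ⟨DoubleForms.expansionCoeff n p q,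
    fun i hi => DoubleForms.expansionCoeff_of_lt hi, fun M x e he θ hθ =>
      ⟨hθ.Rpq_eq he p hn, fun i hi => hθ.contribution_eq he p hn hi⟩, fun h => ?_,
    fun h i _ ⟨M, x, e, _, θ, hθ, h0⟩ => ?_⟩, fun h => ?_, fun h M x e he θ hθ i hi h0 => ?_⟩
  · by_contra! hp
    -- The index is min(2q, n-2q): its component occurs on the test manifold, but its coefficient is
    -- zero because p is smaller.
    exact h _ (min_le_left _ _) (DoubleForms.RiemannianManifold.exists_isComponents_top_ne_zero hn)
      (DoubleForms.expansionCoeff_of_lt hp)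
  · refine DoubleForms.expansionCoeff_ne_zero hpq (le_trans ?_ h)
    by_contra! hlt
    exact h0 (DoubleForms.IsTraceFreeDecomposition.eq_zero hθ i hlt)
  · by_contra! hp
    obtain ⟨M, x, e, he, θ, hθ, h0⟩ :=
      DoubleForms.RiemannianManifold.exists_isComponents_top_ne_zero hn
    refine h M x e he θ hθ _ (min_le_left _ _) h0 ?_
    rw [hθ.contribution_eq he p hn (min_le_left _ _), DoubleForms.metricPow_of_lt _ hp, smul_zero]
  · have hip : i ≤ p := by
      refine le_trans ?_ h
      by_contra! hlt
      exact h0 (DoubleForms.IsTraceFreeDecomposition.eq_zero hθ i hlt)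
    rw [hθ.contribution_eq he p hn hi]
    -- Besides the coefficient, g^{p-i} θ_i must be non-zero; this holds because i ≤ 2q gives p + i
    -- ≤ n.
    exact smul_ne_zero (DoubleForms.expansionCoeff_ne_zero hpq hip)
      (he.isOrthonormalBasis.metricPow_ne_zero (DoubleForms.RiemannianManifold.isBimulti_Rpow x q)
        hθ hip (by omega) h0)
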